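/- **Definitions.** For a small category $\mathcal C$, $B\mathcal C$ denotes its classifying space (the geometric realization of its nerve); for a poset $P$, viewed as a category, $|P|=BP$, which is the geometric realization of the order complex of $P$ (the simplicial complex of finite nonempty chains of $P$). For a group $G$, $BG$ is the classifying space of the one-object category with endomorphism group $G$. A *freely oriented matroid* $(\widetilde E,\widetilde M)$ is a finite set $\widetilde E$ with a fixed-point-free involution $e\mapsto\overline e$ and a collection $\widetilde M$ of nonempty subsets of $\widetilde E$ (the *circuits*) such that, for all $C,C_1,C_2\in\widetilde M$: (1) $C\cap\overline C=\emptyset$; (2) $\overline C\in\widetilde M$; (3) if $C_1\subseteq C_2\cup\overline{C_2}$ then $C_1=C_2$ or $C_1=\overline{C_2}$; (4) if $C_1\ne C_2$ and $e\in C_1\cap C_2$, there is $C_3\in\widetilde M$ with $C_3\subseteq (C_1\setminus e)\cup\overline{C_2\setminus e}$. A subset $A\subseteq\widetilde E$ is *independent* if $A\cap\overline A=\emptyset$ and $A\cup\overline A$ contains no circuit; *bases* are the maximal independent sets, and the *rank* is the number of elements of a basis. A *morphism* is an injective map commuting with the involutions under which a subset is a circuit if and only if its image is a circuit. A *unipotent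 representation over $\mathbb R$* is a map $\rho$ from $\widetilde E$ to a real vector space $V$ such that $\rho(e)+\rho(\overline e)=0$ for all $e$; every circuit $C$ has positive reals $a_e$ with $\sum_{e\in C}a_e\rho(e)=0$; $\rho$ maps every independent set injectively onto a linearly independent set; $\rho(\widetilde E)$ spans $V$; and the images of any two bases have the same volume in $V$. A freely oriented matroid is *regular* if it has a unipotent representation over $\mathbb R$. Let $\mathcal R(r,\mathbb Z)$ be the category of regular freely oriented matroids of rank $r$ with the above morphisms. (The class of objects may be replaced by any small skeleton, or by the matroids whose underlying set lies in a fixed universe.) Let $IR(r,\mathbb Z)$ be the poset, ordered by inclusion, of all subsets $\widetilde E\subseteq\mathbb Z^r$ such that $0\notin\widetilde E$, $\widetilde E=-\widetilde E$, $\widetilde E$ generates $\mathbb Z^r$ additively, and any $r$ linearly independent elements of $\widetilde E$ generate $\mathbb Z^r$. **Theorem.** The space $|IR(2,\mathbb Z)|$ is contractible. More precisely, it is an infinite tree: $IR(2,\mathbb Z)$ is infinite and has no chain of three elements, so that its order complex is a graph, and this graph (the comparability graph of the poset) is a tree. Moreover, there is a homotopy equivalence $$B\mathcal R(2,\mathbb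 Z)\simeq BGL(2,\mathbb Z).$$ -/

import Mathlib

open CategoryTheory
open scoped ContinuousMap MatrixGroups

universe u v

/-- The classifying space `BC` of a category `C`: the geometric realization of its nerve.
For a poset `P`, regarded as a category, this is the geometric realization `|P|`. -/
noncomputable def classifyingSpace (C : Type u) [Category.{v} C] : TopCat.{max u v} :=
  SSet.toTop.obj (nerve C)

/-- A freely oriented matroid: a finite set `carrier` with a free involution `bar` (a two-fold
covering of the set of orbits of `bar`), together with a family of signed circuits. -/
structure FreelyOrientedMatroid where
  /-- the two-fold covering of the ground set -/
  carrier : Type u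
  finite : Finite carrier
  /-- the free involution exchanging the two points of each fibre -/
  bar : carrier → carrier
  bar_bar : ∀ e, bar (bar e) = e
  bar_ne : ∀ e, bar e ≠ e
  /-- the signed circuits -/
  circuits : Set (Set carrier)
  nonempty_of_circuit : ∀ C ∈ circuits, C.Nonempty
  disjoint_bar : ∀ C ∈ circuits, Disjoint C (bar '' C)
  bar_mem_circuits : ∀ C ∈ circuits, bar '' C ∈ circuits
  eq_or_eq_bar : ∀ C₁ ∈ circuits, ∀ C₂ ∈ circuits, C₁ ⊆ C₂ ∪ bar '' C₂ →
    C₁ = C₂ ∨ C₁ = bar '' C₂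
  elimination : ∀ C₁ ∈ circuits, ∀ C₂ ∈ circuits, C₁ ≠ C₂ → ∀ e ∈ C₁ ∩ C₂,
    ∃ C₃ ∈ circuits, C₃ ⊆ (C₁ \ {e}) ∪ bar '' (C₂ \ {e})

namespace FreelyOrientedMatroid

/-- `A` is independent: it maps injectively to the set of orbits of `bar`, and its image there
contains the image of no signed circuit. -/
def Indep (M : FreelyOrientedMatroid.{u}) (A : Set M.carrier) : Prop :=
  Disjoint A (M.bar '' A) ∧ ∀ C ∈ M.circuits, ¬ C ⊆ A ∪ M.bar '' A

/-- Bases are the maximal independent sets. -/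
def IsBasis (M : FreelyOrientedMatroid.{u}) (B : Set M.carrier) : Prop :=
  Maximal M.Indep B

/-- The rank is the common number of elements of the bases. -/
def HasRank (M : FreelyOrientedMatroid.{u}) (r : ℕ) : Prop :=
  ∃ B, M.IsBasis B ∧ B.ncard = r

/-- A representation over `ℝ`. -/
structure IsRepresentation (M : FreelyOrientedMatroid.{u}) {V : Type v} [AddCommGroup V]
    [Module ℝ V] (ρ : M.carrier → V) : Prop where
  add_bar : ∀ e, ρ e + ρ (M.bar e) = 0
  circuit : ∀ C ∈ M.circuits, ∃ a : M.carrier → ℝ,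
    (∀ e ∈ C, 0 < a e) ∧ ∑ᶠ e ∈ C, a e • ρ e = 0
  indep : ∀ A, M.Indep A → LinearIndepOn ℝ ρ A
  span : Submodule.span ℝ (Set.range ρ) = ⊤

/-- A representation is unipotent if the images of any two bases have the same volume. The volume
is measured by an alternating form `ω` in as many variables as a basis has elements; as the images
of the bases of the matroid are bases of the vector space, such an `ω` is a top form, unique up to
a scalar. -/
def IsUnipotent (M : FreelyOrientedMatroid.{u}) {V : Type v} [AddCommGroup V]
    [Module ℝ V] (ρ : M.carrier → V) : Prop :=
  M.IsRepresentation ρ ∧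
    ∀ (n : ℕ) (ω : V [⋀^Fin n]→ₗ[ℝ] ℝ) (b b' : Fin n → M.carrier),
      Function.Injective b → Function.Injective b' →
      M.IsBasis (Set.range b) → M.IsBasis (Set.range b') →
      |ω (fun i => ρ (b i))| = |ω (fun i => ρ (b' i))|

/-- A freely oriented matroid is regular if it has a unipotent representation over `ℝ`. (The
vector space is spanned by a finite set, so nothing is lost by taking it in `Type`.) -/
def IsRegular (M : FreelyOrientedMatroid.{u}) : Prop :=
  ∃ (V : Type) (_ : AddCommGroup V) (_ : Module ℝ V) (ρ : M.carrier → V), M.IsUnipotent ρ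

/-- A morphism is an equivariant injection under which a set is a circuit if and only if its image
is one. -/
@[ext]
structure Hom (M N : FreelyOrientedMatroid.{u}) where
  /-- the underlying map -/
  toFun : M.carrier → N.carrier
  injective : Function.Injective toFun
  map_bar : ∀ e, toFun (M.bar e) = N.bar (toFun e)
  image_mem_circuits_iff : ∀ C : Set M.carrier, toFun '' C ∈ N.circuits ↔ C ∈ M.circuits

instance : Category.{u} FreelyOrientedMatroid.{u} where
  Hom M N := Hom M N
  id M := ⟨id, Function.injective_id, fun _ => rfl, fun C => by simp⟩
  comp f g := ⟨g.toFun ∘ f.toFun, g.injective.comp f.injective,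
    fun e => by simp [f.map_bar, g.map_bar],
    fun C => by rw [Set.image_comp, g.image_mem_circuits_iff, f.image_mem_circuits_iff]⟩

end FreelyOrientedMatroid

/-- The category `R(r,ℤ)` of regular freely oriented matroids of rank `r`, a full subcategory of
the category of freely oriented matroids. -/
abbrev RegularMatroidCat (r : ℕ) : Type (u + 1) :=
  ObjectProperty.FullSubcategory
    (fun M : FreelyOrientedMatroid.{u} => M.HasRank r ∧ M.IsRegular)

/-- The poset `IR(r,ℤ)`, ordered by inclusion: the subsets of `ℤ^r` that do not contain `0`, are
symmetric, generate `ℤ^r`, and in which any `r` linearly independent elements generate `ℤ^r`. -/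
abbrev IR (r : ℕ) : Type :=
  {E : Set (Fin r → ℤ) //
    0 ∉ E ∧
    (∀ x, x ∈ E ↔ -x ∈ E) ∧
    AddSubgroup.closure E = ⊤ ∧
    ∀ b : Fin r → (Fin r → ℤ), (∀ i, b i ∈ E) → LinearIndependent ℤ b →
      AddSubgroup.closure (Set.range b) = ⊤}

/-- The comparability graph of a poset, i.e. the 1-skeleton of its order complex. -/
def comparabilityGraph (P : Type u) [PartialOrder P] : SimpleGraph P where
  Adj x y := x < y ∨ y < x
  symm := ⟨fun _ _ h => h.symm⟩
  loopless := ⟨fun x h => h.elim (lt_irrefl x) (lt_irrefl x)⟩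

/-!
The elements of `IR(2,ℤ)` are the edges `{±v, ±w}` and the triangles `{±v, ±w, ±(v + w)}` of the
Farey tessellation, where `v, w` is a basis of `ℤ²`. Removing the longest vectors of a triangle, and
completing an edge which is not a square by the shorter one of its diagonals, leads from any of them
to the standard edge, so that they form a rooted tree. The cone over a rooted tree is obtained from
the tree by filling horns, going away from the root: the simplex spanned by the apex and a point is
matched with the one spanned by the apex, this point and its parent. Filling horns does not change
the homotopy type, hence the tree is contractible, like the cone.

Now let a group `G` act on the tree, not necessarily fixing the root. Over each simplex of `BG`, the
nerve of the homotopy orbit category is a product with the tree, so that adjoining the apex of the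
cone again amounts to filling horns; as the apex is fixed by `G`, the homotopy orbit category has
the classifying space `BG`. For `G = GL₂(ℤ)` it remains to compare the homotopy orbit category with
the regular matroids of rank two. These are, up to equivalence of categories, the finite symmetric
configurations of vectors in `ℤ²`, with zeros and repetitions, which contain a basis of `ℤ²` and in
which any two vectors are dependent or form a basis. A configuration embeds naturally in its
disjoint union with the set of its nonzero vectors, and so does this set, which is an element of
`IR(2,ℤ)`. Hence zeros and repetitions do not matter for the homotopy type.
-/

universe w w'

open Simplicial Opposite MonoidalCategory

/-! ### Retractions of strips -/

section StandardSimplex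

variable {S : Type*} [Semiring S] [PartialOrder S] [IsOrderedRing S]
  {X Y : Type*} [Fintype X] [Fintype Y] {f : X → Y}

lemma stdSimplex_map_apply_of_injective (hf : Function.Injective f) (s : stdSimplex S X) (x : X) :
    stdSimplex.map f s (f x) = s x := by
  classical
  rw [stdSimplex.map_coe, FunOnFinite.linearMap_apply_apply, Finset.sum_eq_single x] <;>
    simp +contextual [hf.eq_iff]

lemma stdSimplex_map_apply_eq_zero (s : stdSimplex S X) {y : Y} (hy : y ∉ Set.range f) :
    stdSimplex.map f s y = 0 := by
  classical
  rw [stdSimplex.map_coe, FunOnFinite.linearMap_apply_apply]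
  exact Finset.sum_eq_zero fun x hx => (hy ⟨x, (Finset.mem_filter.1 hx).2⟩).elim

lemma stdSimplex_map_injective (hf : Function.Injective f) :
    Function.Injective (stdSimplex.map (S := S) f) := by
  intro s t h
  ext x
  rw [← stdSimplex_map_apply_of_injective hf s, ← stdSimplex_map_apply_of_injective hf t, h]

lemma exists_stdSimplex_map_succAbove_eq {n : ℕ} (j : Fin (n + 2)) {x : stdSimplex S (Fin (n + 2))}
    (hx : x j = 0) : ∃ y : stdSimplex S (Fin (n + 1)), stdSimplex.map j.succAbove y = x := by
  have hsum : ∑ k, x (j.succAbove k) = 1 := by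
    rw [← stdSimplex.sum_eq_one x, Fin.sum_univ_succAbove _ j, hx, zero_add]
  refine ⟨⟨fun k => x (j.succAbove k), fun k => stdSimplex.zero_le x _, hsum⟩, ?_⟩
  ext k
  obtain rfl | ⟨k, rfl⟩ := Fin.eq_self_or_eq_succAbove j k
  · rw [stdSimplex_map_apply_eq_zero _ (by simp), hx]
  · exact stdSimplex_map_apply_of_injective Fin.succAbove_right_injective _ k

lemma succAbove_comp_succAbove_of_lt {n : ℕ} {j l : Fin (n + 3)} (hjl : j < l) :
    j.succAbove ∘ (l.pred (Fin.ne_zero_of_lt hjl)).succAbove =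
      l.succAbove ∘ (j.castPred (Fin.ne_last_of_lt hjl)).succAbove := by
  funext k
  obtain ⟨j, rfl⟩ := j.eq_castSucc_of_ne_last (Fin.ne_last_of_lt hjl)
  obtain ⟨l, rfl⟩ := l.eq_succ_of_ne_zero (Fin.ne_zero_of_lt hjl)
  have := congr_arg (fun f => f.toOrderHom k)
    (SimplexCategory.δ_comp_δ (i := j) (j := l) (Fin.castSucc_lt_succ_iff.1 hjl))
  simpa [SimplexCategory.δ] using this.symm

lemma exists_of_stdSimplex_map_succAbove_eq {n : ℕ} {j l : Fin (n + 3)} (hjl : j < l)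
    {y y' : stdSimplex S (Fin (n + 2))}
    (h : stdSimplex.map j.succAbove y = stdSimplex.map l.succAbove y') :
    ∃ z : stdSimplex S (Fin (n + 1)),
      stdSimplex.map (l.pred (Fin.ne_zero_of_lt hjl)).succAbove z = y ∧
      stdSimplex.map (j.castPred (Fin.ne_last_of_lt hjl)).succAbove z = y' := by
  have hy : y (l.pred (Fin.ne_zero_of_lt hjl)) = 0 := by
    rw [← stdSimplex_map_apply_of_injective (Fin.succAbove_right_injective (p := j)) y,
      Fin.succAbove_pred_of_lt _ _ hjl, h, stdSimplex_map_apply_eq_zero _ (by simp)]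
  obtain ⟨z, rfl⟩ := exists_stdSimplex_map_succAbove_eq _ hy
  refine ⟨z, rfl, stdSimplex_map_injective (Fin.succAbove_right_injective (p := l)) ?_⟩
  rw [← h, stdSimplex.map_comp_apply, stdSimplex.map_comp_apply, succAbove_comp_succAbove_of_lt hjl]

end StandardSimplex

/-- A pair `(K, L)` whose strip `[0, 1] × K` can be pushed downwards onto the union of its bottom
`{0} × K` and its walls `[0, 1] × L`; the point `(m, k)` lands on `(height (m, k), pos (m, k))`. -/
structure StripRetraction (K : Type*) [TopologicalSpace K] (L : Set K) where
  /-- the first coordinate of the retraction -/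
  height : C(unitInterval × K, unitInterval)
  /-- the second coordinate of the retraction -/
  pos : C(unitInterval × K, K)
  height_le : ∀ m k, height (m, k) ≤ m
  height_eq_zero_or_pos_mem : ∀ m k, height (m, k) = 0 ∨ pos (m, k) ∈ L
  pos_zero : ∀ k, pos (0, k) = k
  height_of_mem : ∀ m, ∀ k ∈ L, height (m, k) = m
  pos_of_mem : ∀ m, ∀ k ∈ L, pos (m, k) = k

namespace StripRetraction

/-- The strip over a space without walls is pushed vertically onto its bottom. -/
def vertical (K : Type*) [TopologicalSpace K] : StripRetraction K ∅ where
  height := .const _ 0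
  pos := .snd
  height_le _ _ := unitInterval.nonneg'
  height_eq_zero_or_pos_mem _ _ := .inl rfl
  pos_zero _ := rfl
  height_of_mem _ _ hk := hk.elim
  pos_of_mem _ _ hk := hk.elim

/-- The square is pushed onto the union of its bottom and its sides: the points above the broken
line `m = 4 * min t (1 - t)` go to the sides, the other points go to the bottom. -/
noncomputable def square : StripRetraction unitInterval {0, 1} where
  height := ⟨fun p => Set.projIcc 0 1 zero_le_one (p.1 - 4 * min (p.2 : ℝ) (1 - p.2)), by fun_prop⟩
  pos := ⟨fun p => Set.projIcc 0 1 zero_le_one (1 / 2 + (1 + p.1) * (p.2 - 1 / 2 : ℝ)), by fun_prop⟩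
  height_le m t := by
    have hmin : 0 ≤ min (t : ℝ) (1 - t) := le_min t.2.1 (sub_nonneg.2 t.2.2)
    calc Set.projIcc 0 1 zero_le_one ((m : ℝ) - 4 * min (t : ℝ) (1 - t))
      _ ≤ Set.projIcc 0 1 zero_le_one (m : ℝ) := Set.monotone_projIcc _ (by linarith)
      _ = m := Set.projIcc_val zero_le_one m
  height_eq_zero_or_pos_mem m t := by
    have hm : 0 ≤ (m : ℝ) * (1 - m) := mul_nonneg m.2.1 (sub_nonneg.2 m.2.2)
    have hm' : 0 ≤ 1 + (m : ℝ) := by linarith [m.2.1]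
    obtain h | h := le_or_gt (m : ℝ) (4 * min (t : ℝ) (1 - t))
    · exact .inl (Set.projIcc_of_le_left zero_le_one (sub_nonpos.2 h))
    have h' : min (t : ℝ) (1 - t) < m / 4 := by linarith
    refine .inr ((min_lt_iff.1 h').imp (fun h => ?_) fun h => ?_)
    · have hpos : (1 / 2 + (1 + m) * (t - 1 / 2) : ℝ) ≤ 0 := by nlinarith
      exact Set.projIcc_of_le_left zero_le_one hpos
    · have hpos : 1 ≤ (1 / 2 + (1 + m) * (t - 1 / 2) : ℝ) := by nlinarith
      exact Set.projIcc_of_right_le zero_le_one hpos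
  pos_zero t := by simp
  height_of_mem := by rintro m t (rfl | rfl) <;> simp
  pos_of_mem := by
    have hle (m : unitInterval) : (1 / 2 + (1 + m) * (0 - 1 / 2) : ℝ) ≤ 0 := by linarith [m.2.1]
    have hge (m : unitInterval) : 1 ≤ (1 / 2 + (1 + m) * (1 - 1 / 2) : ℝ) := by linarith [m.2.1]
    rintro m t (rfl | rfl)
    exacts [Set.projIcc_of_le_left zero_le_one (hle m),
      Set.projIcc_of_right_le zero_le_one (hge m)]

end StripRetraction

section HornRetraction

variable {n : ℕ} (i : Fin (n + 2))

/-- The least of the barycentric coordinates of `x` of index different from `i`; it vanishes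
exactly on the horn opposite to `i`. -/
noncomputable def minCoord (x : stdSimplex ℝ (Fin (n + 2))) : unitInterval :=
  Finset.univ.inf' Finset.univ_nonempty fun k : Fin (n + 1) =>
    ⟨x (i.succAbove k), stdSimplex.zero_le x _, stdSimplex.le_one x _⟩

lemma continuous_minCoord : Continuous (minCoord i) :=
  Continuous.finset_inf'_apply _ fun k _ =>
    ((continuous_apply (i.succAbove k)).comp continuous_subtype_val).subtype_mk _

lemma minCoord_le (x : stdSimplex ℝ (Fin (n + 2))) (k : Fin (n + 1)) :
    minCoord i x ≤ x (i.succAbove k) :=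
  Subtype.coe_le_coe.2 (Finset.inf'_le (fun k : Fin (n + 1) =>
    (⟨x (i.succAbove k), stdSimplex.zero_le x _, stdSimplex.le_one x _⟩ : unitInterval))
    (Finset.mem_univ k))

lemma exists_eq_minCoord (x : stdSimplex ℝ (Fin (n + 2))) :
    ∃ k : Fin (n + 1), x (i.succAbove k) = minCoord i x := by
  obtain ⟨k, -, hk⟩ := Finset.exists_mem_eq_inf' (Finset.univ_nonempty (α := Fin (n + 1)))
    fun k => (⟨x (i.succAbove k), stdSimplex.zero_le x _, stdSimplex.le_one x _⟩ : unitInterval)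
  exact ⟨k, congr_arg Subtype.val hk.symm⟩

lemma minCoord_map_succAbove {j : Fin (n + 2)} (hj : j ≠ i) (y : stdSimplex ℝ (Fin (n + 1))) :
    minCoord i (stdSimplex.map j.succAbove y) = 0 := by
  obtain ⟨k, rfl⟩ := Fin.exists_succAbove_eq hj
  refine le_antisymm (Subtype.coe_le_coe.1 ((minCoord_le i _ k).trans_eq ?_)) unitInterval.nonneg'
  exact stdSimplex_map_apply_eq_zero _ (by simp)

/-- The point obtained from `x` by moving it, along the line from the barycenter of the face
opposite to `i` to the vertex `i`, until its least coordinate is `μ`. -/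
noncomputable def lowerMinCoord (x : stdSimplex ℝ (Fin (n + 2))) (μ : unitInterval)
    (hμ : μ ≤ minCoord i x) : stdSimplex ℝ (Fin (n + 2)) :=
  ⟨fun k => if k = i then x i + (n + 1) * (minCoord i x - μ) else x k - (minCoord i x - μ), by
    have hμ' : (μ : ℝ) ≤ minCoord i x := hμ
    refine ⟨fun k => ?_, ?_⟩
    · dsimp only
      split_ifs with h
      · exact add_nonneg (stdSimplex.zero_le x i) (mul_nonneg (by positivity) (sub_nonneg.2 hμ'))
      · obtain ⟨k, rfl⟩ := Fin.exists_succAbove_eq h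
        linarith [minCoord_le i x k, unitInterval.nonneg μ]
    · have hsum := stdSimplex.sum_eq_one x
      rw [Fin.sum_univ_succAbove _ i] at hsum ⊢
      simp only [↓reduceIte, Fin.succAbove_ne, Finset.sum_sub_distrib, Finset.sum_const,
        Finset.card_univ, Fintype.card_fin, nsmul_eq_mul, Nat.cast_add, Nat.cast_one]
      linarith⟩

lemma lowerMinCoord_succAbove_apply (x : stdSimplex ℝ (Fin (n + 2))) (μ : unitInterval) (hμ) (k) :
    lowerMinCoord i x μ hμ (i.succAbove k) = x (i.succAbove k) - (minCoord i x - μ) :=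
  if_neg (Fin.succAbove_ne _ _)

lemma lowerMinCoord_of_eq (x : stdSimplex ℝ (Fin (n + 2))) {μ : unitInterval}
    (hμ : μ = minCoord i x) : lowerMinCoord i x μ hμ.le = x := by
  subst hμ
  ext k
  simp +contextual [lowerMinCoord, DFunLike.coe]

lemma continuous_lowerMinCoord {X : Type*} [TopologicalSpace X]
    {x : X → stdSimplex ℝ (Fin (n + 2))} {μ : X → unitInterval} (hx : Continuous x)
    (hμ : Continuous μ) (hle : ∀ t, μ t ≤ minCoord i (x t)) :
    Continuous fun t => lowerMinCoord i (x t) (μ t) (hle t) := by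
  have hcoord (k : Fin (n + 2)) : Continuous fun t => x t k :=
    (continuous_apply k).comp (continuous_subtype_val.comp hx)
  have hdiff : Continuous fun t => (minCoord i (x t) - μ t : ℝ) :=
    (continuous_subtype_val.comp ((continuous_minCoord i).comp hx)).sub
      (continuous_subtype_val.comp hμ)
  refine Continuous.subtype_mk (continuous_pi fun k => ?_) _
  split_ifs
  exacts [(hcoord i).add (continuous_const.mul hdiff), (hcoord k).sub hdiff]

variable {K : Type*} [TopologicalSpace K] (L : Set K)

/-- The disjoint union of the products with `K` of the faces of the `i`-th horn and of `Δ × L`. -/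
abbrev HornCover : Type _ :=
  (Σ _ : {j : Fin (n + 2) // j ≠ i}, stdSimplex ℝ (Fin (n + 1)) × K) ⊕
    (stdSimplex ℝ (Fin (n + 2)) × L)

/-- The map from the horn cover to `Δ × K`, with image the union of `Λ[i] × K` and `Δ × L`. -/
noncomputable def hornCover : HornCover i L → stdSimplex ℝ (Fin (n + 2)) × K :=
  Sum.elim (fun w => (stdSimplex.map w.1.1.succAbove w.2.1, w.2.2)) (fun w => (w.1, w.2))

lemma continuous_hornCover : Continuous (hornCover i L) :=
  Continuous.sumElim
    (continuous_sigma fun j => (stdSimplex.continuous_map j.1.succAbove).prodMap continuous_id)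
    (continuous_id.prodMap continuous_subtype_val)

variable {L}

lemma exists_retraction_onto_range_hornCover (R : StripRetraction K L) :
    ∃ r : C(stdSimplex ℝ (Fin (n + 2)) × K, stdSimplex ℝ (Fin (n + 2)) × K),
      (∀ d, r d ∈ Set.range (hornCover i L)) ∧ ∀ w, r (hornCover i L w) = hornCover i L w := by
  have hmin : Continuous fun p : stdSimplex ℝ (Fin (n + 2)) × K => (minCoord i p.1, p.2) :=
    (continuous_minCoord i).prodMap continuous_id
  refine ⟨⟨fun p => (lowerMinCoord i p.1 (R.height (minCoord i p.1, p.2)) (R.height_le _ _),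
    R.pos (minCoord i p.1, p.2)), ?_⟩, fun ⟨x, k⟩ => ?_, ?_⟩
  · exact (continuous_lowerMinCoord i continuous_fst (R.height.continuous.comp hmin) _).prodMk
      (R.pos.continuous.comp hmin)
  · obtain h0 | hL := R.height_eq_zero_or_pos_mem (minCoord i x) k
    · obtain ⟨l, hl⟩ := exists_eq_minCoord i x
      obtain ⟨y, hy⟩ := exists_stdSimplex_map_succAbove_eq (i.succAbove l)
        (x := lowerMinCoord i x _ (R.height_le _ k))
        (by rw [lowerMinCoord_succAbove_apply, hl, h0]; simp)
      exact ⟨.inl ⟨⟨i.succAbove l, Fin.succAbove_ne _ _⟩, y, R.pos (minCoord i x, k)⟩,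
        Prod.ext hy rfl⟩
    · exact ⟨.inr (lowerMinCoord i x _ (R.height_le _ k), ⟨_, hL⟩), rfl⟩
  · rintro (⟨⟨j, hj⟩, y, k⟩ | ⟨x, k, hk⟩)
    · have h0 := minCoord_map_succAbove i hj y
      refine Prod.ext (lowerMinCoord_of_eq i _ ?_) ?_
      · refine (congr_arg (fun m => R.height (m, k)) h0).trans (Eq.trans ?_ h0.symm)
        exact le_antisymm (R.height_le 0 k) unitInterval.nonneg'
      · exact (congr_arg (fun m => R.pos (m, k)) h0).trans (R.pos_zero k)
    · exact Prod.ext (lowerMinCoord_of_eq i x (R.height_of_mem _ k hk)) (R.pos_of_mem _ k hk)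

end HornRetraction

section HornExtension

lemma exists_extension_of_retraction {D W Z : Type*} [TopologicalSpace D] [T2Space D]
    [TopologicalSpace W] [CompactSpace W] [TopologicalSpace Z] {a : W → D} (ha : Continuous a)
    {r : C(D, D)} (hra : ∀ d, r d ∈ Set.range a) (har : ∀ w, r (a w) = a w)
    (g : C(W, Z)) (hg : ∀ w w', a w = a w' → g w = g w') :
    ∃ F : C(D, Z), ∀ w, F (a w) = g w := by
  let q : C(W, Set.range a) := ⟨Set.rangeFactorization a, ha.subtype_mk _⟩
  have hq : Topology.IsQuotientMap q :=
    q.continuous.isClosedMap.isQuotientMap q.continuous Set.rangeFactorization_surjective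
  have hfac : Function.FactorsThrough g q := fun w w' h => hg w w' (congr_arg Subtype.val h)
  refine ⟨(hq.lift g hfac).comp ⟨fun d => ⟨r d, hra d⟩, r.continuous.subtype_mk _⟩, fun w => ?_⟩
  calc hq.lift g hfac ⟨r (a w), hra _⟩
    _ = hq.lift g hfac (q w) := congr_arg _ (Subtype.ext (har w))
    _ = g w := DFunLike.congr_fun (hq.lift_comp g hfac) w

variable {n : ℕ} (i : Fin (n + 2)) {K : Type w} [TopologicalSpace K] [CompactSpace K] [T2Space K]
  {L : Set K}

lemma exists_extension_hornCover (hL : IsClosed L) (R : StripRetraction K L)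
    {Z : Type*} [TopologicalSpace Z] (g : C(HornCover i L, Z))
    (hg : ∀ p q, hornCover i L p = hornCover i L q → g p = g q) :
    ∃ F : C(stdSimplex ℝ (Fin (n + 2)) × K, Z), ∀ p, F (hornCover i L p) = g p := by
  have : CompactSpace L := isCompact_iff_compactSpace.1 hL.isCompact
  obtain ⟨r, hrange, hfix⟩ := exists_retraction_onto_range_hornCover i R
  exact exists_extension_of_retraction (continuous_hornCover i L) hrange hfix g hg

lemma exists_extension_horn (hL : IsClosed L) (R : StripRetraction K L)
    {Z : Type*} [TopologicalSpace Z]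
    (g : ∀ j : Fin (n + 2), j ≠ i → C(stdSimplex ℝ (Fin (n + 1)), C(K, Z)))
    (h : C(stdSimplex ℝ (Fin (n + 2)), C(L, Z)))
    (hg : ∀ j l hj hl y y', j < l → stdSimplex.map j.succAbove y = stdSimplex.map l.succAbove y' →
      g j hj y = g l hl y')
    (hgh : ∀ j hj y (k : L), g j hj y k = h (stdSimplex.map j.succAbove y) k) :
    ∃ F : C(stdSimplex ℝ (Fin (n + 2)), C(K, Z)),
      (∀ j hj y, F (stdSimplex.map j.succAbove y) = g j hj y) ∧
      ∀ x (k : L), F x k = h x k := by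
  have hg' : ∀ j l hj hl y y', stdSimplex.map j.succAbove y = stdSimplex.map l.succAbove y' →
      g j hj y = g l hl y' := by
    intro j l hj hl y y' e
    obtain hjl | rfl | hjl := lt_trichotomy j l
    · exact hg j l hj hl y y' hjl e
    · rw [stdSimplex_map_injective Fin.succAbove_right_injective e]
    · exact (hg l j hl hj y' y hjl e.symm).symm
  have : CompactSpace L := isCompact_iff_compactSpace.1 hL.isCompact
  let G : C(HornCover i L, Z) :=
    ⟨Sum.elim (fun p => g p.1.1 p.1.2 p.2.1 p.2.2) (fun p => h p.1 p.2), Continuous.sumElim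
      (continuous_sigma fun j => ContinuousEval.continuous_eval.comp
        ((g j.1 j.2).continuous.prodMap continuous_id))
      (ContinuousEval.continuous_eval.comp (h.continuous.prodMap continuous_id))⟩
  obtain ⟨F, hF⟩ := exists_extension_hornCover i hL R G (by
    rintro (⟨⟨j, hj⟩, y, k⟩ | ⟨x, k, hk⟩) (⟨⟨j', hj'⟩, y', k'⟩ | ⟨x', k', hk'⟩) e
    all_goals obtain ⟨e₁, e₂⟩ := Prod.ext_iff.1 e; dsimp [hornCover] at e₁ e₂; subst e₂
    · exact DFunLike.congr_fun (hg' _ _ hj hj' _ _ e₁) k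
    · subst e₁; exact hgh j hj y ⟨_, hk'⟩
    · subst e₁; exact (hgh j' hj' y' ⟨_, hk⟩).symm
    · subst e₁; rfl)
  refine ⟨F.curry, fun j hj y => ?_, fun x k => hF (.inr ⟨x, k⟩)⟩
  ext k
  exact hF (.inl ⟨⟨j, hj⟩, y, k⟩)

end HornExtension

section SingularLifting

lemma toSSetObjEquiv_map_apply {X Y : TopCat.{u}} (p : X ⟶ Y) {n : ℕ}
    (x : TopCat.toSSet.obj X _⦋n⦌) (y : stdSimplex ℝ (Fin (n + 1))) :
    Y.toSSetObjEquiv (op ⦋n⦌) ((TopCat.toSSet.map p).app _ x) y =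
      p (X.toSSetObjEquiv (op ⦋n⦌) x y) := rfl

lemma toSSetObjEquiv_yonedaEquiv_δ_comp {X : TopCat.{u}} {n : ℕ} (j : Fin (n + 2))
    (f : Δ[n + 1] ⟶ TopCat.toSSet.obj X) (y : stdSimplex ℝ (Fin (n + 1))) :
    X.toSSetObjEquiv (op ⦋n⦌) (SSet.yonedaEquiv (SSet.stdSimplex.δ j ≫ f)) y =
      X.toSSetObjEquiv (op ⦋n + 1⦌) (SSet.yonedaEquiv f) (stdSimplex.map j.succAbove y) := by
  obtain ⟨f, rfl⟩ := SSet.yonedaEquiv.symm.surjective f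
  rw [SSet.stdSimplex.δ_comp_yonedaEquiv_symm, Equiv.apply_symm_apply, Equiv.apply_symm_apply]
  exact TopCat.toSSetObjEquiv_δ_apply _ _ _

lemma toSSetObjEquiv_eq_of_horn_isCompatible {X : TopCat.{u}} {n : ℕ} {i : Fin (n + 2)}
    {f : ∀ j : Fin (n + 2), j ≠ i → (Δ[n] ⟶ TopCat.toSSet.obj X)} (hf : SSet.horn.IsCompatible f)
    {j l : Fin (n + 2)} (hj : j ≠ i) (hl : l ≠ i) {y y' : stdSimplex ℝ (Fin (n + 1))} (hjl : j < l)
    (h : stdSimplex.map j.succAbove y = stdSimplex.map l.succAbove y') :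
    X.toSSetObjEquiv (op ⦋n⦌) (SSet.yonedaEquiv (f j hj)) y =
      X.toSSetObjEquiv (op ⦋n⦌) (SSet.yonedaEquiv (f l hl)) y' := by
  obtain _ | n := n
  · omega
  obtain ⟨z, rfl, rfl⟩ := exists_of_stdSimplex_map_succAbove_eq hjl h
  rw [← toSSetObjEquiv_yonedaEquiv_δ_comp, ← toSSetObjEquiv_yonedaEquiv_δ_comp,
    hf.δ_pred_comp j l hj hl hjl]

variable {K : Type w} [TopologicalSpace K] (L : Set K) (Z : Type u) [TopologicalSpace Z]

/-- The restriction of continuous maps `K → Z` to a subspace `L` of `K`. -/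
def restrictionMap : TopCat.of C(K, Z) ⟶ TopCat.of C(L, Z) :=
  TopCat.ofHom ⟨fun f => f.restrict L, ContinuousMap.continuous_restrict L⟩

variable {L}

lemma hasLiftingProperty_horn_restrictionMap [CompactSpace K] [T2Space K] (hL : IsClosed L)
    (R : StripRetraction K L) {n : ℕ} (i : Fin (n + 2)) :
    HasLiftingProperty Λ[n + 1, i].ι (TopCat.toSSet.map (restrictionMap L Z)) where
  sq_hasLift {t b} sq := by
    let f (j : Fin (n + 2)) (hj : j ≠ i) := SSet.horn.ι i j hj ≫ t
    have hfb (j hj) : f j hj ≫ TopCat.toSSet.map (restrictionMap L Z) =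
        SSet.stdSimplex.δ j ≫ b := by
      simp only [f, Category.assoc, sq.w, SSet.horn.ι_ι_assoc]
    obtain ⟨F, hFf, hFb⟩ := exists_extension_horn i hL R
      (fun j hj => TopCat.toSSetObjEquiv _ (op ⦋n⦌) (SSet.yonedaEquiv (f j hj)))
      (TopCat.toSSetObjEquiv _ (op ⦋n + 1⦌) (SSet.yonedaEquiv b))
      (fun j l hj hl y y' hjl =>
        toSSetObjEquiv_eq_of_horn_isCompatible (.of_hom t) hj hl hjl)
      (fun j hj y k => by
        rw [← toSSetObjEquiv_yonedaEquiv_δ_comp, ← hfb j hj]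
        exact congr_arg (fun z : C(L, Z) => z k) (toSSetObjEquiv_map_apply (restrictionMap L Z)
          (SSet.yonedaEquiv (f j hj)) y).symm)
    refine ⟨⟨⟨SSet.yonedaEquiv.symm ((TopCat.toSSetObjEquiv (TopCat.of C(K, Z)) _).symm F),
      SSet.horn.hom_ext' fun j hj => ?_, SSet.yonedaEquiv.injective ?_⟩⟩⟩
    · rw [SSet.horn.ι_ι_assoc]
      refine SSet.yonedaEquiv.injective ((TopCat.toSSetObjEquiv _ _).injective ?_)
      ext1 y
      rw [toSSetObjEquiv_yonedaEquiv_δ_comp, Equiv.apply_symm_apply, Equiv.apply_symm_apply]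
      exact hFf j hj y
    · refine (TopCat.toSSetObjEquiv _ _).injective ?_
      ext1 x
      rw [SSet.yonedaEquiv_comp, toSSetObjEquiv_map_apply, Equiv.apply_symm_apply,
        Equiv.apply_symm_apply]
      ext1 k
      exact hFb x k

end SingularLifting

/-! ### Realizations of anodyne extensions -/

section AnodyneRealization

/-- The realization of a morphism of simplicial sets, as a continuous map. -/
noncomputable def realizationMap {X Y : SSet.{u}} (f : X ⟶ Y) :
    C(SSet.toTop.obj X, SSet.toTop.obj Y) :=
  (SSet.toTop.map f).hom

lemma realizationMap_id (X : SSet.{u}) : realizationMap (𝟙 X) = ContinuousMap.id _ := by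
  simp [realizationMap]

lemma realizationMap_comp {X Y Z : SSet.{u}} (f : X ⟶ Y) (g : Y ⟶ Z) :
    realizationMap (f ≫ g) = (realizationMap g).comp (realizationMap f) := by
  simp [realizationMap]

variable {X Y : SSet.{u}} {f : X ⟶ Y} {Z : Type u} [TopologicalSpace Z]

lemma hasLiftingProperty_toTop_map (hf : SSet.anodyneExtensions f) {K : Type} [TopologicalSpace K]
    [CompactSpace K] [T2Space K] {L : Set K} (hL : IsClosed L) (R : StripRetraction K L) :
    HasLiftingProperty (SSet.toTop.map f) (restrictionMap L Z) := by
  rw [sSetTopAdj.hasLiftingProperty_iff]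
  refine hf _ ?_
  rw [SSet.modelCategoryQuillen.fibrations_eq]
  intro _ _ _ hj
  simp only [SSet.modelCategoryQuillen.J, MorphismProperty.iSup_iff] at hj
  obtain ⟨n, ⟨i⟩⟩ := hj
  exact hasLiftingProperty_horn_restrictionMap Z hL R i

lemma exists_lift_of_anodyne (hf : SSet.anodyneExtensions f) {K : Type} [TopologicalSpace K]
    [CompactSpace K] [T2Space K] {L : Set K} (hL : IsClosed L) (R : StripRetraction K L)
    (g : C(SSet.toTop.obj X, C(K, Z))) (h : C(SSet.toTop.obj Y, C(L, Z)))
    (hgh : ∀ x (k : L), g x k = h (realizationMap f x) k) :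
    ∃ F : C(SSet.toTop.obj Y, C(K, Z)),
      (∀ x, F (realizationMap f x) = g x) ∧ ∀ y (k : L), F y k = h y k := by
  have := hasLiftingProperty_toTop_map (Z := Z) hf hL R
  have sq : CommSq (TopCat.ofHom g) (SSet.toTop.map f) (restrictionMap L Z) (TopCat.ofHom h) :=
    ⟨by ext x k; exact hgh x k⟩
  exact ⟨sq.lift.hom, ConcreteCategory.congr_hom sq.fac_left,
    fun y => DFunLike.congr_fun (ConcreteCategory.congr_hom sq.fac_right y)⟩

lemma exists_retraction_of_anodyne (hf : SSet.anodyneExtensions f) :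
    ∃ r : C(SSet.toTop.obj Y, SSet.toTop.obj X),
      r.comp (realizationMap f) = ContinuousMap.id _ := by
  let const : C(SSet.toTop.obj X, C(Unit, SSet.toTop.obj X)) :=
    ⟨ContinuousMap.const Unit, ContinuousMap.continuous_const'⟩
  let empty : C((∅ : Set Unit), SSet.toTop.obj X) :=
    ⟨fun k => k.2.elim, continuous_iff_continuousAt.2 fun k => k.2.elim⟩
  obtain ⟨F, hF, -⟩ := exists_lift_of_anodyne hf isClosed_empty (.vertical Unit) const
    (.const _ empty) (fun _ k => k.2.elim)
  refine ⟨⟨fun y => F y (), (continuous_eval_const ()).comp F.continuous⟩, ?_⟩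
  ext x
  exact DFunLike.congr_fun (hF x) ()

lemma homotopic_of_anodyne (hf : SSet.anodyneExtensions f) {g h : C(SSet.toTop.obj Y, Z)}
    (hgh : g.comp (realizationMap f) = h.comp (realizationMap f)) : g.Homotopic h := by
  let const : C(Z, C(unitInterval, Z)) :=
    ⟨ContinuousMap.const unitInterval, ContinuousMap.continuous_const'⟩
  let ends : C(SSet.toTop.obj Y × ({0, 1} : Set unitInterval), Z) :=
    ⟨fun p => if p.2.1 = 0 then g p.1 else h p.1, continuous_prod_of_discrete_right.2 fun k => by
      dsimp only
      split_ifs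
      exacts [g.continuous, h.continuous]⟩
  obtain ⟨F, -, hF⟩ := exists_lift_of_anodyne hf (Set.toFinite _).isClosed .square
    (const.comp (g.comp (realizationMap f))) ends.curry (fun x k => by
      change g (realizationMap f x) =
        if k.1 = 0 then g (realizationMap f x) else h (realizationMap f x)
      split_ifs
      exacts [rfl, DFunLike.congr_fun hgh x])
  refine ⟨⟨⟨fun p => F p.2 p.1, ?_⟩, fun y => ?_, fun y => ?_⟩⟩
  · exact ContinuousEval.continuous_eval.comp
      ((F.continuous.comp continuous_snd).prodMk continuous_fst)
  · exact (hF y ⟨0, by simp⟩).trans (if_pos rfl)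
  · exact (hF y ⟨1, by simp⟩).trans (if_neg (by simp))

lemma exists_homotopyInverse_of_anodyne (hf : SSet.anodyneExtensions f) :
    ∃ r : C(SSet.toTop.obj Y, SSet.toTop.obj X), r.comp (realizationMap f) = ContinuousMap.id _ ∧
      ((realizationMap f).comp r).Homotopic (ContinuousMap.id _) := by
  obtain ⟨r, hr⟩ := exists_retraction_of_anodyne hf
  refine ⟨r, hr, homotopic_of_anodyne hf ?_⟩
  rw [ContinuousMap.comp_assoc, hr, ContinuousMap.comp_id, ContinuousMap.id_comp]

lemma nonempty_homotopyEquiv_of_anodyne (hf : SSet.anodyneExtensions f) :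
    Nonempty (SSet.toTop.obj X ≃ₕ SSet.toTop.obj Y) := by
  obtain ⟨r, hr, hr'⟩ := exists_homotopyInverse_of_anodyne hf
  exact ⟨⟨realizationMap f, r, by rw [hr], hr'⟩⟩

end AnodyneRealization

section SimplicialHomotopy

open SSet

open modelCategoryQuillen in
lemma anodyneExtensions_δ_one : anodyneExtensions (stdSimplex.δ (1 : Fin 2) : Δ[0] ⟶ Δ[1]) := by
  intro E B p hp
  have : HomotopicalAlgebra.Fibration p := ⟨hp⟩
  refine ⟨fun {t b} sq => ?_⟩
  obtain ⟨φ, hφ, hφ'⟩ := horn.IsCompatible.exists_lift (i := (0 : Fin 2))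
    (f := fun _ _ => t) (by simp) p b (fun j hj => by
      obtain rfl : j = 1 := by fin_cases j <;> simp_all
      exact sq.w)
  exact ⟨⟨φ, hφ 1 (by simp), hφ'⟩⟩

lemma anodyneExtensions_ι₀ (X : SSet.{u}) : anodyneExtensions (ι₀ : X ⟶ X ⊗ Δ[1]) := by
  let e : X ≅ (X ⊗ Δ[0] : SSet.{u}) :=
    { hom := CartesianMonoidalCategory.lift (𝟙 X) (SSet.const (stdSimplex.obj₀Equiv.symm 0))
      inv := CartesianMonoidalCategory.fst _ _
      hom_inv_id := by simp
      inv_hom_id := by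
        apply CartesianMonoidalCategory.hom_ext
        · simp
        · exact stdSimplex.isTerminalObj₀.hom_ext _ _ }
  have hι : (ι₀ : X ⟶ X ⊗ Δ[1]) = e.hom ≫ X ◁ stdSimplex.δ (1 : Fin 2) := by
    apply CartesianMonoidalCategory.hom_ext
    · simp [e]
    · simp [e, stdSimplex.δ_one_eq_const]
  have : IsIso e.hom := e.isIso_hom
  rw [hι]
  exact anodyneExtensions.comp_mem _ _ (.of_isIso e.hom) (anodyneExtensions_δ_one.whiskerLeft X)

lemma realizationMap_ι₀_homotopic (X : SSet.{u}) :
    (realizationMap (ι₀ : X ⟶ X ⊗ Δ[1])).Homotopic (realizationMap ι₁) := by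
  let q := realizationMap (CartesianMonoidalCategory.fst X Δ[1])
  have h : ((realizationMap (ι₀ : X ⟶ X ⊗ Δ[1])).comp q).Homotopic (ContinuousMap.id _) := by
    refine homotopic_of_anodyne (anodyneExtensions_ι₀ X) ?_
    rw [ContinuousMap.comp_assoc, ← realizationMap_comp, ι₀_fst, realizationMap_id]
    rfl
  have h' := h.comp (.refl (realizationMap (ι₁ : X ⟶ X ⊗ Δ[1])))
  rwa [ContinuousMap.comp_assoc, ← realizationMap_comp, ι₁_fst, realizationMap_id,
    ContinuousMap.id_comp, ContinuousMap.comp_id] at h'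

lemma realizationMap_homotopic {X Y : SSet.{u}} {f g : X ⟶ Y} (H : X ⊗ Δ[1] ⟶ Y)
    (h₀ : ι₀ ≫ H = f) (h₁ : ι₁ ≫ H = g) :
    (realizationMap f).Homotopic (realizationMap g) := by
  rw [← h₀, ← h₁, realizationMap_comp, realizationMap_comp]
  exact (ContinuousMap.Homotopic.refl _).comp (realizationMap_ι₀_homotopic X)

end SimplicialHomotopy

section ClassifyingMap

variable {C D E : Type u} [Category.{v} C] [Category.{v} D] [Category.{v} E]

/-- The map of classifying spaces induced by a functor. -/
noncomputable def classifyingMap (F : C ⥤ D) : C(classifyingSpace C, classifyingSpace D) :=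
  realizationMap (nerveMap F)

lemma classifyingMap_id : classifyingMap (𝟭 C) = ContinuousMap.id _ :=
  realizationMap_id _

lemma classifyingMap_comp (F : C ⥤ D) (G : D ⥤ E) :
    classifyingMap (F ⋙ G) = (classifyingMap G).comp (classifyingMap F) :=
  realizationMap_comp (nerveMap F) (nerveMap G)

variable {F G : C ⥤ D}

/-- The simplicial homotopy between maps of nerves attached to a natural transformation. -/
def nerveHomotopy (α : F ⟶ G) : nerve C ⊗ Δ[1] ⟶ nerve D where
  app _ := ↾fun x => ((SSet.stdSimplex.objEquiv x.2).toOrderHom.monotone.functor.prod'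
    (x.1 : ComposableArrows C _)) ⋙ Functor.uncurry.obj (ComposableArrows.mk₁ α)
  naturality _ _ _ := rfl

lemma ι₀_nerveHomotopy (α : F ⟶ G) : SSet.ι₀ ≫ nerveHomotopy α = nerveMap F := by
  ext n x
  refine CategoryTheory.Functor.ext (fun _ => rfl) fun i j f => ?_
  change 𝟙 _ ≫ F.map (x.map f) = 𝟙 _ ≫ F.map (x.map f) ≫ 𝟙 _
  simp

lemma ι₁_nerveHomotopy (α : F ⟶ G) : SSet.ι₁ ≫ nerveHomotopy α = nerveMap G := by
  ext n x
  refine CategoryTheory.Functor.ext (fun _ => rfl) fun i j f => ?_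
  change 𝟙 _ ≫ G.map (x.map f) = 𝟙 _ ≫ G.map (x.map f) ≫ 𝟙 _
  simp

lemma classifyingMap_homotopic (α : F ⟶ G) :
    (classifyingMap F).Homotopic (classifyingMap G) :=
  realizationMap_homotopic (nerveHomotopy α) (ι₀_nerveHomotopy α) (ι₁_nerveHomotopy α)

/-- The homotopy equivalence of classifying spaces given by two functors that are inverse to each
other up to homotopy. -/
noncomputable def classifyingHomotopyEquiv (F : C ⥤ D) (G : D ⥤ C)
    (h : (classifyingMap (F ⋙ G)).Homotopic (classifyingMap (𝟭 C)))
    (h' : (classifyingMap (G ⋙ F)).Homotopic (classifyingMap (𝟭 D))) :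
    classifyingSpace C ≃ₕ classifyingSpace D where
  toFun := classifyingMap F
  invFun := classifyingMap G
  left_inv := by rwa [classifyingMap_comp, classifyingMap_id] at h
  right_inv := by rwa [classifyingMap_comp, classifyingMap_id] at h'

end ClassifyingMap

section RealizationPoints

open SSet

variable {X : SSet.{u}}

/-- The point of the realization of `X` with barycentric coordinates `t` in the simplex `s`. -/
noncomputable def realizationPoint {n : SimplexCategoryᵒᵖ} (s : X.obj n)
    (t : _root_.stdSimplex ℝ (Fin (n.unop.len + 1))) : toTop.obj X :=
  (toTop.obj X).toSSetObjEquiv n ((sSetTopAdj.unit.app X).app n s) t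

lemma continuous_realizationPoint {n : SimplexCategoryᵒᵖ} (s : X.obj n) :
    Continuous (realizationPoint s) :=
  ContinuousMap.continuous _

lemma realizationPoint_map {n m : SimplexCategory} (f : n ⟶ m) (s : X.obj (op m))
    (t : _root_.stdSimplex ℝ (Fin (n.len + 1))) :
    realizationPoint (X.map f.op s) t = realizationPoint s (_root_.stdSimplex.map f t) := by
  have hnat := ConcreteCategory.congr_hom ((sSetTopAdj.unit.app X).naturality f.op) s
  unfold realizationPoint
  rw [← TopCat.toSSetObjEquiv_naturality_apply]
  exact congr_arg (fun z => (toTop.obj X).toSSetObjEquiv (op n) z t) hnat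

lemma toTop_hom_ext {Z : TopCat.{u}} {f g : toTop.obj X ⟶ Z}
    (h : ∀ (n : SimplexCategoryᵒᵖ) (s : X.obj n) t,
      f (realizationPoint s t) = g (realizationPoint s t)) : f = g := by
  apply (sSetTopAdj.homEquiv _ _).injective
  ext n s
  apply (Z.toSSetObjEquiv n).injective
  ext t
  exact h n s t

lemma exists_toTop_hom {Z : TopCat.{u}} (φ : X ⟶ TopCat.toSSet.obj Z) :
    ∃ f : toTop.obj X ⟶ Z, ∀ (n : SimplexCategoryᵒᵖ) (s : X.obj n) t,
      f (realizationPoint s t) = Z.toSSetObjEquiv n (φ.app n s) t := by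
  obtain ⟨f, rfl⟩ := (sSetTopAdj.homEquiv _ _).surjective φ
  exact ⟨f, fun _ _ _ => rfl⟩

/- Two maps to an indiscrete space that agree on the points of the simplices are equal: apply this
to the characteristic function of the set of these points. -/
lemma exists_eq_realizationPoint (x : toTop.obj X) :
    ∃ (n : SimplexCategoryᵒᵖ) (s : X.obj n) (t : _), realizationPoint s t = x := by
  let IsPoint (x : toTop.obj X) : Prop :=
    ∃ (n : SimplexCategoryᵒᵖ) (s : X.obj n) (t : _), realizationPoint s t = x
  let T : TopCat.{u} := @TopCat.of (ULift Prop) ⊤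
  let toT (p : toTop.obj X → Prop) : toTop.obj X ⟶ T :=
    @TopCat.ofHom _ _ _ ⊤ (@ContinuousMap.mk _ _ _ ⊤ (fun x => ⟨p x⟩) continuous_top)
  have heq : toT IsPoint = toT fun _ => True := toTop_hom_ext fun n s t =>
    congr_arg ULift.up (eq_true ⟨n, s, t, rfl⟩)
  exact of_eq_true (congr_arg ULift.down (ConcreteCategory.congr_hom heq x))

lemma small_toTop_obj_of_equiv {Y : SSet.{w}} (e : ∀ n, X.obj n ≃ Y.obj n) :
    Small.{u} (toTop.obj Y) := by
  refine small_of_surjective (α := Σ n : SimplexCategoryᵒᵖ, X.obj n ×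
    _root_.stdSimplex ℝ (Fin (n.unop.len + 1)))
    (f := fun p => realizationPoint (e _ p.2.1) p.2.2) fun y => ?_
  obtain ⟨n, s, t, rfl⟩ := exists_eq_realizationPoint y
  exact ⟨⟨n, (e n).symm s, t⟩, by simp⟩

lemma exists_continuousMap_of_equiv {Y : SSet.{w}} (e : ∀ n, X.obj n ≃ Y.obj n)
    (he : ∀ {n m : SimplexCategoryᵒᵖ} (f : n ⟶ m) (s : X.obj n),
      e m (X.map f s) = Y.map f (e n s)) :
    ∃ F : C(toTop.obj X, toTop.obj Y), ∀ (n : SimplexCategoryᵒᵖ) (s : X.obj n) t,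
      F (realizationPoint s t) = realizationPoint (e n s) t := by
  have := small_toTop_obj_of_equiv e
  let Z : TopCat.{u} := @TopCat.of (Shrink.{u} (toTop.obj Y))
    (TopologicalSpace.induced (equivShrink _).symm inferInstance)
  let h : Z ≃ₜ toTop.obj Y := (equivShrink (toTop.obj Y)).symm.toHomeomorphOfIsInducing ⟨rfl⟩
  let φ : X ⟶ TopCat.toSSet.obj Z :=
    { app n := ↾fun s => (Z.toSSetObjEquiv n).symm ⟨fun t => h.symm (realizationPoint (e n s) t),
        h.symm.continuous.comp (continuous_realizationPoint _)⟩
      naturality n m f := by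
        ext s
        refine (Z.toSSetObjEquiv m).injective (ContinuousMap.ext fun t => ?_)
        change h.symm (realizationPoint (e m (X.map f.unop.op s)) t) =
          h.symm (realizationPoint (e n s) (_root_.stdSimplex.map f.unop t))
        rw [he]
        exact congr_arg h.symm (realizationPoint_map f.unop _ t) }
  obtain ⟨f, hf⟩ := exists_toTop_hom φ
  refine ⟨⟨fun x => h (f x), h.continuous.comp f.hom.continuous⟩, fun n s t => ?_⟩
  exact (congr_arg h (hf n s t)).trans (h.apply_symm_apply _)

theorem nonempty_homeomorph_toTop_of_equiv {Y : SSet.{w}} (e : ∀ n, X.obj n ≃ Y.obj n)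
    (he : ∀ {n m : SimplexCategoryᵒᵖ} (f : n ⟶ m) (s : X.obj n),
      e m (X.map f s) = Y.map f (e n s)) :
    Nonempty (toTop.obj X ≃ₜ toTop.obj Y) := by
  obtain ⟨F, hF⟩ := exists_continuousMap_of_equiv e he
  obtain ⟨G, hG⟩ := exists_continuousMap_of_equiv (fun n => (e n).symm) (fun {n m} f s => by
    rw [Equiv.symm_apply_eq, he, Equiv.apply_symm_apply])
  refine ⟨⟨⟨F, G, fun x => ?_, fun y => ?_⟩, F.continuous, G.continuous⟩⟩
  · obtain ⟨n, s, t, rfl⟩ := exists_eq_realizationPoint x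
    rw [hF, hG, Equiv.symm_apply_apply]
  · obtain ⟨n, s, t, rfl⟩ := exists_eq_realizationPoint y
    rw [hG, hF, Equiv.apply_symm_apply]

end RealizationPoints

section Contractibility

lemma contractibleSpace_classifyingSpace_punit :
    ContractibleSpace (classifyingSpace (Discrete PUnit.{u + 1})) := by
  let _ (n) : Unique ((nerve (Discrete PUnit.{u + 1})).obj n) :=
    ⟨⟨(Functor.const _).obj ⟨⟨⟩⟩⟩, fun _ => Functor.punit_ext' _ _⟩
  let _ (n) : Unique ((Δ[0] : SSet.{0}).obj n) :=
    ⟨⟨SSet.stdSimplex.objEquiv.symm default⟩, fun _ =>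
      SSet.stdSimplex.objEquiv.injective (SimplexCategory.isTerminalZero.hom_ext _ _)⟩
  obtain ⟨h⟩ := nonempty_homeomorph_toTop_of_equiv
    (X := nerve (Discrete PUnit.{u + 1})) (Y := Δ[0]) (fun _ => Equiv.ofUnique _ _)
    (fun _ _ => Subsingleton.elim _ _)
  exact (h.toHomotopyEquiv.trans
    (Homeomorph.homeomorphOfUnique _ Unit).toHomotopyEquiv).contractibleSpace

lemma contractibleSpace_classifyingSpace_of_isTerminal {C : Type u} [Category.{u} C] {X : C}
    (hX : Limits.IsTerminal X) : ContractibleSpace (classifyingSpace C) := by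
  have := contractibleSpace_classifyingSpace_punit.{u}
  let toX : 𝟭 C ⟶ (Functor.const C).obj X :=
    { app Y := hX.from Y, naturality _ _ _ := hX.hom_ext _ _ }
  exact (classifyingHomotopyEquiv (D := Discrete PUnit.{u + 1}) ((Functor.const _).obj ⟨⟨⟩⟩)
    ((Functor.const _).obj X) (classifyingMap_homotopic toX).symm
    (classifyingMap_homotopic (𝟙 _))).contractibleSpace

end Contractibility

/-! ### Anodyne extensions over a base -/

section RelativeLifts

open SSet

variable {X S E F : SSet.{u}} (q : X ⟶ S) {A : X.Subcomplex} (φ : (A : SSet.{u}) ⟶ E)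
  (p : E ⟶ F) (b : X ⟶ F)

/-- A simplex `base` of `S` together with a partial lift of `b`, defined over this simplex, which
extends `φ`. -/
structure RelativeLift (n : SimplexCategoryᵒᵖ) where
  /-- the simplex of the base -/
  base : S.obj n
  /-- the partial lift -/
  lift : ∀ (m : SimplexCategoryᵒᵖ) (θ : n ⟶ m) (x : X.obj m), q.app m x = S.map θ base → E.obj m
  naturality : ∀ {m m' : SimplexCategoryᵒᵖ} (θ : n ⟶ m) (f : m ⟶ m') (x : X.obj m) h h',
    lift m' (θ ≫ f) (X.map f x) h' = E.map f (lift m θ x h)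
  extends_left : ∀ (m : SimplexCategoryᵒᵖ) (θ : n ⟶ m) (x : X.obj m) h (hx : x ∈ A.obj m),
    lift m θ x h = φ.app m ⟨x, hx⟩
  fac_right : ∀ (m : SimplexCategoryᵒᵖ) (θ : n ⟶ m) (x : X.obj m) h,
    p.app m (lift m θ x h) = b.app m x

namespace RelativeLift

variable {q φ p b} {n m : SimplexCategoryᵒᵖ}

lemma hext {L L' : RelativeLift q φ p b n} (h : L.base = L'.base)
    (h' : ∀ m θ x h₁ h₂, L.lift m θ x h₁ = L'.lift m θ x h₂) : L = L' := by
  obtain ⟨s, l, _, _, _⟩ := L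
  obtain ⟨s', l', _, _, _⟩ := L'
  obtain rfl : s = s' := h
  obtain rfl : l = l' := by
    funext m θ x h
    exact h' m θ x h h
  rfl

lemma lift_congr {L L' : RelativeLift q φ p b n} (hL : L = L') {θ θ' : n ⟶ m} (hθ : θ = θ')
    {x x' : X.obj m} (hx : x = x') (h h') : L.lift m θ x h = L'.lift m θ' x' h' := by
  subst hL hθ hx
  rfl

/-- The action of the simplicial operators on relative lifts. -/
def map (f : n ⟶ m) (L : RelativeLift q φ p b n) : RelativeLift q φ p b m where
  base := S.map f L.base
  lift m θ x h := L.lift m (f ≫ θ) x (by rw [h, Functor.map_comp_apply])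
  naturality θ g x h h' := by
    rw [lift_congr rfl (Category.assoc f θ g).symm rfl _ _]
    · exact L.naturality (f ≫ θ) g x _ _
    · rw [h', Functor.map_comp_apply, Functor.map_comp_apply, Functor.map_comp_apply]
  extends_left m θ x h hx := L.extends_left _ _ _ _ _
  fac_right m θ x h := L.fac_right _ _ _ _

/-- The value of a relative lift on the simplices over its base. -/
def diag (L : RelativeLift q φ p b n) (x : X.obj n) (h : q.app n x = L.base) : E.obj n :=
  L.lift n (𝟙 n) x (by rw [h, Functor.map_id_apply])

lemma map_diag (f : n ⟶ m) (L : RelativeLift q φ p b n) (x : X.obj n)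
    (h : q.app n x = L.base) (h' : q.app m (X.map f x) = (L.map f).base) :
    (L.map f).diag (X.map f x) h' = E.map f (L.diag x h) := by
  have hfx : q.app m (X.map f x) = S.map f L.base := h'
  calc _ = L.lift m (f ≫ 𝟙 m) (X.map f x) (by rw [Category.comp_id, hfx]) := rfl
    _ = L.lift m (𝟙 n ≫ f) (X.map f x) (by rw [Category.id_comp, hfx]) :=
      lift_congr rfl (by simp) rfl _ _
    _ = _ := L.naturality (𝟙 n) f x _ _

lemma diag_congr {L L' : RelativeLift q φ p b n} (hL : L = L') {x x' : X.obj n} (hx : x = x')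
    (h h') : L.diag x h = L'.diag x' h' :=
  lift_congr hL rfl hx _ _

lemma map_diag_eq_lift (f : n ⟶ m) (L : RelativeLift q φ p b n) (x : X.obj m)
    (h : q.app m x = (L.map f).base) : (L.map f).diag x h = L.lift m f x h :=
  lift_congr (L := L) rfl (Category.comp_id f) rfl _ _

end RelativeLift

/-- The simplicial set of relative lifts. Its sections over `S` are the lifts `X ⟶ E` of `b`
extending `φ`. -/
def relativeLifts : SSet.{u} where
  obj n := RelativeLift q φ p b n
  map f := ↾(RelativeLift.map f)
  map_id n := by
    ext L
    refine RelativeLift.hext ?_ fun m θ x h₁ h₂ => ?_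
    · change S.map (𝟙 n) L.base = L.base
      rw [Functor.map_id_apply]
    · exact RelativeLift.lift_congr rfl (Category.id_comp θ) rfl _ _
  map_comp f g := by
    ext L
    refine RelativeLift.hext ?_ fun m θ x h₁ h₂ => ?_
    · change S.map (f ≫ g) L.base = S.map g (S.map f L.base)
      rw [Functor.map_comp_apply]
    · exact RelativeLift.lift_congr rfl (Category.assoc f g θ) rfl _ _

/-- The projection from relative lifts to the base. -/
def relativeLiftsπ : relativeLifts q φ p b ⟶ S where
  app n := ↾(fun L : RelativeLift q φ p b n => L.base)
  naturality _ _ _ := rfl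

variable {q φ p b}

section Total

variable {T Y : SSet.{u}} (t : T ⟶ relativeLifts q φ p b) (c : Y ⟶ X) (d : Y ⟶ T)

/-- The relative lift that a map to `relativeLifts` assigns to a simplex. -/
def relativeLiftAt {n : SimplexCategoryᵒᵖ} (z : T.obj n) : RelativeLift q φ p b n := t.app n z

lemma relativeLiftAt_map {n m : SimplexCategoryᵒᵖ} (f : n ⟶ m) (z : T.obj n) :
    relativeLiftAt t (T.map f z) = (relativeLiftAt t z).map f :=
  NatTrans.naturality_apply t f z

variable {c d}

lemma base_relativeLiftAt (h : c ≫ q = d ≫ t ≫ relativeLiftsπ q φ p b) {n : SimplexCategoryᵒᵖ}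
    (y : Y.obj n) :
    q.app n (c.app n y) = (relativeLiftAt t (d.app n y)).base :=
  ConcreteCategory.congr_hom (congr_app h n) y

variable (h : c ≫ q = d ≫ t ≫ relativeLiftsπ q φ p b)

/-- The map obtained by evaluating the relative lift `t (d y)` at the simplex `c y` above its
base. -/
def totalLift : Y ⟶ E where
  app n := ↾fun y => (relativeLiftAt t (d.app n y)).diag (c.app n y) (base_relativeLiftAt t h y)
  naturality n m f := by
    ext y
    have hL : relativeLiftAt t (d.app m (Y.map f y)) = (relativeLiftAt t (d.app n y)).map f := by
      rw [NatTrans.naturality_apply, relativeLiftAt_map]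
    have hbase : q.app m (X.map f (c.app n y)) = ((relativeLiftAt t (d.app n y)).map f).base := by
      rw [← hL, ← base_relativeLiftAt t h, NatTrans.naturality_apply c]
    exact (RelativeLift.diag_congr hL (NatTrans.naturality_apply c f y)
      (base_relativeLiftAt t h _) hbase).trans (RelativeLift.map_diag f _ _
        (base_relativeLiftAt t h y) _)

lemma totalLift_app_of_mem {n : SimplexCategoryᵒᵖ} (y : Y.obj n) (hy : c.app n y ∈ A.obj n) :
    (totalLift t h).app n y = φ.app n ⟨c.app n y, hy⟩ :=
  RelativeLift.extends_left _ _ _ _ _ hy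

lemma totalLift_comp : totalLift t h ≫ p = c ≫ b := by
  ext n y
  exact RelativeLift.fac_right _ _ _ _ _

end Total

lemma exists_lift_of_section (s : S ⟶ relativeLifts q φ p b)
    (hs : s ≫ relativeLiftsπ q φ p b = 𝟙 S) :
    ∃ l : X ⟶ E, A.ι ≫ l = φ ∧ l ≫ p = b := by
  have h : 𝟙 X ≫ q = q ≫ s ≫ relativeLiftsπ q φ p b := by
    rw [hs, Category.id_comp, Category.comp_id]
  refine ⟨totalLift s h, ?_, by rw [totalLift_comp, Category.id_comp]⟩
  ext n x
  exact totalLift_app_of_mem s h x.1 x.2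

/-- The data exhibiting `Y` as the pullback of `q` along the simplex `τ`. -/
structure IsFiber {n : SimplexCategory} (q : X ⟶ S) (τ : S.obj (op n)) {Y : SSet.{u}} (c : Y ⟶ X)
    (d : Y ⟶ stdSimplex.obj n) : Prop where
  fac : ∀ {m : SimplexCategoryᵒᵖ} (y : Y.obj m),
    q.app m (c.app m y) = S.map (stdSimplex.objEquiv (d.app m y)).op τ
  existsUnique : ∀ {m : SimplexCategoryᵒᵖ} (x : X.obj m) (θ : op n ⟶ m),
    q.app m x = S.map θ τ → ∃! y : Y.obj m, c.app m y = x ∧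
      (stdSimplex.objEquiv (d.app m y)).op = θ

lemma exists_relativeLift_of_isFiber {n : SimplexCategory} {τ : S.obj (op n)} {Y : SSet.{u}}
    {c : Y ⟶ X} {d : Y ⟶ stdSimplex.obj n} (hcd : IsFiber q τ c d) (ℓ : Y ⟶ E)
    (hℓφ : (A.preimage c).ι ≫ ℓ = A.fromPreimage c ≫ φ) (hℓp : ℓ ≫ p = c ≫ b) :
    ∃ L : RelativeLift q φ p b (op n), L.base = τ ∧
      ∀ (m : SimplexCategoryᵒᵖ) (y : Y.obj m) θ h,
        (stdSimplex.objEquiv (d.app m y)).op = θ → L.lift m θ (c.app m y) h = ℓ.app m y := by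
  choose y hy hy_unique using fun m (θ : op n ⟶ m) (x : X.obj m) h => hcd.existsUnique x θ h
  refine ⟨{
    base := τ
    lift m θ x h := ℓ.app m (y m θ x h)
    naturality {m m'} θ f x h h' := ?_
    extends_left m θ x h hx := ?_
    fac_right m θ x h := ?_ }, rfl, fun m y₀ θ h hθ => ?_⟩
  · rw [← NatTrans.naturality_apply]
    congr 1
    refine (hy_unique _ _ _ _ _ ⟨?_, ?_⟩).symm
    · rw [NatTrans.naturality_apply, (hy m θ x h).1]
    · rw [NatTrans.naturality_apply]
      exact congr_arg (· ≫ f) (hy m θ x h).2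
  · have hA : c.app m (y m θ x h) ∈ A.obj m := by rwa [(hy m θ x h).1]
    have hyx : (A.fromPreimage c).app m ⟨y m θ x h, hA⟩ = ⟨x, hx⟩ := Subtype.ext (hy m θ x h).1
    exact (ConcreteCategory.congr_hom (congr_app hℓφ m) ⟨_, hA⟩).trans
      (congr_arg (φ.app m) hyx)
  · exact (ConcreteCategory.congr_hom (congr_app hℓp m) _).trans
      (congr_arg (b.app m) (hy m θ x h).1)
  · exact congr_arg (ℓ.app m) (hy_unique _ _ _ _ _ ⟨rfl, hθ⟩).symm

lemma exists_extension_preimage_sup {T Y : SSet.{u}} {B : T.Subcomplex} {c : Y ⟶ X} {d : Y ⟶ T}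
    {t : (B : SSet.{u}) ⟶ relativeLifts q φ p b} (hφ : φ ≫ p = A.ι ≫ b)
    (h : ((B.preimage d).ι ≫ c) ≫ q = B.fromPreimage d ≫ t ≫ relativeLiftsπ q φ p b) :
    ∃ g : ((A.preimage c ⊔ B.preimage d : Y.Subcomplex) : SSet.{u}) ⟶ E,
      Subcomplex.homOfLE le_sup_left ≫ g = A.fromPreimage c ≫ φ ∧
      Subcomplex.homOfLE le_sup_right ≫ g = totalLift t h ∧
      g ≫ p = Subcomplex.ι _ ≫ c ≫ b := by
  have sq : Subcomplex.BicartSq (A.preimage c ⊓ B.preimage d) (A.preimage c) (B.preimage d)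
    (A.preimage c ⊔ B.preimage d) := ⟨rfl, rfl⟩
  refine ⟨sq.isPushout.desc (A.fromPreimage c ≫ φ) (totalLift t h) ?_, sq.isPushout.inl_desc _ _ _,
    sq.isPushout.inr_desc _ _ _, sq.isPushout.hom_ext ?_ ?_⟩
  · ext n ⟨y, hy⟩
    exact (totalLift_app_of_mem t h ⟨y, hy.2⟩ hy.1).symm
  · rw [sq.isPushout.inl_desc_assoc, Category.assoc, hφ]
    rfl
  · rw [sq.isPushout.inr_desc_assoc, totalLift_comp]
    rfl

lemma exists_boundary_lift {n : ℕ} (hφ : φ ≫ p = A.ι ≫ b)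
    (hq : ∀ τ : S _⦋n⦌, ∃ (Y : SSet.{u}) (c : Y ⟶ X) (d : Y ⟶ Δ[n]), IsFiber q τ c d ∧
      ∀ (g : ((A.preimage c ⊔ (boundary n).preimage d : Y.Subcomplex) : SSet.{u}) ⟶ E)
        (b' : Y ⟶ F), g ≫ p = Subcomplex.ι _ ≫ b' →
        ∃ ℓ : Y ⟶ E, Subcomplex.ι _ ≫ ℓ = g ∧ ℓ ≫ p = b')
    (t : (boundary n : SSet.{u}) ⟶ relativeLifts q φ p b) (v : Δ[n] ⟶ S)
    (htv : t ≫ relativeLiftsπ q φ p b = (boundary n).ι ≫ v) :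
    ∃ L : Δ[n] ⟶ relativeLifts q φ p b,
      (boundary n).ι ≫ L = t ∧ L ≫ relativeLiftsπ q φ p b = v := by
  obtain ⟨τ, rfl⟩ := SSet.yonedaEquiv.symm.surjective v
  obtain ⟨Y, c, d, hcd, hlift⟩ := hq τ
  have hbase : (((boundary n).preimage d).ι ≫ c) ≫ q =
      (boundary n).fromPreimage d ≫ t ≫ relativeLiftsπ q φ p b := by
    rw [htv]
    ext m y
    exact hcd.fac y.1
  obtain ⟨g, hgA, hgd, hgp⟩ := exists_extension_preimage_sup hφ hbase
  obtain ⟨ℓ, hℓ, hℓp⟩ := hlift g (c ≫ b) hgp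
  obtain ⟨L, hLτ, hL⟩ := exists_relativeLift_of_isFiber hcd ℓ (by rw [← hgA, ← hℓ]; rfl) hℓp
  have hℓd : ((boundary n).preimage d).ι ≫ ℓ = totalLift t hbase := by rw [← hgd, ← hℓ]; rfl
  refine ⟨SSet.yonedaEquiv.symm (L : (relativeLifts q φ p b).obj (op ⦋n⦌)), ?_, ?_⟩
  · ext m ⟨z, hz⟩
    change L.map (stdSimplex.objEquiv z).op = relativeLiftAt t ⟨z, hz⟩
    have hzτ : (relativeLiftAt t ⟨z, hz⟩).base = S.map (stdSimplex.objEquiv z).op τ := by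
      have := ConcreteCategory.congr_hom (congr_app htv m) ⟨z, hz⟩
      exact this
    refine RelativeLift.hext (by rw [hzτ, ← hLτ]; rfl) fun k θ x hx hx' => ?_
    obtain ⟨y, ⟨rfl, hdy⟩, -⟩ := hcd.existsUnique x ((stdSimplex.objEquiv z).op ≫ θ)
      (by rw [hx', hzτ, Functor.map_comp_apply])
    have hdyz : d.app k y = Δ[n].map θ z := stdSimplex.objEquiv.injective (Quiver.Hom.op_inj hdy)
    have hy : d.app k y ∈ (boundary n).obj k := hdyz ▸ (boundary n).map θ hz
    calc (L.map (stdSimplex.objEquiv z).op).lift k θ (c.app k y) hx = ℓ.app k y := hL _ _ _ _ hdy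
      _ = (relativeLiftAt t ⟨d.app k y, hy⟩).diag (c.app k y)
          (base_relativeLiftAt t hbase ⟨y, hy⟩) :=
        ConcreteCategory.congr_hom (congr_app hℓd k) ⟨y, hy⟩
      _ = ((relativeLiftAt t ⟨z, hz⟩).map θ).diag (c.app k y) hx' := RelativeLift.diag_congr
        ((congr_arg (relativeLiftAt t) (Subtype.ext hdyz)).trans (relativeLiftAt_map t θ _)) rfl _ _
      _ = _ := RelativeLift.map_diag_eq_lift _ _ _ _
  · apply SSet.yonedaEquiv.injective
    change S.map (𝟙 _) L.base = _
    rw [Equiv.apply_symm_apply, Functor.map_id_apply, hLτ]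

/- A lift in a square from `A.ι` to a fibration is a section of the projection from the relative
lifts to the base. By the hypothesis, this projection lifts against boundary inclusions, hence it
is a trivial fibration. -/
theorem anodyneExtensions_of_isFiber (q : X ⟶ S) (A : X.Subcomplex)
    (hq : ∀ (n : ℕ) (τ : S _⦋n⦌), ∃ (Y : SSet.{u}) (c : Y ⟶ X) (d : Y ⟶ Δ[n]), IsFiber q τ c d ∧
      anodyneExtensions (A.preimage c ⊔ (boundary n).preimage d : Y.Subcomplex).ι) :
    anodyneExtensions A.ι := by
  intro E F p hp
  refine ⟨fun {φ b} sq => ?_⟩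
  have hπ : (modelCategoryQuillen.I : MorphismProperty SSet.{u}).rlp
      (relativeLiftsπ q φ p b) := by
    rintro _ _ _ ⟨n⟩
    refine ⟨fun {t v} sq_boundary => ?_⟩
    obtain ⟨L, hLt, hLv⟩ := exists_boundary_lift sq.w (fun τ => by
      obtain ⟨Y, c, d, hcd, hY⟩ := hq n τ
      refine ⟨Y, c, d, hcd, fun g b' h => ?_⟩
      have := hY _ hp
      have sq_fiber : CommSq g (Subcomplex.ι _) p b' := ⟨h⟩
      exact ⟨sq_fiber.lift, sq_fiber.fac_left, sq_fiber.fac_right⟩) t v sq_boundary.w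
    exact ⟨⟨⟨L, hLt, hLv⟩⟩⟩
  rw [← rlp_monomorphisms] at hπ
  have := hπ (Limits.initial.to S) (inferInstanceAs (Mono _))
  have sq_empty : CommSq (Limits.initial.to _) (Limits.initial.to S) (relativeLiftsπ q φ p b)
    (𝟙 S) := ⟨Limits.initialIsInitial.hom_ext _ _⟩
  obtain ⟨l, hlφ, hlb⟩ := exists_lift_of_section sq_empty.lift sq_empty.fac_right
  exact ⟨⟨⟨l, hlφ, hlb⟩⟩⟩

end RelativeLifts

section NerveSubcomplex

variable {C : Type u} [Category.{v} C]

/-- The subcomplex of the nerve spanned by the objects with a given property. -/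
def nerveSubcomplex (U : ObjectProperty C) : (nerve C).Subcomplex where
  obj _ := {x | ∀ k, U ((x : ComposableArrows C _).obj k)}
  map _ _ hx _ := hx _

lemma nonempty_homeomorph_nerveSubcomplex (U : ObjectProperty C) :
    Nonempty (classifyingSpace U.FullSubcategory ≃ₜ
      SSet.toTop.obj (nerveSubcomplex U : SSet.{max u v})) :=
  nonempty_homeomorph_toTop_of_equiv (fun _ =>
    { toFun x := ⟨(x : ComposableArrows U.FullSubcategory _) ⋙ U.ι,
        fun k => ((x : ComposableArrows U.FullSubcategory _).obj k).property⟩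
      invFun x := U.lift x.1 x.2
      left_inv _ := rfl
      right_inv _ := rfl }) fun _ _ => rfl

/-- The homotopy equivalence of classifying spaces induced by an equivalence of categories. -/
noncomputable def classifyingHomotopyEquivOfEquivalence {D : Type u} [Category.{v} D] (e : C ≌ D) :
    classifyingSpace C ≃ₕ classifyingSpace D :=
  classifyingHomotopyEquiv e.functor e.inverse
    (classifyingMap_homotopic e.unitIso.inv) (classifyingMap_homotopic e.counitIso.hom)

end NerveSubcomplex

section HomotopyOrbit

variable {G P : Type} [Group G] [Preorder P]

/-- The homotopy orbit category of a group acting on a poset: the objects are the points of the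
poset, and a morphism from `x` to `y` is an element of the group moving `x` below `y`. Its
classifying space is a model of the homotopy quotient of `|P|` by `G`. -/
structure HomotopyOrbit (ρ : G →* (P ≃o P)) : Type where
  /-- the point of the poset -/
  pt : P

namespace HomotopyOrbit

variable {ρ : G →* (P ≃o P)}

instance : Category.{0} (HomotopyOrbit ρ) where
  Hom x y := {g : G // ρ g x.pt ≤ y.pt}
  id x := ⟨1, by rw [map_one]; exact le_rfl⟩
  comp f g := ⟨g.1 * f.1, by
    rw [map_mul]
    exact ((ρ g.1).monotone f.2).trans g.2⟩
  id_comp f := Subtype.ext (mul_one _)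
  comp_id f := Subtype.ext (one_mul _)
  assoc f g h := Subtype.ext (mul_assoc _ _ _).symm

@[simp] lemma comp_val {x y z : HomotopyOrbit ρ} (f : x ⟶ y) (g : y ⟶ z) :
    (f ≫ g).1 = g.1 * f.1 := rfl

lemma eqToHom_val {x y : HomotopyOrbit ρ} (h : x = y) : Subtype.val (eqToHom h) = 1 := by
  subst h
  rfl

lemma functor_ext {C : Type w} [Category.{w'} C] {F F' : C ⥤ HomotopyOrbit ρ}
    (h : ∀ x, (F.obj x).pt = (F'.obj x).pt) (h' : ∀ {x y} (f : x ⟶ y), (F.map f).1 = (F'.map f).1) :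
    F = F' := by
  refine CategoryTheory.Functor.ext (fun x => ?_) fun x y f => Subtype.ext ?_
  · exact congr_arg mk (h x)
  · simp [eqToHom_val, h']

variable (ρ) in
/-- The functor remembering the element of the group only. -/
def proj : HomotopyOrbit ρ ⥤ SingleObj G where
  obj _ := SingleObj.star G
  map f := f.1

section Twist

variable {n m : ℕ} (τ : ComposableArrows (SingleObj G) n)

/-- The simplex of the nerve of the homotopy orbit category attached to a simplex of the nerve of
the group and to a simplex of the nerve of the poset. -/
def twist (y : ComposableArrows P m) (θ : Fin (m + 1) →o Fin (n + 1)) :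
    ComposableArrows (HomotopyOrbit ρ) m where
  obj k := ⟨ρ (τ.map (homOfLE (Fin.zero_le (θ k)))) (y.obj k)⟩
  map {k l} f := ⟨τ.map (homOfLE (θ.monotone (leOfHom f))), by
    have h : (τ.map (homOfLE (θ.monotone (leOfHom f))) : G) *
        τ.map (homOfLE (Fin.zero_le (θ k))) = τ.map (homOfLE (Fin.zero_le (θ l))) :=
      (τ.map_comp _ _).symm
    change (ρ _ * ρ _) _ ≤ _
    rw [← map_mul, h]
    exact (ρ _).monotone (leOfHom (y.map f))⟩
  map_id k := Subtype.ext (τ.map_id _)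
  map_comp f g := Subtype.ext (τ.map_comp _ _)

variable {τ} {θ : Fin (m + 1) →o Fin (n + 1)}

lemma twist_injective {y z : ComposableArrows P m}
    (h : twist (ρ := ρ) τ y θ = twist (ρ := ρ) τ z θ) : y = z :=
  CategoryTheory.Functor.ext
    (fun k => (ρ _).injective (congr_arg pt (Functor.congr_obj h k)))
    fun _ _ _ => Subsingleton.elim _ _

lemma map_val_of_proj_eq {x : ComposableArrows (HomotopyOrbit ρ) m}
    (h : x ⋙ proj ρ = θ.monotone.functor ⋙ τ) {k l : Fin (m + 1)} (f : k ⟶ l) :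
    (x.map f).1 = τ.map (homOfLE (θ.monotone (leOfHom f))) := by
  have eqToHom_comp_comp : ∀ (e₁ e₂ : SingleObj.star G = SingleObj.star G)
      (g : SingleObj.star G ⟶ SingleObj.star G), eqToHom e₁ ≫ g ≫ eqToHom e₂ = g := by
    intros
    simp
  exact (Functor.congr_hom h f).trans (eqToHom_comp_comp _ _ _)

lemma exists_twist_eq {x : ComposableArrows (HomotopyOrbit ρ) m}
    (h : x ⋙ proj ρ = θ.monotone.functor ⋙ τ) :
    ∃ y : ComposableArrows P m, twist τ y θ = x := by
  have hmap := fun {k l : Fin (m + 1)} (f : k ⟶ l) => map_val_of_proj_eq h f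
  let γ (k : Fin (m + 1)) : G := τ.map (homOfLE (Fin.zero_le (θ k)))
  have hγ {k l : Fin (m + 1)} (f : k ⟶ l) : (x.map f).1 * γ k = γ l :=
    (congr_arg (· * γ k) (hmap f)).trans
      (τ.map_comp (homOfLE (Fin.zero_le (θ k))) (homOfLE (θ.monotone (leOfHom f)))).symm
  have hle {k l : Fin (m + 1)} (f : k ⟶ l) :
      (ρ (γ k)).symm (x.obj k).pt ≤ (ρ (γ l)).symm (x.obj l).pt := by
    rw [OrderIso.le_symm_apply, ← hγ f, map_mul]
    change ρ _ (ρ _ ((ρ _).symm _)) ≤ _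
    rw [OrderIso.apply_symm_apply]
    exact (x.map f).2
  exact ⟨{ obj := fun k => (ρ (γ k)).symm (x.obj k).pt, map := fun f => homOfLE (hle f) },
    functor_ext (fun k => (ρ (γ k)).apply_symm_apply _) fun f => (hmap f).symm⟩

end Twist

/-- The map exhibiting `nerve P ⊗ Δ[n]` as the fiber of the nerve of `proj` over the simplex
`τ`. -/
def twistMap {n : ℕ} (τ : ComposableArrows (SingleObj G) n) :
    nerve P ⊗ Δ[n] ⟶ nerve (HomotopyOrbit ρ) where
  app _ := ↾fun z => twist τ z.1 (SSet.stdSimplex.objEquiv z.2).toOrderHom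
  naturality _ _ _ := rfl

lemma isFiber_twistMap {n : ℕ} (τ : ComposableArrows (SingleObj G) n) :
    IsFiber (S := nerve (SingleObj G)) (nerveMap (proj ρ)) (n := ⦋n⦌) τ (twistMap τ)
      (CartesianMonoidalCategory.snd (nerve P) Δ[n]) where
  fac y := rfl
  existsUnique {m} x θ hx := by
    obtain ⟨y, rfl⟩ := exists_twist_eq (x := x) (θ := SimplexCategory.Hom.toOrderHom θ.unop) hx
    refine ⟨(y, SSet.stdSimplex.objEquiv.symm θ.unop), ⟨rfl, rfl⟩, ?_⟩
    rintro ⟨z, θ'⟩ ⟨hz, hθ'⟩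
    obtain rfl : θ' = SSet.stdSimplex.objEquiv.symm θ.unop :=
      SSet.stdSimplex.objEquiv.injective (Quiver.Hom.op_inj hθ')
    exact congr_arg (·, _) (twist_injective hz)

lemma anodyneExtensions_nerveSubcomplex {U : ObjectProperty P} (hU : ∀ g x, U (ρ g x) ↔ U x)
    (h : SSet.anodyneExtensions (nerveSubcomplex U).ι) :
    SSet.anodyneExtensions (nerveSubcomplex fun x : HomotopyOrbit ρ => U x.pt).ι := by
  refine anodyneExtensions_of_isFiber (nerveMap (proj ρ)) _ fun n τ =>
    ⟨_, _, _, isFiber_twistMap τ, ?_⟩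
  have hpreimage : (nerveSubcomplex fun x : HomotopyOrbit ρ => U x.pt).preimage (twistMap τ) ⊔
      (SSet.boundary n).preimage (CartesianMonoidalCategory.snd (nerve P) Δ[n]) =
      (nerveSubcomplex U).unionProd (SSet.boundary n) := by
    ext m x
    exact (or_congr (forall_congr' fun k => hU _ _) Iff.rfl).trans (or_comm.trans
      (SSet.Subcomplex.mem_unionProd_iff (S := nerveSubcomplex U) (T := SSet.boundary n) x).symm)
  rw [hpreimage]
  exact SSet.anodyneExtensions_unionProd_ι' (nerveSubcomplex U) (SSet.boundary n) h

variable (ρ) in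
/-- The equivalence showing that the homotopy quotient of a poset with a greatest element is the
classifying space of the group. -/
noncomputable def homotopyEquivOfOrderTop [OrderTop P] :
    classifyingSpace (HomotopyOrbit ρ) ≃ₕ classifyingSpace (SingleObj G) :=
  let top : SingleObj G ⥤ HomotopyOrbit ρ :=
    { obj := fun _ => ⟨⊤⟩
      map := fun g => ⟨g, le_top⟩
      map_id := fun _ => rfl
      map_comp := fun _ _ => rfl }
  classifyingHomotopyEquiv (proj ρ) top
    (classifyingMap_homotopic (F := 𝟭 _) (G := proj ρ ⋙ top)
      { app := fun _ => ⟨1, le_top⟩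
        naturality := fun _ _ _ => Subtype.ext ((one_mul _).trans (mul_one _).symm) }).symm
    (classifyingMap_homotopic (𝟙 _))

end HomotopyOrbit

end HomotopyOrbit

/-! ### Rooted trees -/

section NerveVertices

variable {Q : Type u} [PartialOrder Q]

/-- The set of vertices of a simplex of the nerve of a partial order. -/
def nerveVertices (s : (nerve Q).S) : Set Q :=
  Set.range (s.simplex : ComposableArrows Q s.dim).obj

lemma eq_of_nerveVertices_eq {s t : (nerve Q).S} (hs : s.simplex ∈ (nerve Q).nonDegenerate _)
    (ht : t.simplex ∈ (nerve Q).nonDegenerate _) (h : nerveVertices s = nerveVertices t) :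
    s = t := by
  obtain @⟨n, s⟩ := s
  obtain @⟨m, t⟩ := t
  replace hs : StrictMono (s : ComposableArrows Q n).obj :=
    (PartialOrder.mem_nerve_nonDegenerate_iff_strictMono _).1 hs
  replace ht : StrictMono (t : ComposableArrows Q m).obj :=
    (PartialOrder.mem_nerve_nonDegenerate_iff_strictMono _).1 ht
  replace h : Set.range (s : ComposableArrows Q n).obj =
    Set.range (t : ComposableArrows Q m).obj := h
  obtain rfl : n = m := by
    have hcard := congr_arg Set.ncard h
    rw [← Set.image_univ, ← Set.image_univ, Set.ncard_image_of_injective _ hs.injective,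
      Set.ncard_image_of_injective _ ht.injective] at hcard
    simpa using hcard
  have hobj := (hs.range_inj ht).1 h
  congr 1
  exact CategoryTheory.Functor.ext (fun k => congr_fun hobj k) fun _ _ _ => Subsingleton.elim _ _

lemma nerveVertices_mono {s t : (nerve Q).N} (h : s ≤ t) :
    nerveVertices s.toS ⊆ nerveVertices t.toS := by
  obtain ⟨f, _, hf⟩ := SSet.N.le_iff_exists_mono.1 h
  rintro _ ⟨k, rfl⟩
  rw [← hf]
  exact ⟨_, rfl⟩

end NerveVertices

section StrictMonoVectors

lemma range_vec₃ {α : Type u} (a b c : α) : Set.range ![a, b, c] = {a, b, c} := by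
  rw [Matrix.range_cons, Matrix.range_cons_cons_empty]
  rfl

lemma strictMono_vec₂ {α : Type u} [Preorder α] {a b : α} (h : a < b) : StrictMono ![a, b] := by
  rw [Fin.strictMono_iff_lt_succ]
  intro i
  fin_cases i
  exact h

lemma strictMono_vec₃ {α : Type u} [Preorder α] {a b c : α} (h : a < b) (h' : b < c) :
    StrictMono ![a, b, c] := by
  rw [Fin.strictMono_iff_lt_succ]
  intro i
  fin_cases i
  exacts [h, h']

lemma exists_range_eq_insert_top {P : Type u} [Preorder P] {n : ℕ} {f : Fin (n + 1) → WithTop P}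
    (hf : StrictMono f) (h : ⊤ ∈ Set.range f) :
    ∃ g : Fin n → P, StrictMono g ∧ Set.range f = insert ⊤ ((↑) '' Set.range g) := by
  have hlast : f (Fin.last n) = ⊤ := by
    obtain ⟨k, hk⟩ := h
    exact WithTop.top_le_iff.1 (hk.ge.trans (hf.monotone (Fin.le_last k)))
  have hne_top (k : Fin n) : ∃ x : P, x = f k.castSucc :=
    WithTop.ne_top_iff_exists.1 (ne_top_of_lt (hf (Fin.castSucc_lt_last k)))
  choose g hg using hne_top
  refine ⟨g, fun k l hkl => WithTop.coe_lt_coe.1 ?_, ?_⟩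
  · rw [hg, hg]
    exact hf (Fin.castSucc_lt_castSucc_iff.2 hkl)
  · ext y
    simp [Fin.exists_fin_succ', hlast, hg, or_comm, eq_comm]

end StrictMonoVectors

/-- A tree, presented as a poset without chains of three elements together with a root and a
function attaching to each point the next one on the way to the root. -/
structure RootedTreePoset (P : Type u) [PartialOrder P] where
  /-- the root -/
  root : P
  /-- the parent -/
  parent : P → P
  /-- a measure of the distance to the root -/
  height : P → ℕ
  not_chain : ∀ x y z : P, x < y → ¬ y < z
  parent_lt_or_lt : ∀ x, x ≠ root → parent x < x ∨ x < parent x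
  height_lt : ∀ x, x ≠ root → height (parent x) < height x
  eq_parent : ∀ x y : P, x < y → (x ≠ root ∧ y = parent x) ∨ (y ≠ root ∧ x = parent y)

namespace RootedTreePoset

variable {P : Type u} [PartialOrder P] (T : RootedTreePoset P)

lemma parent_ne (x : P) (hx : x ≠ T.root) : T.parent x ≠ x := fun h =>
  (T.height_lt x hx).ne (congr_arg T.height h)

lemma ne_parent_of_eq_parent {x y : P} (hx : x ≠ T.root) (hy : y ≠ T.root)
    (h : y = T.parent x) : x ≠ T.parent y := fun h' =>
  lt_asymm (h ▸ T.height_lt x hx) (h' ▸ T.height_lt y hy)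

/-- The dimension of the simplex `T.pairFace s`, the smaller one of the pair indexed by `s`. -/
def pairDim (s : Option {x : P // x ≠ T.root}) : ℕ :=
  match s with
  | none => 0
  | some _ => 1

open Classical in
/-- The larger simplices of the pairs in which the simplices of the cone over a rooted tree,
which are not simplices of the tree, are matched. These pairs are indexed by the points `x` of the
tree, the root being `none`, and the larger simplex consists of `x`, its parent and the apex of the
cone. -/
noncomputable def pairSeq (s : Option {x : P // x ≠ T.root}) :
    Fin (T.pairDim s + 2) → WithTop P :=
  match s with
  | none => ![(T.root : WithTop P), ⊤]
  | some x => if x.1 < T.parent x then ![(x.1 : WithTop P), T.parent x, ⊤] else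
      ![(T.parent x : WithTop P), x.1, ⊤]

open Classical in
/-- The vertex to be removed from the larger simplex of a pair to get the smaller one: the parent,
or the root. -/
noncomputable def pairIndex (s : Option {x : P // x ≠ T.root}) : Fin (T.pairDim s + 2) :=
  match s with
  | none => 0
  | some x => if x.1 < T.parent x then 1 else 0

/-- The smaller simplex of a pair. -/
noncomputable def pairFace (s : Option {x : P // x ≠ T.root}) :
    Fin (T.pairDim s + 1) → WithTop P :=
  T.pairSeq s ∘ (T.pairIndex s).succAbove

lemma pairSeq_of_lt {x : {x : P // x ≠ T.root}} (h : x.1 < T.parent x) :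
    T.pairSeq (some x) = ![(x.1 : WithTop P), T.parent x, ⊤] :=
  if_pos h

lemma pairSeq_of_not_lt {x : {x : P // x ≠ T.root}} (h : ¬ x.1 < T.parent x) :
    T.pairSeq (some x) = ![(T.parent x : WithTop P), x.1, ⊤] :=
  if_neg h

lemma strictMono_pairSeq (s) : StrictMono (T.pairSeq s) := by
  rcases s with _ | x
  · exact strictMono_vec₂ (WithTop.coe_lt_top T.root)
  · by_cases h : x.1 < T.parent x
    · rw [T.pairSeq_of_lt h]
      exact strictMono_vec₃ (WithTop.coe_lt_coe.2 h) (WithTop.coe_lt_top _)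
    · rw [T.pairSeq_of_not_lt h]
      exact strictMono_vec₃ (WithTop.coe_lt_coe.2 ((T.parent_lt_or_lt _ x.2).resolve_right h))
        (WithTop.coe_lt_top _)

lemma strictMono_pairFace (s) : StrictMono (T.pairFace s) :=
  (T.strictMono_pairSeq s).comp (Fin.strictMono_succAbove _)

lemma range_pairSeq_none : Set.range (T.pairSeq none) = {(T.root : WithTop P), ⊤} :=
  Matrix.range_cons_cons_empty _ _ _

lemma range_pairSeq_some (x) :
    Set.range (T.pairSeq (some x)) = {(x.1 : WithTop P), ↑(T.parent x), ⊤} := by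
  by_cases h : x.1 < T.parent x
  · rw [T.pairSeq_of_lt h]
    exact range_vec₃ _ _ _
  · rw [T.pairSeq_of_not_lt h]
    exact (range_vec₃ _ _ _).trans (Set.insert_comm _ _ _)

lemma range_pairFace_none : Set.range (T.pairFace none) = {⊤} := by
  ext y
  change (∃ k : Fin 1, ![(T.root : WithTop P), ⊤] (Fin.succAbove 0 k) = y) ↔ _
  simp [eq_comm]

lemma range_pairFace_some (x) : Set.range (T.pairFace (some x)) = {(x.1 : WithTop P), ⊤} := by
  unfold pairFace
  by_cases h : x.1 < T.parent x
  · have hindex : T.pairIndex (some x) = (1 : Fin 3) := if_pos h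
    rw [T.pairSeq_of_lt h, hindex]
    ext y
    change (∃ k : Fin 2, ![(x.1 : WithTop P), T.parent x, ⊤] (Fin.succAbove 1 k) = y) ↔ _
    simp [Fin.exists_fin_two, eq_comm, Fin.succAbove]
  · have hindex : T.pairIndex (some x) = (0 : Fin 3) := if_neg h
    rw [T.pairSeq_of_not_lt h, hindex]
    ext y
    change (∃ k : Fin 2, ![(T.parent x : WithTop P), x.1, ⊤] (Fin.succAbove 0 k) = y) ↔ _
    simp [Fin.exists_fin_two, eq_comm, Fin.succAbove]

lemma top_mem_range_pairFace (s) : ⊤ ∈ Set.range (T.pairFace s) := by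
  rcases s with _ | x
  · simp [range_pairFace_none]
  · simp [range_pairFace_some]

lemma range_pairSeq_injective {s t} (h : Set.range (T.pairSeq s) = Set.range (T.pairSeq t)) :
    s = t := by
  rcases s with _ | ⟨x, hx⟩ <;> rcases t with _ | ⟨y, hy⟩
  · rfl
  · rw [range_pairSeq_none, range_pairSeq_some, Set.ext_iff] at h
    exact absurd (by simpa using h y) hy
  · rw [range_pairSeq_none, range_pairSeq_some, Set.ext_iff] at h
    exact absurd (by simpa using h x) hx
  · rw [range_pairSeq_some, range_pairSeq_some, Set.ext_iff] at h
    have hxy : x = y ∨ x = T.parent y := by simpa using h x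
    have hyx : y = x ∨ y = T.parent x := by simpa using h y
    obtain rfl : x = y := by
      rcases hxy with hxy | hxy
      · exact hxy
      · exact (hyx.resolve_right fun hyx => T.ne_parent_of_eq_parent hx hy hyx hxy).symm
    rfl

lemma range_pairFace_injective {s t} (h : Set.range (T.pairFace s) = Set.range (T.pairFace t)) :
    s = t := by
  rcases s with _ | ⟨x, hx⟩ <;> rcases t with _ | ⟨y, hy⟩
  · rfl
  · rw [range_pairFace_none, range_pairFace_some, Set.ext_iff] at h
    simpa using h y
  · rw [range_pairFace_none, range_pairFace_some, Set.ext_iff] at h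
    simpa using h x
  · rw [range_pairFace_some, range_pairFace_some, Set.ext_iff] at h
    obtain rfl : x = y := by simpa using h x
    rfl

lemma range_pairSeq_ne_range_pairFace (s t) :
    Set.range (T.pairSeq s) ≠ Set.range (T.pairFace t) := by
  intro h
  rcases s with _ | ⟨x, hx⟩ <;> rcases t with _ | ⟨y, hy⟩
  · rw [range_pairFace_none, range_pairSeq_none, Set.ext_iff] at h
    simpa using h T.root
  · rw [range_pairFace_some, range_pairSeq_none, Set.ext_iff] at h
    exact absurd (by simpa using h y) hy
  · rw [range_pairFace_none, range_pairSeq_some, Set.ext_iff] at h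
    simpa using h x
  · rw [range_pairFace_some, range_pairSeq_some, Set.ext_iff] at h
    have hxy : x = y := by simpa using h x
    have hparent : T.parent x = y := by simpa using h (T.parent x)
    exact T.parent_ne _ hx (hparent.trans hxy.symm)

lemma exists_range_pairSeq_eq_or_range_pairFace_eq {n : ℕ} {f : Fin (n + 1) → WithTop P}
    (hf : StrictMono f) (h : ⊤ ∈ Set.range f) :
    ∃ s, Set.range f = Set.range (T.pairSeq s) ∨ Set.range f = Set.range (T.pairFace s) := by
  obtain ⟨g, hg, hrange⟩ := exists_range_eq_insert_top hf h
  rw [hrange]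
  match n, g, hg with
  | 0, g, _ =>
    refine ⟨none, Or.inr ?_⟩
    rw [range_pairFace_none]
    simp
  | 1, g, _ =>
    rw [Set.range_unique, Set.image_singleton, Set.pair_comm]
    by_cases hroot : g default = T.root
    · exact ⟨none, Or.inl (by rw [range_pairSeq_none, hroot])⟩
    · exact ⟨some ⟨_, hroot⟩, Or.inr (T.range_pairFace_some ⟨_, hroot⟩).symm⟩
  | 2, g, hg =>
    have hrange_g : Set.range g = {g 0, g 1} := by
      ext
      simp [eq_comm, Fin.exists_fin_two]
    rw [hrange_g, Set.image_pair]
    rcases T.eq_parent (g 0) (g 1) (hg (by simp)) with ⟨hroot, hparent⟩ | ⟨hroot, hparent⟩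
    · refine ⟨some ⟨_, hroot⟩, Or.inl ?_⟩
      rw [range_pairSeq_some, hparent]
      grind
    · refine ⟨some ⟨_, hroot⟩, Or.inl ?_⟩
      rw [range_pairSeq_some, hparent]
      grind
  | n + 3, g, hg =>
    have h₀₁ : (⟨0, by omega⟩ : Fin (n + 3)) < ⟨1, by omega⟩ := Nat.one_pos
    have h₁₂ : (⟨1, by omega⟩ : Fin (n + 3)) < ⟨2, by omega⟩ := Nat.one_lt_two
    exact absurd (hg h₁₂) (T.not_chain _ _ _ (hg h₀₁))

lemma functor_mem_nonDegenerate {Q : Type u} [PartialOrder Q] {n : ℕ} {f : Fin (n + 1) → Q}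
    (hf : StrictMono f) : (hf.monotone.functor : (nerve Q) _⦋n⦌) ∈ (nerve Q).nonDegenerate n :=
  (PartialOrder.mem_nerve_nonDegenerate_iff_strictMono _).2 hf

/-- The pairing of the simplices in the cone over a rooted tree which are not simplices of the
tree. -/
noncomputable def pairingCore :
    (nerveSubcomplex fun x : WithTop P => x ≠ ⊤).PairingCore where
  ι := Option {x : P // x ≠ T.root}
  dim s := T.pairDim s
  simplex s := ((T.strictMono_pairSeq s).monotone.functor : ComposableArrows _ _)
  index s := T.pairIndex s
  nonDegenerate₁ s := functor_mem_nonDegenerate (T.strictMono_pairSeq s)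
  nonDegenerate₂ s := functor_mem_nonDegenerate (T.strictMono_pairFace s)
  notMem₁ s h := by
    obtain ⟨k, hk⟩ := T.top_mem_range_pairFace s
    exact h _ hk
  notMem₂ s h := by
    obtain ⟨k, hk⟩ := T.top_mem_range_pairFace s
    exact h k hk
  injective_type₁' h := T.range_pairSeq_injective (congr_arg nerveVertices h)
  injective_type₂' h := T.range_pairFace_injective (congr_arg nerveVertices h)
  type₁_ne_type₂' s t h := T.range_pairSeq_ne_range_pairFace s t (congr_arg nerveVertices h)
  surjective' x := by
    have hx : StrictMono (x.simplex : ComposableArrows (WithTop P) x.dim).obj :=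
      (PartialOrder.mem_nerve_nonDegenerate_iff_strictMono _).1 x.nonDegenerate
    have htop : ⊤ ∈ Set.range (x.simplex : ComposableArrows (WithTop P) x.dim).obj := by
      by_contra! h
      exact x.notMem fun k hk => h ⟨k, hk⟩
    obtain ⟨s, h | h⟩ := T.exists_range_pairSeq_eq_or_range_pairFace_eq hx htop
    · exact ⟨s, Or.inl (eq_of_nerveVertices_eq x.nonDegenerate
        (functor_mem_nonDegenerate (T.strictMono_pairSeq s)) h)⟩
    · exact ⟨s, Or.inr (eq_of_nerveVertices_eq x.nonDegenerate
        (functor_mem_nonDegenerate (T.strictMono_pairFace s)) h)⟩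

/-- The height, as the order in which the simplices of the cone are attached to the tree. -/
noncomputable def rankFunction : T.pairingCore.RankFunction ℕ where
  rank s := (s : Option {x : P // x ≠ T.root}).elim 0 fun x => T.height x + 1
  lt {s t} h := by
    obtain ⟨hne, hlt⟩ := h
    have hsub : Set.range (T.pairFace s) ⊆ Set.range (T.pairSeq t) := nerveVertices_mono hlt.le
    rcases (s : Option {x : P // x ≠ T.root}) with _ | x <;>
      rcases (t : Option {x : P // x ≠ T.root}) with _ | y
    · exact absurd rfl hne
    · simp
    · rw [range_pairFace_some, range_pairSeq_none] at hsub
      exact absurd (by simpa using hsub (Set.mem_insert _ _)) x.2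
    · rw [range_pairFace_some, range_pairSeq_some] at hsub
      have hxy : x.1 = y.1 ∨ x.1 = T.parent y := by simpa using hsub (Set.mem_insert _ _)
      rcases hxy with hxy | hxy
      · exact absurd (congr_arg some (Subtype.ext hxy)) hne
      · simpa [hxy] using T.height_lt _ y.2

theorem anodyneExtensions_nerveSubcomplex_ne_top (T : RootedTreePoset P) :
    SSet.anodyneExtensions (nerveSubcomplex fun x : WithTop P => x ≠ ⊤).ι := by
  have := T.rankFunction.isRegular
  exact T.pairingCore.pairing.anodyneExtensions

end RootedTreePoset

lemma nonempty_homotopyEquiv_of_anodyneExtensions_nerveSubcomplex {C : Type u} [Category.{u} C]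
    {U : ObjectProperty C} (hU : SSet.anodyneExtensions (nerveSubcomplex U).ι) :
    Nonempty (classifyingSpace U.FullSubcategory ≃ₕ classifyingSpace C) := by
  obtain ⟨h⟩ := nonempty_homeomorph_nerveSubcomplex U
  obtain ⟨h'⟩ := nonempty_homotopyEquiv_of_anodyne hU
  exact ⟨h.toHomotopyEquiv.trans h'⟩

section WithTop

/-- The inclusion of a poset into the poset with a greatest element adjoined. -/
def toWithTop (P : Type u) [Preorder P] :
    P ⥤ (ObjectProperty.FullSubcategory fun x : WithTop P => x ≠ ⊤) :=
  ObjectProperty.lift _ (Monotone.functor (f := ((↑) : P → WithTop P)) fun _ _ h =>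
    WithTop.coe_le_coe.2 h) fun _ => WithTop.coe_ne_top

section

variable {P : Type u} [Preorder P]

instance : (toWithTop P).Faithful where
  map_injective _ := Subsingleton.elim _ _

instance : (toWithTop P).Full where
  map_surjective f := ⟨homOfLE (WithTop.coe_le_coe.1 (leOfHom f.hom)),
    ObjectProperty.hom_ext _ (Subsingleton.elim _ _)⟩

instance : (toWithTop P).EssSurj where
  mem_essImage := fun ⟨x, hx⟩ => by
    lift x to P using hx
    exact ⟨x, ⟨Iso.refl _⟩⟩

instance : (toWithTop P).IsEquivalence where

end

theorem RootedTreePoset.contractibleSpace {P : Type u} [PartialOrder P] (T : RootedTreePoset P) :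
    ContractibleSpace (classifyingSpace P) := by
  obtain ⟨h⟩ := nonempty_homotopyEquiv_of_anodyneExtensions_nerveSubcomplex
    T.anodyneExtensions_nerveSubcomplex_ne_top
  have : ContractibleSpace (classifyingSpace (WithTop P)) :=
    contractibleSpace_classifyingSpace_of_isTerminal (Limits.isTerminalTop (α := WithTop P))
  exact ((classifyingHomotopyEquivOfEquivalence
    (toWithTop P).asEquivalence).trans h).contractibleSpace

namespace HomotopyOrbit

variable {G P : Type} [Group G] [PartialOrder P] (ρ : G →* (P ≃o P))

/-- The action of a group on a poset to which a fixed greatest element has been adjoined. -/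
def withTop : G →* (WithTop P ≃o WithTop P) where
  toFun g := (ρ g).withTopCongr
  map_one' := by
    ext x
    cases x <;> simp
  map_mul' g h := by
    ext x
    cases x <;> simp

lemma withTop_ne_top_iff (g : G) (x : WithTop P) : withTop ρ g x ≠ ⊤ ↔ x ≠ ⊤ := by
  simp

/-- The inclusion into the homotopy orbit category of the poset to which a greatest element has
been adjoined. -/
def toWithTop : HomotopyOrbit ρ ⥤
    (ObjectProperty.FullSubcategory fun x : HomotopyOrbit (withTop ρ) => x.pt ≠ ⊤) :=
  ObjectProperty.lift _
    { obj := fun x => ⟨x.pt⟩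
      map := fun f => ⟨f.1, WithTop.coe_le_coe.2 f.2⟩
      map_id := fun _ => rfl
      map_comp := fun _ _ => rfl } fun _ => WithTop.coe_ne_top

instance : (toWithTop ρ).Faithful where
  map_injective h := Subtype.ext (congr_arg (fun f => Subtype.val (InducedCategory.Hom.hom f)) h)

instance : (toWithTop ρ).Full where
  map_surjective f := ⟨⟨f.hom.1, WithTop.coe_le_coe.1 f.hom.2⟩, rfl⟩

instance : (toWithTop ρ).EssSurj where
  mem_essImage := fun ⟨⟨x⟩, hx⟩ => by
    lift x to P using hx
    exact ⟨⟨x⟩, ⟨Iso.refl _⟩⟩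

instance : (toWithTop ρ).IsEquivalence where

theorem nonempty_homotopyEquiv_of_rootedTreePoset (T : RootedTreePoset P) :
    Nonempty (classifyingSpace (HomotopyOrbit ρ) ≃ₕ classifyingSpace (SingleObj G)) := by
  obtain ⟨h⟩ := nonempty_homotopyEquiv_of_anodyneExtensions_nerveSubcomplex
    (anodyneExtensions_nerveSubcomplex (withTop_ne_top_iff ρ)
      T.anodyneExtensions_nerveSubcomplex_ne_top)
  exact ⟨(classifyingHomotopyEquivOfEquivalence (toWithTop ρ).asEquivalence).trans
    (h.trans (homotopyEquivOfOrderTop (withTop ρ)))⟩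

end HomotopyOrbit

end WithTop

/-! ### Unimodular systems in the plane -/

namespace Farey

open scoped Matrix

/-- The determinant of two vectors in the plane. -/
def det (v w : Fin 2 → ℤ) : ℤ := v 0 * w 1 - v 1 * w 0

/-- Two vectors form a basis of the lattice. -/
def Unimodular (v w : Fin 2 → ℤ) : Prop := det v w = 1 ∨ det v w = -1

lemma det_add_left (u v w) : det (u + v) w = det u w + det v w := by
  simp only [det, Pi.add_apply]
  ring

lemma det_add_right (u v w) : det u (v + w) = det u v + det u w := by
  simp only [det, Pi.add_apply]
  ring

lemma det_neg_left (v w) : det (-v) w = -det v w := by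
  simp only [det, Pi.neg_apply]
  ring

lemma det_neg_right (v w) : det v (-w) = -det v w := by
  simp only [det, Pi.neg_apply]
  ring

lemma det_smul_left (a : ℤ) (v w) : det (a • v) w = a * det v w := by
  simp only [det, Pi.smul_apply, smul_eq_mul]
  ring

lemma det_smul_right (a : ℤ) (v w) : det v (a • w) = a * det v w := by
  simp only [det, Pi.smul_apply, smul_eq_mul]
  ring

lemma det_zero_left (v) : det 0 v = 0 := by simp [det]

lemma det_zero_right (v) : det v 0 = 0 := by simp [det]

lemma det_self (v) : det v v = 0 := by
  simp only [det]
  ring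

lemma det_swap (v w) : det w v = -det v w := by
  simp only [det]
  ring

lemma cramer (v w z) : det v w • z = det z w • v + det v z • w := by
  ext i
  fin_cases i <;> simp [det] <;> ring

lemma dotProduct_mul_dotProduct_self (v w : Fin 2 → ℤ) :
    (v ⬝ᵥ v) * (w ⬝ᵥ w) = det v w ^ 2 + (v ⬝ᵥ w) ^ 2 := by
  simp only [dotProduct, Fin.sum_univ_two, det]
  ring

lemma dotProduct_self_pos {v : Fin 2 → ℤ} (hv : v ≠ 0) : 0 < v ⬝ᵥ v := by
  simpa using Matrix.dotProduct_star_self_pos_iff.2 hv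

lemma dotProduct_add_self (v w : Fin 2 → ℤ) :
    (v + w) ⬝ᵥ (v + w) = v ⬝ᵥ v + w ⬝ᵥ w + 2 * (v ⬝ᵥ w) := by
  rw [add_dotProduct, dotProduct_add, dotProduct_add, dotProduct_comm w v]
  ring

lemma dotProduct_neg_self (v : Fin 2 → ℤ) : (-v) ⬝ᵥ (-v) = v ⬝ᵥ v := by
  rw [neg_dotProduct, dotProduct_neg, neg_neg]

lemma unimodular_iff_isUnit {v w} : Unimodular v w ↔ IsUnit (det v w) := Int.isUnit_iff.symm

namespace Unimodular

variable {v w : Fin 2 → ℤ}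

lemma neg_right (h : Unimodular v w) : Unimodular v (-w) := by
  rwa [unimodular_iff_isUnit, det_neg_right, IsUnit.neg_iff, ← unimodular_iff_isUnit]

lemma symm (h : Unimodular v w) : Unimodular w v := by
  rwa [unimodular_iff_isUnit, det_swap, IsUnit.neg_iff, ← unimodular_iff_isUnit]

lemma add_right (h : Unimodular v w) : Unimodular v (v + w) := by
  rwa [Unimodular, det_add_right, det_self, zero_add]

lemma det_mul_self (h : Unimodular v w) : det v w * det v w = 1 :=
  Int.isUnit_mul_self (unimodular_iff_isUnit.1 h)

lemma det_sq (h : Unimodular v w) : det v w ^ 2 = 1 := by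
  rw [sq, h.det_mul_self]

lemma det_ne_zero (h : Unimodular v w) : det v w ≠ 0 :=
  (unimodular_iff_isUnit.1 h).ne_zero

lemma left_ne_zero (h : Unimodular v w) : v ≠ 0 := by
  rintro rfl
  exact h.det_ne_zero (det_zero_left _)

lemma right_ne_zero (h : Unimodular v w) : w ≠ 0 := h.symm.left_ne_zero

lemma eq_smul_add_smul (h : Unimodular v w) (z) :
    z = (det v w * det z w) • v + (det v w * det v z) • w := by
  have := congr_arg (det v w • ·) (cramer v w z)
  simpa only [smul_smul, h.det_mul_self, one_smul, smul_add] using this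

lemma closure_eq_top (h : Unimodular v w) {E : Set (Fin 2 → ℤ)} (hv : v ∈ E) (hw : w ∈ E) :
    AddSubgroup.closure E = ⊤ := by
  refine eq_top_iff.2 fun z _ => ?_
  rw [h.eq_smul_add_smul z]
  exact add_mem (AddSubgroup.zsmul_mem _ (AddSubgroup.subset_closure hv) _)
    (AddSubgroup.zsmul_mem _ (AddSubgroup.subset_closure hw) _)

end Unimodular

lemma unimodular_of_closure_eq_top {v w} (h : AddSubgroup.closure {v, w} = ⊤) :
    Unimodular v w := by
  obtain ⟨a, b, hab⟩ := AddSubgroup.mem_closure_pair.1 (h ▸ AddSubgroup.mem_top ![1, 0])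
  obtain ⟨c, d, hcd⟩ := AddSubgroup.mem_closure_pair.1 (h ▸ AddSubgroup.mem_top ![0, 1])
  have hdet : (a * d - b * c) * det v w = 1 := calc
    _ = det (a • v + b • w) (c • v + d • w) := by
      simp only [det, Pi.add_apply, Pi.smul_apply, smul_eq_mul]
      ring
    _ = 1 := by
      rw [hab, hcd]
      simp [det]
  exact unimodular_iff_isUnit.2 (.of_mul_eq_one_right _ hdet)

lemma linearIndependent_iff_det_ne_zero (b : Fin 2 → (Fin 2 → ℤ)) :
    LinearIndependent ℤ b ↔ det (b 0) (b 1) ≠ 0 := by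
  have hdet : (Matrix.of b).det = det (b 0) (b 1) := by
    rw [Matrix.det_fin_two, Matrix.of_apply, Matrix.of_apply, det]
    ring_nf
    rfl
  rw [← hdet]
  refine ⟨fun h h0 => ?_, Matrix.linearIndependent_rows_of_det_ne_zero⟩
  obtain ⟨v, hv, hv0⟩ := Matrix.exists_vecMul_eq_zero_iff.2 h0
  exact hv (Matrix.vecMul_injective_iff.2 h (hv0.trans (Matrix.zero_vecMul _).symm))

lemma exists_det_ne_zero_of_closure_eq_top {E : Set (Fin 2 → ℤ)}
    (hE : AddSubgroup.closure E = ⊤) : ∃ v ∈ E, ∃ w ∈ E, det v w ≠ 0 := by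
  by_contra! hdet
  have hzero : det ![1, 0] ![0, 1] = 0 := by
    refine AddSubgroup.closure_induction₂ (p := fun v w _ _ => det v w = 0)
      (fun v w hv hw => hdet v hv w hw) (fun _ _ => det_zero_left _) (fun _ _ => det_zero_right _)
      (fun u v w _ _ _ hu hv => ?_) (fun u v w _ _ _ hu hv => ?_) (fun v w _ _ h => ?_)
      (fun v w _ _ h => ?_) (hE ▸ AddSubgroup.mem_top _) (hE ▸ AddSubgroup.mem_top _)
    · rw [det_add_left, hu, hv, add_zero]
    · rw [det_add_right, hu, hv, add_zero]
    · rw [det_neg_left, h, neg_zero]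
    · rw [det_neg_right, h, neg_zero]
  simp [det] at hzero

/-- The sets of vectors in the plane belonging to `IR 2`, in terms of determinants. -/
structure IsUnimodularSystem (E : Set (Fin 2 → ℤ)) : Prop where
  zero_notMem : 0 ∉ E
  neg_mem_iff : ∀ x, x ∈ E ↔ -x ∈ E
  unimodular : ∀ v ∈ E, ∀ w ∈ E, det v w = 0 ∨ Unimodular v w
  exists_unimodular : ∃ v ∈ E, ∃ w ∈ E, Unimodular v w

lemma isUnimodularSystem_iff (E : Set (Fin 2 → ℤ)) : IsUnimodularSystem E ↔
    (0 ∉ E ∧ (∀ x, x ∈ E ↔ -x ∈ E) ∧ AddSubgroup.closure E = ⊤ ∧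
    ∀ b : Fin 2 → (Fin 2 → ℤ), (∀ i, b i ∈ E) → LinearIndependent ℤ b →
      AddSubgroup.closure (Set.range b) = ⊤) := by
  constructor
  · intro h
    obtain ⟨v, hv, w, hw, hvw⟩ := h.exists_unimodular
    refine ⟨h.zero_notMem, h.neg_mem_iff, hvw.closure_eq_top hv hw, fun b hb hind => ?_⟩
    rw [linearIndependent_iff_det_ne_zero] at hind
    exact ((h.unimodular _ (hb 0) _ (hb 1)).resolve_left hind).closure_eq_top ⟨0, rfl⟩ ⟨1, rfl⟩
  · rintro ⟨hzero, hneg, hgen, hbasis⟩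
    have hunimod : ∀ v ∈ E, ∀ w ∈ E, det v w = 0 ∨ Unimodular v w := fun v hv w hw => by
      refine or_iff_not_imp_left.2 fun h => unimodular_of_closure_eq_top ?_
      have := hbasis ![v, w] (by simp [Fin.forall_fin_two, hv, hw])
        ((linearIndependent_iff_det_ne_zero _).2 h)
      rwa [Matrix.range_cons_cons_empty] at this
    obtain ⟨v, hv, w, hw, h⟩ := exists_det_ne_zero_of_closure_eq_top hgen
    exact ⟨hzero, hneg, hunimod, v, hv, w, hw, (hunimod v hv w hw).resolve_left h⟩

lemma isUnimodularSystem (E : IR 2) : IsUnimodularSystem E.1 :=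
  (isUnimodularSystem_iff _).2 E.2

/-- The edge of the Farey graph spanned by two vectors. A vertex of the Farey graph is a primitive
vector up to sign, and an edge is identified with the set of the vectors representing its ends. -/
def edge (v w : Fin 2 → ℤ) : Set (Fin 2 → ℤ) := {v, -v, w, -w}

/-- The triangle of the Farey graph spanned by two vectors and their sum, identified with the set
of the vectors representing its vertices. -/
def triangle (v w : Fin 2 → ℤ) : Set (Fin 2 → ℤ) := {v, -v, w, -w, v + w, -(v + w)}

lemma mem_edge {v w z} : z ∈ edge v w ↔ z = v ∨ z = -v ∨ z = w ∨ z = -w := Iff.rfl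

lemma mem_triangle {v w z} : z ∈ triangle v w ↔
    z = v ∨ z = -v ∨ z = w ∨ z = -w ∨ z = v + w ∨ z = -(v + w) := Iff.rfl

lemma left_mem_edge (v w) : v ∈ edge v w := by simp [mem_edge]

lemma right_mem_edge (v w) : w ∈ edge v w := by simp [mem_edge]

lemma left_mem_triangle (v w) : v ∈ triangle v w := by simp [mem_triangle]

lemma right_mem_triangle (v w) : w ∈ triangle v w := by simp [mem_triangle]

lemma add_mem_triangle (v w) : v + w ∈ triangle v w := by simp [mem_triangle]

lemma edge_neg_right (v w) : edge v (-w) = edge v w := by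
  ext z
  simp only [mem_edge, neg_neg]
  tauto

lemma triangle_swap (v w) : triangle w v = triangle v w := by
  ext z
  simp only [mem_triangle, add_comm w v]
  tauto

lemma triangle_rotate (v w) : triangle v (-(v + w)) = triangle v w := by
  ext z
  have : v + -(v + w) = -w := by abel
  simp only [mem_triangle, this, neg_neg]
  tauto

lemma edge_subset_triangle (v w) : edge v w ⊆ triangle v w := by
  intro z
  simp only [mem_triangle, mem_edge]
  tauto

lemma isUnimodularSystem_triangle {v w} (h : Unimodular v w) :
    IsUnimodularSystem (triangle v w) where
  zero_notMem := by
    simp only [mem_triangle, eq_comm (a := (0 : Fin 2 → ℤ)), neg_eq_zero,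
      h.left_ne_zero, h.right_ne_zero, h.add_right.right_ne_zero, or_self, not_false_eq_true]
  neg_mem_iff x := by
    simp only [mem_triangle, neg_eq_iff_eq_neg, neg_neg]
    tauto
  unimodular x hx y hy := by
    unfold Unimodular at *
    have := det_swap v w
    rw [mem_triangle] at hx hy
    rcases hx with rfl | rfl | rfl | rfl | rfl | rfl <;>
      rcases hy with rfl | rfl | rfl | rfl | rfl | rfl <;>
      (try simp only [det_neg_left, det_neg_right, det_add_left, det_add_right, det_self]) <;>
      first | omega | simp
  exists_unimodular := ⟨v, left_mem_triangle v w, w, right_mem_triangle v w, h⟩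

lemma isUnimodularSystem_edge {v w} (h : Unimodular v w) : IsUnimodularSystem (edge v w) where
  zero_notMem h' := (isUnimodularSystem_triangle h).zero_notMem (edge_subset_triangle _ _ h')
  neg_mem_iff x := by
    simp only [mem_edge, neg_eq_iff_eq_neg, neg_neg]
    tauto
  unimodular x hx y hy := (isUnimodularSystem_triangle h).unimodular x (edge_subset_triangle _ _ hx)
    y (edge_subset_triangle _ _ hy)
  exists_unimodular := ⟨v, left_mem_edge v w, w, right_mem_edge v w, h⟩

namespace IsUnimodularSystem

variable {E : Set (Fin 2 → ℤ)} {v w z : Fin 2 → ℤ}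

lemma neg_mem (hE : IsUnimodularSystem E) (hv : v ∈ E) : -v ∈ E := (hE.neg_mem_iff v).1 hv

lemma edge_subset (hE : IsUnimodularSystem E) (hv : v ∈ E) (hw : w ∈ E) : edge v w ⊆ E := by
  rintro z (rfl | rfl | rfl | rfl)
  exacts [hv, hE.neg_mem hv, hw, hE.neg_mem hw]

lemma triangle_subset (hE : IsUnimodularSystem E) (hv : v ∈ E) (hw : w ∈ E) (hvw : v + w ∈ E) :
    triangle v w ⊆ E := by
  rintro z (rfl | rfl | rfl | rfl | rfl | rfl)
  exacts [hv, hE.neg_mem hv, hw, hE.neg_mem hw, hvw, hE.neg_mem hvw]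

lemma exists_eq_smul_add_smul (hE : IsUnimodularSystem E) (h : Unimodular v w) (hv : v ∈ E)
    (hw : w ∈ E) (hz : z ∈ E) : ∃ a b : ℤ, (a = 0 ∨ a = 1 ∨ a = -1) ∧ (b = 0 ∨ b = 1 ∨ b = -1) ∧
      z = a • v + b • w := by
  refine ⟨_, _, ?_, ?_, h.eq_smul_add_smul z⟩
  · have hzw := hE.unimodular z hz w hw
    unfold Unimodular at *
    rcases h with h | h <;> rcases hzw with hzw | hzw | hzw <;> rw [h, hzw] <;> simp
  · have hvz := hE.unimodular v hv z hz
    unfold Unimodular at *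
    rcases h with h | h <;> rcases hvz with hvz | hvz | hvz <;> rw [h, hvz] <;> simp

lemma mem_triangle_or_mem_triangle_neg (hE : IsUnimodularSystem E) (h : Unimodular v w)
    (hv : v ∈ E) (hw : w ∈ E) (hz : z ∈ E) : z ∈ triangle v w ∨ z ∈ triangle v (-w) := by
  have hz0 : z ≠ 0 := fun h => hE.zero_notMem (h ▸ hz)
  obtain ⟨a, b, ha, hb, rfl⟩ := hE.exists_eq_smul_add_smul h hv hw hz
  simp only [mem_triangle]
  rcases ha with rfl | rfl | rfl <;> rcases hb with rfl | rfl | rfl <;>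
    simp only [zero_smul, one_smul, neg_smul, zero_add, add_zero, neg_add, neg_neg] at hz0 ⊢ <;>
    tauto

lemma eq_triangle (hE : IsUnimodularSystem E) (h : Unimodular v w) (hv : v ∈ E) (hw : w ∈ E)
    (hvw : v + w ∈ E) : E = triangle v w := by
  refine (hE.triangle_subset hv hw hvw).antisymm' fun z hz => ?_
  refine (hE.mem_triangle_or_mem_triangle_neg h hv hw hz).elim id fun hz' => ?_
  have hdet := hE.unimodular _ hvw _ hz
  unfold Unimodular at *
  have := det_swap v w
  simp only [mem_triangle] at hz' ⊢
  rcases hz' with rfl | rfl | rfl | rfl | rfl | rfl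
  any_goals simp
  all_goals
    simp only [det_neg_right, det_add_left, det_add_right, det_self] at hdet
    omega

lemma eq_edge_or_triangle (hE : IsUnimodularSystem E) (h : Unimodular v w) (hv : v ∈ E)
    (hw : w ∈ E) : E = edge v w ∨ E = triangle v w ∨ E = triangle v (-w) := by
  by_cases hadd : v + w ∈ E
  · exact Or.inr (Or.inl (hE.eq_triangle h hv hw hadd))
  by_cases hsub : v + -w ∈ E
  · exact Or.inr (Or.inr (hE.eq_triangle h.neg_right hv (hE.neg_mem hw) hsub))
  refine Or.inl ((hE.edge_subset hv hw).antisymm' fun z hz => ?_)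
  have hmem := hE.mem_triangle_or_mem_triangle_neg h hv hw hz
  have hadd' : z ≠ v + w := fun h => hadd (h ▸ hz)
  have hneg_add : z ≠ -(v + w) := fun h => hadd (by rwa [hE.neg_mem_iff, ← h])
  have hsub' : z ≠ v + -w := fun h => hsub (h ▸ hz)
  have hneg_sub : z ≠ -(v + -w) := fun h => hsub (by rwa [hE.neg_mem_iff, ← h])
  rw [mem_edge]
  rw [mem_triangle, mem_triangle, neg_neg] at hmem
  tauto

end IsUnimodularSystem

/-- A system contains three vectors which are the vertices of a triangle. -/
def HasTriangle (E : Set (Fin 2 → ℤ)) : Prop := ∃ y ∈ E, ∃ z ∈ E, y + z ∈ E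

lemma hasTriangle_triangle (v w) : HasTriangle (triangle v w) :=
  ⟨v, left_mem_triangle v w, w, right_mem_triangle v w, add_mem_triangle v w⟩

lemma odd_det_add_det_of_mem_edge {v w z} (h : Unimodular v w) (hz : z ∈ edge v w) :
    Odd (det v z + det w z) := by
  have hswap := det_swap v w
  have hodd : Odd (det v w) := by
    rcases h with h | h <;> rw [h] <;> decide
  rcases hz with rfl | rfl | rfl | rfl <;>
    simp [det_neg_right, det_self, hswap, hodd]

/- The functional `z ↦ det v z + det w z` is odd on all vectors of the edge, hence even on the sum
of two of them. -/
lemma not_hasTriangle_edge {v w} (h : Unimodular v w) : ¬ HasTriangle (edge v w) := by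
  rintro ⟨y, hy, z, hz, hyz⟩
  have hodd := odd_det_add_det_of_mem_edge h hyz
  rw [det_add_right, det_add_right, add_add_add_comm] at hodd
  exact Int.not_odd_iff_even.2
    ((odd_det_add_det_of_mem_edge h hy).add_odd (odd_det_add_det_of_mem_edge h hz)) hodd

lemma IsUnimodularSystem.eq_edge {E : Set (Fin 2 → ℤ)} (hE : IsUnimodularSystem E)
    (hE' : ¬ HasTriangle E) {v w} (h : Unimodular v w) (hv : v ∈ E) (hw : w ∈ E) :
    E = edge v w := by
  rcases hE.eq_edge_or_triangle h hv hw with h | h | h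
  · exact h
  · exact absurd (h ▸ hasTriangle_triangle _ _) hE'
  · exact absurd (h ▸ hasTriangle_triangle _ _) hE'

open Classical in
/-- The next system on the path to the square of the unit vectors. A triangle loses its longest
vectors, and an edge is completed to the triangle containing the shorter one of the sum and the
difference of its vectors. -/
noncomputable def parentSet (E : Set (Fin 2 → ℤ)) : Set (Fin 2 → ℤ) :=
  if HasTriangle E then {z | z ∈ E ∧ ∃ y ∈ E, z ⬝ᵥ z < y ⬝ᵥ y} else
    {x | x ∈ E ∨ ∃ y ∈ E, ∃ z ∈ E, y ⬝ᵥ z < 0 ∧ det y z ≠ 0 ∧ x = y + z}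

lemma parentSet_triangle {v w} (h : Unimodular v w) (hvw : 0 ≤ v ⬝ᵥ w) :
    parentSet (triangle v w) = edge v w := by
  have hv := dotProduct_self_pos h.left_ne_zero
  have hw := dotProduct_self_pos h.right_ne_zero
  have hadd := dotProduct_add_self v w
  rw [parentSet, if_pos (hasTriangle_triangle _ _)]
  ext z
  constructor
  · rintro ⟨hz, y, hy, hzy⟩
    have hle : y ⬝ᵥ y ≤ (v + w) ⬝ᵥ (v + w) := by
      rcases hy with rfl | rfl | rfl | rfl | rfl | rfl <;> (try rw [dotProduct_neg_self]) <;> omega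
    rcases hz with rfl | rfl | rfl | rfl | rfl | rfl
    any_goals simp [mem_edge]
    all_goals
      (try rw [dotProduct_neg_self] at hzy)
      omega
  · intro hz
    refine ⟨edge_subset_triangle _ _ hz, v + w, add_mem_triangle v w, ?_⟩
    rcases hz with rfl | rfl | rfl | rfl <;> (try rw [dotProduct_neg_self]) <;> omega

lemma parentSet_edge {v w} (h : Unimodular v w) (hvw : v ⬝ᵥ w < 0) :
    parentSet (edge v w) = triangle v w := by
  rw [parentSet, if_neg (not_hasTriangle_edge h)]
  ext x
  constructor
  · rintro (hx | ⟨y, hy, z, hz, hdot, hdet, rfl⟩)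
    · exact edge_subset_triangle _ _ hx
    · have hcomm := dotProduct_comm w v
      rcases hy with rfl | rfl | rfl | rfl <;> rcases hz with rfl | rfl | rfl | rfl
      all_goals
        first
        | exfalso
          simp [det_neg_left, det_neg_right, det_self] at hdet
          done
        | exfalso
          simp only [neg_dotProduct, dotProduct_neg] at hdot
          omega
        | simp only [mem_triangle, neg_add, add_comm, true_or, or_true]
  · rintro (rfl | rfl | rfl | rfl | rfl | rfl)
    iterate 4 exact Or.inl (by simp [mem_edge])
    · exact Or.inr ⟨v, left_mem_edge v w, w, right_mem_edge v w, hvw, h.det_ne_zero, rfl⟩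
    · refine Or.inr ⟨-v, by simp [mem_edge], -w, by simp [mem_edge], ?_, ?_, by abel⟩
      · rwa [neg_dotProduct, dotProduct_neg, neg_neg]
      · rw [det_neg_left, det_neg_right, neg_neg]
        exact h.det_ne_zero

open Classical in
/-- The height of a system, measured by the length of its longest vector; an edge with the same
longest vector as a triangle is higher. -/
noncomputable def heightSet (E : Set (Fin 2 → ℤ)) : ℤ :=
  2 * sSup ((fun z => z ⬝ᵥ z) '' E) + if HasTriangle E then 0 else 1

lemma heightSet_edge {v w} (h : Unimodular v w) :
    heightSet (edge v w) = 2 * max (v ⬝ᵥ v) (w ⬝ᵥ w) + 1 := by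
  have hmax : IsGreatest ((fun z => z ⬝ᵥ z) '' edge v w) (max (v ⬝ᵥ v) (w ⬝ᵥ w)) := by
    constructor
    · rcases max_choice (v ⬝ᵥ v) (w ⬝ᵥ w) with h | h <;> rw [h]
      exacts [⟨v, left_mem_edge v w, rfl⟩, ⟨w, right_mem_edge v w, rfl⟩]
    · rintro _ ⟨z, (rfl | rfl | rfl | rfl), rfl⟩ <;> simp
  rw [heightSet, if_neg (not_hasTriangle_edge h), hmax.csSup_eq]

lemma heightSet_triangle_of_nonneg {v w} (h : Unimodular v w) (hvw : 0 ≤ v ⬝ᵥ w) :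
    heightSet (triangle v w) = 2 * (v ⬝ᵥ v + w ⬝ᵥ w + 2 * (v ⬝ᵥ w)) := by
  have hv := dotProduct_self_pos h.left_ne_zero
  have hw := dotProduct_self_pos h.right_ne_zero
  have hmax : IsGreatest ((fun z => z ⬝ᵥ z) '' triangle v w)
      (v ⬝ᵥ v + w ⬝ᵥ w + 2 * (v ⬝ᵥ w)) := by
    constructor
    · exact ⟨v + w, add_mem_triangle v w, dotProduct_add_self _ _⟩
    · rintro _ ⟨z, (rfl | rfl | rfl | rfl | rfl | rfl), rfl⟩ <;>
        simp only [dotProduct_neg_self, dotProduct_add_self] <;> omega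
  rw [heightSet, if_pos (hasTriangle_triangle _ _), hmax.csSup_eq, add_zero]

lemma dotProduct_self_le_neg_dotProduct {v w} (h : Unimodular v w) (hvw : v ⬝ᵥ w < 0) :
    v ⬝ᵥ v ≤ -(v ⬝ᵥ w) ∨ w ⬝ᵥ w ≤ -(v ⬝ᵥ w) := by
  have hlagrange := dotProduct_mul_dotProduct_self v w
  rw [h.det_sq] at hlagrange
  by_contra!
  nlinarith

lemma heightSet_triangle_of_neg {v w} (h : Unimodular v w) (hvw : v ⬝ᵥ w < 0) :
    heightSet (triangle v w) = 2 * max (v ⬝ᵥ v) (w ⬝ᵥ w) := by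
  have hv := dotProduct_self_pos h.left_ne_zero
  have hw := dotProduct_self_pos h.right_ne_zero
  have hle := dotProduct_self_le_neg_dotProduct h hvw
  have hmax : IsGreatest ((fun z => z ⬝ᵥ z) '' triangle v w) (max (v ⬝ᵥ v) (w ⬝ᵥ w)) := by
    constructor
    · rcases max_choice (v ⬝ᵥ v) (w ⬝ᵥ w) with h | h <;> rw [h]
      exacts [⟨v, left_mem_triangle v w, rfl⟩, ⟨w, right_mem_triangle v w, rfl⟩]
    · rintro _ ⟨z, (rfl | rfl | rfl | rfl | rfl | rfl), rfl⟩ <;>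
        simp only [dotProduct_neg_self, dotProduct_add_self] <;> omega
  rw [heightSet, if_pos (hasTriangle_triangle _ _), hmax.csSup_eq, add_zero]

/-- The first vector of the standard basis of the lattice. -/
def e₁ : Fin 2 → ℤ := ![1, 0]

/-- The second vector of the standard basis of the lattice. -/
def e₂ : Fin 2 → ℤ := ![0, 1]

lemma unimodular_e₁_e₂ : Unimodular e₁ e₂ := Or.inl (by simp [det, e₁, e₂])

lemma mem_edge_e₁_e₂ {v : Fin 2 → ℤ} (h : v ⬝ᵥ v = 1) : v ∈ edge e₁ e₂ := by
  obtain ⟨a, b, rfl⟩ : ∃ a b, v = ![a, b] := ⟨_, _, List.ofFn_inj.1 rfl⟩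
  simp only [dotProduct, Fin.sum_univ_two, Matrix.cons_val_zero, Matrix.cons_val_one] at h
  have ha : a ≤ 1 := by nlinarith [mul_self_nonneg b]
  have ha' : -1 ≤ a := by nlinarith [mul_self_nonneg b]
  have hb : b ≤ 1 := by nlinarith [mul_self_nonneg a]
  have hb' : -1 ≤ b := by nlinarith [mul_self_nonneg a]
  rw [mem_edge]
  interval_cases a <;> interval_cases b <;> simp [e₁, e₂] at h ⊢

lemma edge_eq_edge_e₁_e₂ {v w} (h : Unimodular v w) (hvw : v ⬝ᵥ w = 0) :
    edge v w = edge e₁ e₂ := by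
  have hlagrange := dotProduct_mul_dotProduct_self v w
  rw [h.det_sq, hvw] at hlagrange
  have hv := dotProduct_self_pos h.left_ne_zero
  have hw := dotProduct_self_pos h.right_ne_zero
  exact ((isUnimodularSystem_edge unimodular_e₁_e₂).eq_edge
    (not_hasTriangle_edge unimodular_e₁_e₂) h (mem_edge_e₁_e₂ (by nlinarith))
    (mem_edge_e₁_e₂ (by nlinarith))).symm

lemma dotProduct_eq_zero_of_edge_eq {v w} (h : Unimodular v w) (hvw : edge v w = edge e₁ e₂) :
    v ⬝ᵥ w = 0 := by
  have hv : v ∈ edge e₁ e₂ := hvw ▸ left_mem_edge v w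
  have hw : w ∈ edge e₁ e₂ := hvw ▸ right_mem_edge v w
  rcases hv with rfl | rfl | rfl | rfl <;> rcases hw with rfl | rfl | rfl | rfl <;>
    simp [Unimodular, det, e₁, e₂] at h ⊢

/- By Lagrange's identity the vectors `v`, `w` and `-(v + w)` cannot make three obtuse angles. -/
lemma exists_triangle_eq_of_unimodular {v w} (h : Unimodular v w) :
    ∃ v' w', Unimodular v' w' ∧ 0 ≤ v' ⬝ᵥ w' ∧ triangle v' w' = triangle v w := by
  rcases le_or_gt 0 (v ⬝ᵥ w) with hvw | hvw
  · exact ⟨v, w, h, hvw, rfl⟩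
  rcases le_or_gt 0 (v ⬝ᵥ (-(v + w))) with hv | hv
  · exact ⟨v, -(v + w), h.add_right.neg_right, hv, triangle_rotate _ _⟩
  rcases le_or_gt 0 (w ⬝ᵥ (-(w + v))) with hw | hw
  · exact ⟨w, -(w + v), h.symm.add_right.neg_right, hw, (triangle_rotate _ _).trans
      (triangle_swap _ _)⟩
  exfalso
  rw [dotProduct_neg, dotProduct_add] at hv hw
  rw [dotProduct_comm w v] at hw
  rcases dotProduct_self_le_neg_dotProduct h hvw <;> omega

/-- An edge as an element of `IR 2`. -/
def edgeIR {v w} (h : Unimodular v w) : IR 2 :=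
  ⟨edge v w, (isUnimodularSystem_iff _).1 (isUnimodularSystem_edge h)⟩

/-- A triangle as an element of `IR 2`. -/
def triangleIR {v w} (h : Unimodular v w) : IR 2 :=
  ⟨triangle v w, (isUnimodularSystem_iff _).1 (isUnimodularSystem_triangle h)⟩

lemma exists_eq_edgeIR_or_eq_triangleIR (E : IR 2) : ∃ (v w : _) (h : Unimodular v w),
    (E = edgeIR h ∧ v ⬝ᵥ w ≤ 0) ∨ (E = triangleIR h ∧ 0 ≤ v ⬝ᵥ w) := by
  have hE := isUnimodularSystem E
  obtain ⟨v, hv, w, hw, h⟩ := hE.exists_unimodular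
  rcases hE.eq_edge_or_triangle h hv hw with hedge | htriangle | htriangle
  · rcases le_total (v ⬝ᵥ w) 0 with hvw | hvw
    · exact ⟨v, w, h, Or.inl ⟨Subtype.ext hedge, hvw⟩⟩
    · refine ⟨v, -w, h.neg_right, Or.inl ⟨Subtype.ext (hedge.trans (edge_neg_right _ _).symm), ?_⟩⟩
      rw [dotProduct_neg]
      omega
  · obtain ⟨v', w', h', hvw, heq⟩ := exists_triangle_eq_of_unimodular h
    exact ⟨v', w', h', Or.inr ⟨Subtype.ext (htriangle.trans heq.symm), hvw⟩⟩
  · obtain ⟨v', w', h', hvw, heq⟩ := exists_triangle_eq_of_unimodular h.neg_right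
    exact ⟨v', w', h', Or.inr ⟨Subtype.ext (htriangle.trans heq.symm), hvw⟩⟩

lemma edgeIR_ne_triangleIR {v w v' w'} (h : Unimodular v w) (h' : Unimodular v' w') :
    edgeIR h ≠ triangleIR h' := fun heq => by
  have hset : edge v w = triangle v' w' := congr_arg Subtype.val heq
  exact not_hasTriangle_edge h (hset ▸ hasTriangle_triangle v' w')

lemma edgeIR_lt_triangleIR {v w} (h : Unimodular v w) : edgeIR h < triangleIR h :=
  lt_of_le_of_ne (edge_subset_triangle v w) (edgeIR_ne_triangleIR h h)

lemma eq_of_triangleIR_le {v w} (h : Unimodular v w) {E : IR 2} (hE : triangleIR h ≤ E) :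
    E = triangleIR h :=
  Subtype.ext ((isUnimodularSystem E).eq_triangle h (hE (left_mem_triangle v w))
    (hE (right_mem_triangle v w)) (hE (add_mem_triangle v w)))

lemma exists_eq_edgeIR_and_eq_triangleIR_of_lt {E F : IR 2} (hEF : E < F) :
    ∃ (v w : _) (h : Unimodular v w), E = edgeIR h ∧ F = triangleIR h := by
  obtain ⟨v, w, h, ⟨rfl, -⟩ | ⟨rfl, -⟩⟩ := exists_eq_edgeIR_or_eq_triangleIR E
  · rcases (isUnimodularSystem F).eq_edge_or_triangle h (hEF.le (left_mem_edge v w))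
      (hEF.le (right_mem_edge v w)) with hF | hF | hF
    · exact absurd (Subtype.ext hF) hEF.ne'
    · exact ⟨v, w, h, rfl, Subtype.ext hF⟩
    · exact ⟨v, -w, h.neg_right, Subtype.ext (edge_neg_right v w).symm, Subtype.ext hF⟩
  · exact absurd (eq_of_triangleIR_le h hEF.le) hEF.ne'

open Classical in
/-- The next system on the path to the square of the unit vectors, as an element of `IR 2`. Only
its values away from the root matter. -/
noncomputable def parent (E : IR 2) : IR 2 :=
  if h : ∃ F : IR 2, F.1 = parentSet E.1 then h.choose else E

lemma parent_eq {E F : IR 2} (h : parentSet E.1 = F.1) : parent E = F := by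
  have h' : ∃ F : IR 2, F.1 = parentSet E.1 := ⟨F, h.symm⟩
  rw [parent, dif_pos h']
  exact Subtype.ext (h'.choose_spec.trans h)

lemma parent_edgeIR {v w} (h : Unimodular v w) (hvw : v ⬝ᵥ w < 0) :
    parent (edgeIR h) = triangleIR h :=
  parent_eq (parentSet_edge h hvw)

lemma parent_triangleIR {v w} (h : Unimodular v w) (hvw : 0 ≤ v ⬝ᵥ w) :
    parent (triangleIR h) = edgeIR h :=
  parent_eq (parentSet_triangle h hvw)

lemma edgeIR_eq_edgeIR_e₁_e₂_iff {v w} (h : Unimodular v w) :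
    edgeIR h = edgeIR unimodular_e₁_e₂ ↔ v ⬝ᵥ w = 0 :=
  ⟨fun heq => dotProduct_eq_zero_of_edge_eq h (congr_arg Subtype.val heq),
    fun hvw => Subtype.ext (edge_eq_edge_e₁_e₂ h hvw)⟩

lemma exists_eq_of_ne_root {E : IR 2} (hE : E ≠ edgeIR unimodular_e₁_e₂) :
    ∃ (v w : _) (h : Unimodular v w),
      (E = edgeIR h ∧ v ⬝ᵥ w < 0) ∨ (E = triangleIR h ∧ 0 ≤ v ⬝ᵥ w) := by
  obtain ⟨v, w, h, ⟨rfl, hvw⟩ | ⟨rfl, hvw⟩⟩ := exists_eq_edgeIR_or_eq_triangleIR E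
  · exact ⟨v, w, h, Or.inl ⟨rfl, hvw.lt_of_ne ((edgeIR_eq_edgeIR_e₁_e₂_iff h).not.1 hE)⟩⟩
  · exact ⟨v, w, h, Or.inr ⟨rfl, hvw⟩⟩

lemma parent_lt_or_lt_parent {E : IR 2} (hE : E ≠ edgeIR unimodular_e₁_e₂) :
    parent E < E ∨ E < parent E := by
  obtain ⟨v, w, h, ⟨rfl, hvw⟩ | ⟨rfl, hvw⟩⟩ := exists_eq_of_ne_root hE
  · rw [parent_edgeIR h hvw]
    exact Or.inr (edgeIR_lt_triangleIR h)
  · rw [parent_triangleIR h hvw]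
    exact Or.inl (edgeIR_lt_triangleIR h)

lemma heightSet_parent_lt {E : IR 2} (hE : E ≠ edgeIR unimodular_e₁_e₂) :
    (heightSet (parent E).1).toNat < (heightSet E.1).toNat := by
  obtain ⟨v, w, h, hcases⟩ := exists_eq_of_ne_root hE
  have hv := dotProduct_self_pos h.left_ne_zero
  have hw := dotProduct_self_pos h.right_ne_zero
  rcases hcases with ⟨rfl, hvw⟩ | ⟨rfl, hvw⟩
  · rw [parent_edgeIR h hvw]
    change (heightSet (triangle v w)).toNat < (heightSet (edge v w)).toNat
    rw [heightSet_triangle_of_neg h hvw, heightSet_edge h]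
    omega
  · rw [parent_triangleIR h hvw]
    change (heightSet (edge v w)).toNat < (heightSet (triangle v w)).toNat
    rw [heightSet_triangle_of_nonneg h hvw, heightSet_edge h]
    omega

lemma eq_parent_of_lt {E F : IR 2} (hEF : E < F) :
    (E ≠ edgeIR unimodular_e₁_e₂ ∧ F = parent E) ∨
      (F ≠ edgeIR unimodular_e₁_e₂ ∧ E = parent F) := by
  obtain ⟨v, w, h, rfl, rfl⟩ := exists_eq_edgeIR_and_eq_triangleIR_of_lt hEF
  rcases le_or_gt 0 (v ⬝ᵥ w) with hvw | hvw
  · exact Or.inr ⟨(edgeIR_ne_triangleIR _ h).symm, (parent_triangleIR h hvw).symm⟩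
  · exact Or.inl ⟨(edgeIR_eq_edgeIR_e₁_e₂_iff h).not.2 hvw.ne, (parent_edgeIR h hvw).symm⟩

/-- The rooted tree `IR 2`, with the square of the unit vectors as its root. -/
noncomputable def rootedTreePoset : RootedTreePoset (IR 2) where
  root := edgeIR unimodular_e₁_e₂
  parent := parent
  height E := (heightSet E.1).toNat
  not_chain E F G hEF hFG := by
    obtain ⟨v, w, h, -, rfl⟩ := exists_eq_edgeIR_and_eq_triangleIR_of_lt hEF
    exact hFG.ne' (eq_of_triangleIR_le h hFG.le)
  parent_lt_or_lt _ := parent_lt_or_lt_parent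
  height_lt _ := heightSet_parent_lt
  eq_parent _ _ := eq_parent_of_lt

lemma infinite_IR : Infinite (IR 2) := by
  have h : ∀ n : ℕ, Unimodular e₁ ![(n : ℤ), 1] := fun n => Or.inl (by simp [det, e₁])
  refine Infinite.of_injective (fun n => edgeIR (h n)) fun n m hnm => ?_
  have hset : edge e₁ ![(n : ℤ), 1] = edge e₁ ![(m : ℤ), 1] := congr_arg Subtype.val hnm
  have hmem : ![(n : ℤ), 1] ∈ edge e₁ ![(m : ℤ), 1] := hset ▸ right_mem_edge _ _
  simpa [mem_edge, e₁] using hmem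

end Farey

namespace RootedTreePoset

variable {P : Type u} [PartialOrder P] (T : RootedTreePoset P)

lemma adj_parent {x : P} (hx : x ≠ T.root) : (comparabilityGraph P).Adj x (T.parent x) :=
  (T.parent_lt_or_lt x hx).symm

lemma eq_parent_of_adj {x y : P} (h : (comparabilityGraph P).Adj x y) :
    (x ≠ T.root ∧ y = T.parent x) ∨ (y ≠ T.root ∧ x = T.parent y) :=
  h.elim (T.eq_parent x y) fun h => (T.eq_parent y x h).symm

lemma reachable_root (x : P) : (comparabilityGraph P).Reachable x T.root := by
  induction hn : T.height x using Nat.strong_induction_on generalizing x with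
  | _ n ih =>
    by_cases hx : x = T.root
    · rw [hx]
    · exact (T.adj_parent hx).reachable.trans (ih _ (hn ▸ T.height_lt x hx) _ rfl)

/-- The relation of being an ancestor, or equal. -/
def Ancestor : P → P → Prop :=
  Relation.ReflTransGen fun x y => y ≠ T.root ∧ x = T.parent y

variable {T} in
lemma Ancestor.height_le {x y : P} (h : T.Ancestor x y) : T.height x ≤ T.height y := by
  induction h with
  | refl => exact le_rfl
  | tail _ hy ih => exact ih.trans (hy.2 ▸ (T.height_lt _ hy.1).le)

variable {T} in
lemma Ancestor.of_adj {x y z : P} (hxy : T.Ancestor x y) (hyz : (comparabilityGraph P).Adj y z)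
    (hne : s(y, z) ≠ s(x, T.parent x)) : T.Ancestor x z := by
  rcases T.eq_parent_of_adj hyz with ⟨-, rfl⟩ | ⟨hz, rfl⟩
  · rcases Relation.ReflTransGen.cases_tail hxy with rfl | ⟨b, hb, -, rfl⟩
    · exact absurd rfl hne
    · exact hb
  · exact hxy.tail ⟨hz, rfl⟩

/- A walk starting at `x` which does not use the edge from `x` to its parent stays among the
descendants of `x`. -/
lemma isBridge_parent {x : P} (hx : x ≠ T.root) :
    (comparabilityGraph P).IsBridge s(x, T.parent x) := by
  rw [SimpleGraph.isBridge_iff]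
  intro hreach
  have hancestor : ∀ y, Relation.ReflTransGen
      ((comparabilityGraph P) \ SimpleGraph.fromEdgeSet {s(x, T.parent x)}).Adj x y →
      T.Ancestor x y := by
    intro y hy
    induction hy with
    | refl => exact Relation.ReflTransGen.refl
    | tail _ hadj ih =>
      rw [SimpleGraph.sdiff_adj, SimpleGraph.fromEdgeSet_adj] at hadj
      exact ih.of_adj hadj.1 fun h => hadj.2 ⟨h, hadj.1.ne⟩
  rw [SimpleGraph.reachable_iff_reflTransGen] at hreach
  exact (T.height_lt x hx).not_ge (hancestor _ hreach).height_le

theorem isTree (T : RootedTreePoset P) : (comparabilityGraph P).IsTree where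
  connected :=
    { preconnected := fun x y => (T.reachable_root x).trans (T.reachable_root y).symm
      nonempty := ⟨T.root⟩ }
  isAcyclic := by
    rw [SimpleGraph.isAcyclic_iff_forall_adj_isBridge]
    intro x y h
    rcases T.eq_parent_of_adj h with ⟨hx, rfl⟩ | ⟨hx, rfl⟩
    · exact T.isBridge_parent hx
    · rw [Sym2.eq_swap]
      exact T.isBridge_parent hx

end RootedTreePoset

namespace Farey

/-- The action of the integral matrices on the lattice in the plane. -/
noncomputable def act : GL (Fin 2) ℤ ≃* ((Fin 2 → ℤ) ≃ₗ[ℤ] (Fin 2 → ℤ)) :=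
  Matrix.GeneralLinearGroup.toLin.trans (LinearMap.GeneralLinearGroup.generalLinearEquiv ℤ _)

lemma act_apply (g : GL (Fin 2) ℤ) (v) :
    act g v = (g : Matrix (Fin 2) (Fin 2) ℤ).mulVec v := rfl

lemma act_mul_apply (g h : GL (Fin 2) ℤ) (v) : act (g * h) v = act g (act h v) := by
  rw [map_mul, LinearEquiv.mul_apply]

lemma det_act (g : GL (Fin 2) ℤ) (v w) :
    det (act g v) (act g w) = (g : Matrix (Fin 2) (Fin 2) ℤ).det * det v w := by
  simp only [det, act_apply, Matrix.mulVec, dotProduct, Fin.sum_univ_two, Matrix.det_fin_two]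
  ring

lemma isUnit_det_coe (g : GL (Fin 2) ℤ) : IsUnit (g : Matrix (Fin 2) (Fin 2) ℤ).det :=
  (Matrix.isUnit_iff_isUnit_det _).1 g.isUnit

lemma Unimodular.act {v w} (h : Unimodular v w) (g : GL (Fin 2) ℤ) :
    Unimodular (act g v) (act g w) := by
  rw [unimodular_iff_isUnit, det_act]
  exact (isUnit_det_coe g).mul (unimodular_iff_isUnit.1 h)

lemma IsUnimodularSystem.image {E : Set (Fin 2 → ℤ)} (hE : IsUnimodularSystem E)
    (g : GL (Fin 2) ℤ) : IsUnimodularSystem (Farey.act g '' E) where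
  zero_notMem := by
    rintro ⟨x, hx, h⟩
    rw [LinearEquiv.map_eq_zero_iff] at h
    exact hE.zero_notMem (h ▸ hx)
  neg_mem_iff x := by
    rw [← (Farey.act g).apply_symm_apply x, ← map_neg, (Farey.act g).injective.mem_set_image,
      (Farey.act g).injective.mem_set_image]
    exact hE.neg_mem_iff _
  unimodular := by
    rintro _ ⟨v, hv, rfl⟩ _ ⟨w, hw, rfl⟩
    refine (hE.unimodular v hv w hw).imp (fun h => ?_) fun h => h.act g
    rw [det_act, h, mul_zero]
  exists_unimodular := by
    obtain ⟨v, hv, w, hw, h⟩ := hE.exists_unimodular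
    exact ⟨_, ⟨v, hv, rfl⟩, _, ⟨w, hw, rfl⟩, h.act g⟩

/-- The image of a system under an integral matrix. -/
noncomputable def actIR (g : GL (Fin 2) ℤ) (E : IR 2) : IR 2 :=
  ⟨act g '' E.1, (isUnimodularSystem_iff _).1 ((isUnimodularSystem E).image g)⟩

lemma actIR_one (E) : actIR 1 E = E :=
  Subtype.ext (by simp [actIR])

lemma actIR_mul (g h : GL (Fin 2) ℤ) (E) : actIR (g * h) E = actIR g (actIR h E) :=
  Subtype.ext (by simp only [actIR, act_mul_apply, Set.image_image])

/-- The action of the integral matrices on the poset `IR 2`. -/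
noncomputable def actionIR : GL (Fin 2) ℤ →* (IR 2 ≃o IR 2) where
  toFun g :=
    { toFun := actIR g
      invFun := actIR g⁻¹
      left_inv := fun E => by rw [← actIR_mul, inv_mul_cancel, actIR_one]
      right_inv := fun E => by rw [← actIR_mul, mul_inv_cancel, actIR_one]
      map_rel_iff' := Set.image_subset_image_iff (act g).injective }
  map_one' := RelIso.ext actIR_one
  map_mul' g h := RelIso.ext (actIR_mul g h)

end Farey

/-! ### Matroids of vector configurations -/

open Farey

lemma finsum_mem_eq_finsum_mem_indicator_add {α A : Type*} [Finite α] [AddCommMonoid A]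
    {σ : α → α} (hσ : Function.Injective σ) {C D : Set α} (hD : Disjoint D (σ '' D))
    (hCD : C ⊆ D ∪ σ '' D) (φ : α → A) :
    ∑ᶠ x ∈ C, φ x = ∑ᶠ x ∈ D, (C.indicator φ x + C.indicator φ (σ x)) :=
  calc ∑ᶠ x ∈ C, φ x = ∑ᶠ x ∈ D ∪ σ '' D, C.indicator φ x := by
        simp only [finsum_mem_def, Set.indicator_indicator, Set.inter_eq_right.2 hCD]
    _ = ∑ᶠ x ∈ D, C.indicator φ x + ∑ᶠ x ∈ D, C.indicator φ (σ x) := by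
        rw [finsum_mem_union hD D.toFinite (σ '' D).toFinite, finsum_mem_image hσ.injOn]
    _ = ∑ᶠ x ∈ D, (C.indicator φ x + C.indicator φ (σ x)) :=
        (finsum_mem_add_distrib D.toFinite).symm

/-- A finite family of vectors in the plane, any two of which are linearly dependent or form a
basis of the lattice, and which contains a basis. It is indexed by a set with a free involution
`bar` corresponding to the passage to the opposite vector. -/
structure VectorConfig where
  /-- the index set -/
  carrier : Type u
  finite : Finite carrier
  /-- the free involution -/
  bar : carrier → carrier
  bar_bar : ∀ e, bar (bar e) = e
  bar_ne : ∀ e, bar e ≠ e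
  /-- the family of vectors -/
  vec : carrier → Fin 2 → ℤ
  vec_bar : ∀ e, vec (bar e) = -vec e
  det_eq_zero_or_unimodular : ∀ e f, det (vec e) (vec f) = 0 ∨ Unimodular (vec e) (vec f)
  exists_unimodular : ∃ e f, Unimodular (vec e) (vec f)

namespace VectorConfig

variable (X : VectorConfig.{u})

/-- The signed circuits of a configuration of vectors: the minimal linear dependencies, in which
all coefficients can be taken to be one after the passage to opposite vectors. -/
def IsCircuit (C : Set X.carrier) : Prop :=
  (∃ e, X.vec e = 0 ∧ C = {e}) ∨
  (∃ e f, X.vec e ≠ 0 ∧ f ≠ X.bar e ∧ X.vec e + X.vec f = 0 ∧ C = {e, f}) ∨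
  ∃ e f g, det (X.vec e) (X.vec f) ≠ 0 ∧ X.vec e + X.vec f + X.vec g = 0 ∧ C = {e, f, g}

variable {X}

lemma bar_injective : Function.Injective X.bar := Function.Involutive.injective X.bar_bar

lemma mem_bar_image {C : Set X.carrier} {e} : e ∈ X.bar '' C ↔ X.bar e ∈ C :=
  ⟨by rintro ⟨f, hf, rfl⟩; rwa [X.bar_bar], fun h => ⟨_, h, X.bar_bar e⟩⟩

lemma bar_image_bar_image (C : Set X.carrier) : X.bar '' (X.bar '' C) = C := by
  ext e
  rw [mem_bar_image, mem_bar_image, X.bar_bar]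

lemma finite_set (C : Set X.carrier) : C.Finite :=
  have := X.finite
  C.toFinite

lemma unimodular_of_det_ne_zero {e f} (h : det (X.vec e) (X.vec f) ≠ 0) :
    Unimodular (X.vec e) (X.vec f) :=
  (X.det_eq_zero_or_unimodular e f).resolve_left h

lemma vec_ne_zero_of_det_ne_zero {e f} (h : det (X.vec e) (X.vec f) ≠ 0) : X.vec e ≠ 0 :=
  (unimodular_of_det_ne_zero h).left_ne_zero

lemma ne_of_det_ne_zero {e f} (h : det (X.vec e) (X.vec f) ≠ 0) : f ≠ e := fun hfe =>
  h (by rw [hfe, det_self])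

lemma ne_bar_of_det_ne_zero {e f} (h : det (X.vec e) (X.vec f) ≠ 0) : f ≠ X.bar e := fun hfe =>
  h (by rw [hfe, X.vec_bar, det_neg_right, det_self, neg_zero])

lemma ne_of_add_eq_zero {e f} (he : X.vec e ≠ 0) (hef : X.vec e + X.vec f = 0) : f ≠ e := by
  rintro rfl
  exact he (self_eq_neg.1 (eq_neg_of_add_eq_zero_left hef))

lemma det_rotate_of_add_eq_zero {u v w : Fin 2 → ℤ} (h : u + v + w = 0) :
    det v w = det u v ∧ det w u = det u v := by
  rw [eq_neg_of_add_eq_zero_right h]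
  simp only [det_neg_left, det_neg_right, det_add_left, det_add_right, det_self]
  have := det_swap u v
  omega

lemma det_ne_zero_of_add_eq_zero {u v w : Fin 2 → ℤ} (huv : det u v ≠ 0) (h : u + v + w = 0) :
    det u w ≠ 0 ∧ det v w ≠ 0 := by
  obtain ⟨hvw, hwu⟩ := det_rotate_of_add_eq_zero h
  rw [hvw, det_swap, hwu]
  exact ⟨neg_ne_zero.2 huv, huv⟩

lemma finsum_mem_triple {A : Type*} [AddCommMonoid A] {e f g : X.carrier}
    (hef : det (X.vec e) (X.vec f) ≠ 0) (hefg : X.vec e + X.vec f + X.vec g = 0)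
    (φ : X.carrier → A) : ∑ᶠ x ∈ ({e, f, g} : Set X.carrier), φ x = φ e + (φ f + φ g) := by
  obtain ⟨heg, hfg⟩ := det_ne_zero_of_add_eq_zero hef hefg
  rw [finsum_mem_insert _ _ (finite_set _), finsum_mem_pair (ne_of_det_ne_zero hfg).symm]
  rintro (rfl | rfl)
  exacts [ne_of_det_ne_zero hef rfl, ne_of_det_ne_zero heg rfl]

lemma isCircuit_singleton {e} (he : X.vec e = 0) : X.IsCircuit {e} := Or.inl ⟨e, he, rfl⟩

lemma isCircuit_pair {e f} (he : X.vec e ≠ 0) (hf : f ≠ X.bar e)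
    (hef : X.vec e + X.vec f = 0) : X.IsCircuit {e, f} :=
  Or.inr (Or.inl ⟨e, f, he, hf, hef, rfl⟩)

lemma isCircuit_triple {e f g} (hef : det (X.vec e) (X.vec f) ≠ 0)
    (hefg : X.vec e + X.vec f + X.vec g = 0) : X.IsCircuit {e, f, g} :=
  Or.inr (Or.inr ⟨e, f, g, hef, hefg, rfl⟩)

lemma IsCircuit.nonempty {C} (hC : X.IsCircuit C) : C.Nonempty := by
  rcases hC with ⟨e, -, rfl⟩ | ⟨e, f, -, -, -, rfl⟩ | ⟨e, f, g, -, -, rfl⟩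
  exacts [Set.singleton_nonempty e, Set.insert_nonempty e _, Set.insert_nonempty e _]

lemma IsCircuit.cases_of_mem {C} (hC : X.IsCircuit C) {e} (he : e ∈ C) :
    (X.vec e = 0 ∧ C = {e}) ∨
    (∃ f, X.vec e ≠ 0 ∧ f ≠ X.bar e ∧ X.vec e + X.vec f = 0 ∧ C = {e, f}) ∨
    ∃ f g, det (X.vec e) (X.vec f) ≠ 0 ∧ X.vec e + X.vec f + X.vec g = 0 ∧ C = {e, f, g} := by
  rcases hC with ⟨x, hx, rfl⟩ | ⟨x, y, hx, hy, hxy, rfl⟩ | ⟨x, y, z, hxy, hxyz, rfl⟩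
  · obtain rfl : e = x := he
    exact Or.inl ⟨hx, rfl⟩
  · right; left
    rcases he with rfl | rfl
    · exact ⟨y, hx, hy, hxy, rfl⟩
    · refine ⟨x, fun h => hx ?_, fun h => hy ?_, (add_comm _ _).trans hxy, Set.pair_comm _ _⟩
      · rwa [h, add_zero] at hxy
      · rw [h, X.bar_bar]
  · right; right
    obtain ⟨hyz, hzx⟩ := det_rotate_of_add_eq_zero hxyz
    rcases he with rfl | rfl | rfl
    · exact ⟨y, z, hxy, hxyz, rfl⟩
    · refine ⟨z, x, hyz ▸ hxy, ?_, ?_⟩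
      · rw [← hxyz]
        abel
      · rw [Set.insert_comm, Set.pair_comm x]
    · refine ⟨x, y, hzx ▸ hxy, ?_, ?_⟩
      · rw [← hxyz]
        abel
      · rw [Set.pair_comm y, Set.insert_comm]

lemma IsCircuit.bar {C} (hC : X.IsCircuit C) : X.IsCircuit (X.bar '' C) := by
  rcases hC with ⟨x, hx, rfl⟩ | ⟨x, y, hx, hy, hxy, rfl⟩ | ⟨x, y, z, hxy, hxyz, rfl⟩
  · rw [Set.image_singleton]
    exact isCircuit_singleton (by rw [X.vec_bar, hx, neg_zero])
  · rw [Set.image_pair]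
    refine isCircuit_pair ?_ (fun h => hy (bar_injective h)) ?_
    · rwa [X.vec_bar, neg_ne_zero]
    · rw [X.vec_bar, X.vec_bar, ← neg_add, hxy, neg_zero]
  · rw [Set.image_insert_eq, Set.image_pair]
    refine isCircuit_triple ?_ ?_
    · rwa [X.vec_bar, X.vec_bar, det_neg_left, det_neg_right, neg_neg]
    · rw [X.vec_bar, X.vec_bar, X.vec_bar, ← neg_add, ← neg_add, hxyz, neg_zero]

lemma IsCircuit.bar_notMem {C} (hC : X.IsCircuit C) {e} (he : e ∈ C) : X.bar e ∉ C := by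
  rcases hC.cases_of_mem he with ⟨-, rfl⟩ | ⟨f, -, hf, -, rfl⟩ | ⟨f, g, hef, hefg, rfl⟩
  · exact X.bar_ne e
  · rintro (h | h)
    exacts [X.bar_ne e h, hf h.symm]
  · rintro (h | h | h)
    · exact X.bar_ne e h
    · exact ne_bar_of_det_ne_zero hef h.symm
    · exact ne_bar_of_det_ne_zero (det_ne_zero_of_add_eq_zero hef hefg).1 h.symm

lemma IsCircuit.disjoint_bar {C} (hC : X.IsCircuit C) : Disjoint C (X.bar '' C) :=
  Set.disjoint_left.2 fun _ he hbar => hC.bar_notMem he (mem_bar_image.1 hbar)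

lemma IsCircuit.finsum_eq_zero {C} (hC : X.IsCircuit C) : ∑ᶠ e ∈ C, X.vec e = 0 := by
  rcases hC with ⟨e, he, rfl⟩ | ⟨e, f, he, -, hef, rfl⟩ | ⟨e, f, g, hef, hefg, rfl⟩
  · rwa [finsum_mem_singleton]
  · rwa [finsum_mem_pair (ne_of_add_eq_zero he hef).symm]
  · rwa [finsum_mem_triple hef hefg, ← add_assoc]

lemma IsCircuit.eq_of_finsum_smul_eq_zero {C} (hC : X.IsCircuit C) {c : X.carrier → ℤ}
    (hc : ∑ᶠ x ∈ C, c x • X.vec x = 0) {e} (he : e ∈ C) {x} (hx : x ∈ C) : c x = c e := by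
  rcases hC.cases_of_mem he with ⟨-, rfl⟩ | ⟨f, he₀, -, hef, rfl⟩ | ⟨f, g, hef, hefg, rfl⟩
  · rw [Set.mem_singleton_iff.1 hx]
  · rw [finsum_mem_pair (ne_of_add_eq_zero he₀ hef).symm, eq_neg_of_add_eq_zero_right hef,
      smul_neg, ← sub_eq_add_neg, ← sub_smul] at hc
    rcases hx with rfl | rfl
    exacts [rfl, (sub_eq_zero.1 ((smul_eq_zero.1 hc).resolve_right he₀)).symm]
  · rw [finsum_mem_triple hef hefg] at hc
    obtain ⟨hfg, hge⟩ := det_rotate_of_add_eq_zero hefg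
    have hcfg := congr_arg (det (X.vec e)) hc
    have hceg := congr_arg (det (X.vec f)) hc
    rw [det_swap (X.vec e)] at hge
    simp only [det_add_right, det_smul_right, det_self, det_zero_right, hfg,
      det_swap (X.vec e) (X.vec f), neg_eq_iff_eq_neg.1 hge] at hcfg hceg
    have hf : c f = c g := mul_right_cancel₀ hef (by linarith)
    have hg : c g = c e := mul_right_cancel₀ hef (by linarith)
    rcases hx with rfl | rfl | rfl
    exacts [rfl, hf.trans hg, hg]

/-- The multiplicity of an element in a set of signed elements, counted with sign. -/
noncomputable def sign (C : Set X.carrier) (x : X.carrier) : ℤ :=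
  C.indicator 1 x - C.indicator 1 (X.bar x)

lemma sign_eq_one_iff {C : Set X.carrier} {x} : sign C x = 1 ↔ x ∈ C ∧ X.bar x ∉ C := by
  by_cases hx : x ∈ C <;> by_cases hbar : X.bar x ∈ C <;> simp [sign, hx, hbar]

lemma sign_eq_zero_iff {C : Set X.carrier} {x} : sign C x = 0 ↔ (x ∈ C ↔ X.bar x ∈ C) := by
  by_cases hx : x ∈ C <;> by_cases hbar : X.bar x ∈ C <;> simp [sign, hx, hbar]

lemma finsum_mem_vec_eq_finsum_mem_sign {C D : Set X.carrier} (hD : Disjoint D (X.bar '' D))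
    (hCD : C ⊆ D ∪ X.bar '' D) : ∑ᶠ x ∈ C, X.vec x = ∑ᶠ x ∈ D, sign C x • X.vec x := by
  have hind : ∀ x, C.indicator X.vec x + C.indicator X.vec (X.bar x) = sign C x • X.vec x := by
    intro x
    by_cases hx : x ∈ C <;> by_cases hbar : X.bar x ∈ C <;> simp [sign, hx, hbar, X.vec_bar]
  have := X.finite
  simp only [finsum_mem_eq_finsum_mem_indicator_add bar_injective hD hCD, hind]

/- The relation carried by `C₁` is one among the elements of `C₂`, hence a multiple of the one
carried by `C₂`. -/
lemma IsCircuit.eq_of_subset_of_mem {C₁ C₂} (hC₁ : X.IsCircuit C₁) (hC₂ : X.IsCircuit C₂)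
    (hsub : C₁ ⊆ C₂ ∪ X.bar '' C₂) {e} (he₁ : e ∈ C₁) (he₂ : e ∈ C₂) : C₁ = C₂ := by
  have hrel : ∑ᶠ x ∈ C₂, sign C₁ x • X.vec x = 0 := by
    rw [← finsum_mem_vec_eq_finsum_mem_sign hC₂.disjoint_bar hsub, hC₁.finsum_eq_zero]
  have hsign : ∀ x ∈ C₂, x ∈ C₁ ∧ X.bar x ∉ C₁ := fun x hx => by
    rw [← sign_eq_one_iff, hC₂.eq_of_finsum_smul_eq_zero hrel he₂ hx, sign_eq_one_iff]
    exact ⟨he₁, hC₁.bar_notMem he₁⟩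
  refine Set.Subset.antisymm (fun x hx => (hsub hx).resolve_right ?_) fun x hx => (hsign x hx).1
  intro hbar
  exact hC₁.bar_notMem hx (hsign _ (mem_bar_image.1 hbar)).1

lemma IsCircuit.eq_or_eq_bar {C₁ C₂} (hC₁ : X.IsCircuit C₁) (hC₂ : X.IsCircuit C₂)
    (hsub : C₁ ⊆ C₂ ∪ X.bar '' C₂) : C₁ = C₂ ∨ C₁ = X.bar '' C₂ := by
  obtain ⟨e, he⟩ := hC₁.nonempty
  rcases hsub he with he₂ | he₂
  · exact Or.inl (hC₁.eq_of_subset_of_mem hC₂ hsub he he₂)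
  · refine Or.inr (hC₁.eq_of_subset_of_mem hC₂.bar ?_ he he₂)
    rwa [bar_image_bar_image, Set.union_comm]

lemma triple_sdiff_singleton {e f g} (hef : det (X.vec e) (X.vec f) ≠ 0)
    (hefg : X.vec e + X.vec f + X.vec g = 0) :
    ({e, f, g} \ {e} : Set X.carrier) = {f, g} := by
  refine Set.insert_sdiff_self_of_notMem ?_
  rintro (rfl | rfl)
  exacts [ne_of_det_ne_zero hef rfl,
    ne_of_det_ne_zero (det_ne_zero_of_add_eq_zero hef hefg).1 rfl]

lemma exists_isCircuit_of_vec_eq {A B : Set X.carrier} {f h} (hf : f ∈ A) (hh : h ∈ B)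
    (hfh : f ≠ h) (hf₀ : X.vec f ≠ 0) (hvec : X.vec f = X.vec h) :
    ∃ C, X.IsCircuit C ∧ C ⊆ A ∪ X.bar '' B := by
  refine ⟨{f, X.bar h}, isCircuit_pair hf₀ (fun hbar => hfh (bar_injective hbar).symm) ?_, ?_⟩
  · rw [X.vec_bar, hvec, add_neg_cancel]
  · exact Set.pair_subset (Or.inl hf) (Or.inr ⟨h, hh, rfl⟩)

lemma exists_isCircuit_of_triples_of_vec_eq {e f g h k} (hef : det (X.vec e) (X.vec f) ≠ 0)
    (hefg : X.vec e + X.vec f + X.vec g = 0) (hehk : X.vec e + X.vec h + X.vec k = 0)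
    (hne : ({e, f, g} : Set X.carrier) ≠ {e, h, k}) (hvec : X.vec f = X.vec h) :
    ∃ C, X.IsCircuit C ∧ C ⊆ {f, g} ∪ X.bar '' {h, k} := by
  by_cases hfh : f = h
  · have hgk : g ≠ k := by
      rintro rfl
      exact hne (by rw [hfh])
    have hg₀ := (unimodular_of_det_ne_zero (det_ne_zero_of_add_eq_zero hef hefg).1).right_ne_zero
    rw [← hehk, hvec, add_right_inj] at hefg
    exact exists_isCircuit_of_vec_eq (by simp) (by simp) hgk hg₀ hefg
  · exact exists_isCircuit_of_vec_eq (by simp) (by simp) hfh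
      (unimodular_of_det_ne_zero hef).right_ne_zero hvec

/- If `h = f + n e`, then the pairs `(f, h)`, `(f, k)` and `(g, h)` have determinants `±n`,
`±(n + 1)` and `±(n - 1)`, all of which are at most one in absolute value. -/
lemma vec_eq_of_det_eq {e f g h k} (hef : det (X.vec e) (X.vec f) ≠ 0)
    (heh : det (X.vec e) (X.vec h) = det (X.vec e) (X.vec f))
    (hefg : X.vec e + X.vec f + X.vec g = 0) (hehk : X.vec e + X.vec h + X.vec k = 0) :
    X.vec f = X.vec h := by
  have hu := unimodular_of_det_ne_zero hef
  have hfh := X.det_eq_zero_or_unimodular f h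
  have hfk := X.det_eq_zero_or_unimodular f k
  have hgh := X.det_eq_zero_or_unimodular g h
  rw [eq_neg_of_add_eq_zero_right hehk] at hfk
  rw [eq_neg_of_add_eq_zero_right hefg] at hgh
  have hfh₀ : det (X.vec f) (X.vec h) = 0 := by
    simp only [Unimodular, det_neg_left, det_neg_right, det_add_left, det_add_right, heh,
      det_swap (X.vec e) (X.vec f)] at hfh hfk hgh hu
    omega
  have hvec := hu.eq_smul_add_smul (X.vec h)
  rw [det_swap (X.vec f) (X.vec h), hfh₀, heh, hu.det_mul_self, neg_zero, mul_zero, zero_smul,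
    one_smul, zero_add] at hvec
  exact hvec.symm

lemma exists_isCircuit_of_triples {e f g h k} (hef : det (X.vec e) (X.vec f) ≠ 0)
    (hefg : X.vec e + X.vec f + X.vec g = 0) (heh : det (X.vec e) (X.vec h) ≠ 0)
    (hehk : X.vec e + X.vec h + X.vec k = 0) (hne : ({e, f, g} : Set X.carrier) ≠ {e, h, k}) :
    ∃ C, X.IsCircuit C ∧ C ⊆ {f, g} ∪ X.bar '' {h, k} := by
  have hdet : det (X.vec e) (X.vec h) = det (X.vec e) (X.vec f) ∨
      det (X.vec e) (X.vec k) = det (X.vec e) (X.vec f) := by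
    have hek := (det_rotate_of_add_eq_zero hehk).2
    rw [det_swap (X.vec e), neg_eq_iff_eq_neg] at hek
    rcases unimodular_of_det_ne_zero hef with hf | hf <;>
    rcases unimodular_of_det_ne_zero heh with hh | hh <;> simp [hek, hf, hh]
  rcases hdet with hdet | hdet
  · exact exists_isCircuit_of_triples_of_vec_eq hef hefg hehk hne
      (vec_eq_of_det_eq hef hdet hefg hehk)
  · rw [add_right_comm] at hehk
    rw [Set.pair_comm h k] at hne ⊢
    exact exists_isCircuit_of_triples_of_vec_eq hef hefg hehk hne
      (vec_eq_of_det_eq hef hdet hefg hehk)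

lemma IsCircuit.elimination {C₁ C₂} (hC₁ : X.IsCircuit C₁) (hC₂ : X.IsCircuit C₂)
    (hne : C₁ ≠ C₂) {e} (he₁ : e ∈ C₁) (he₂ : e ∈ C₂) :
    ∃ C₃, X.IsCircuit C₃ ∧ C₃ ⊆ (C₁ \ {e}) ∪ X.bar '' (C₂ \ {e}) := by
  rcases hC₁.cases_of_mem he₁ with
    ⟨he, rfl⟩ | ⟨f, he, -, hef, rfl⟩ | ⟨f, g, hef, hefg, rfl⟩ <;>
  rcases hC₂.cases_of_mem he₂ with
    ⟨he', rfl⟩ | ⟨h, he', -, heh, rfl⟩ | ⟨h, k, heh, hehk, rfl⟩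
  · exact absurd rfl hne
  · exact absurd he he'
  · exact absurd he (vec_ne_zero_of_det_ne_zero heh)
  · exact absurd he' he
  · rw [Set.pair_sdiff_left (ne_of_add_eq_zero he hef).symm,
      Set.pair_sdiff_left (ne_of_add_eq_zero he heh).symm]
    have hf := eq_neg_of_add_eq_zero_right hef
    refine exists_isCircuit_of_vec_eq rfl rfl (by rintro rfl; exact hne rfl) ?_ ?_
    · rwa [hf, neg_ne_zero]
    · rw [hf, eq_neg_of_add_eq_zero_right heh]
  · rw [Set.pair_sdiff_left (ne_of_add_eq_zero he hef).symm, triple_sdiff_singleton heh hehk]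
    have hf := eq_neg_of_add_eq_zero_right hef
    refine ⟨{f, X.bar h, X.bar k}, isCircuit_triple ?_ ?_, ?_⟩
    · rwa [hf, X.vec_bar, det_neg_left, det_neg_right, neg_neg]
    · rw [hf, X.vec_bar, X.vec_bar, ← neg_add, ← neg_add, hehk, neg_zero]
    · rw [Set.image_pair, Set.singleton_union]
  · exact absurd he' (vec_ne_zero_of_det_ne_zero hef)
  · rw [triple_sdiff_singleton hef hefg, Set.pair_sdiff_left (ne_of_add_eq_zero he' heh).symm]
    refine ⟨{f, g, X.bar h}, isCircuit_triple (det_ne_zero_of_add_eq_zero hef hefg).2 ?_, ?_⟩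
    · rw [X.vec_bar, eq_neg_of_add_eq_zero_right heh, neg_neg, ← hefg]
      abel
    · rw [Set.image_singleton, Set.insert_union, Set.singleton_union]
  · rw [triple_sdiff_singleton hef hefg, triple_sdiff_singleton heh hehk]
    exact exists_isCircuit_of_triples hef hefg heh hehk hne

variable (X) in
/-- The freely oriented matroid of a configuration of vectors. -/
def toMatroid : FreelyOrientedMatroid.{u} where
  carrier := X.carrier
  finite := X.finite
  bar := X.bar
  bar_bar := X.bar_bar
  bar_ne := X.bar_ne
  circuits := {C | X.IsCircuit C}
  nonempty_of_circuit _ hC := hC.nonempty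
  disjoint_bar _ hC := hC.disjoint_bar
  bar_mem_circuits _ hC := hC.bar
  eq_or_eq_bar _ hC₁ _ hC₂ hsub := hC₁.eq_or_eq_bar hC₂ hsub
  elimination _ hC₁ _ hC₂ hne _ he := hC₁.elimination hC₂ hne he.1 he.2

end VectorConfig

namespace VectorConfig

variable {X : VectorConfig.{u}}

lemma exists_det_ne_zero {e} (he : X.vec e ≠ 0) : ∃ f, det (X.vec e) (X.vec f) ≠ 0 := by
  obtain ⟨a, b, hab⟩ := X.exists_unimodular
  by_contra! hzero
  refine he ((hab.eq_smul_add_smul (X.vec e)).trans ?_)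
  rw [hzero b, det_swap (X.vec e), hzero a, neg_zero, mul_zero, zero_smul, zero_smul, add_zero]

lemma vec_eq_or_neg_of_det_eq_zero {e f} (hef : det (X.vec e) (X.vec f) = 0)
    (he : X.vec e ≠ 0) (hf : X.vec f ≠ 0) : X.vec f = X.vec e ∨ X.vec f = -X.vec e := by
  obtain ⟨w, hew⟩ := exists_det_ne_zero he
  have hu := unimodular_of_det_ne_zero hew
  have hvec : X.vec f = (det (X.vec e) (X.vec w) * det (X.vec f) (X.vec w)) • X.vec e := by
    simpa only [hef, mul_zero, zero_smul, add_zero] using hu.eq_smul_add_smul (X.vec f)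
  have hfw : det (X.vec f) (X.vec w) ≠ 0 := fun hfw =>
    hf (by rw [hvec, hfw, mul_zero, zero_smul])
  have hunit := (unimodular_iff_isUnit.1 hu).mul
    (unimodular_iff_isUnit.1 (unimodular_of_det_ne_zero hfw))
  rcases Int.isUnit_iff.1 hunit with h | h
  · exact Or.inl (by rw [hvec, h, one_smul])
  · exact Or.inr (by rw [hvec, h, neg_one_smul])

lemma mem_pair_union_bar {a b x : X.carrier} : x ∈ {a, b} ∪ X.bar '' {a, b} ↔
    (x = a ∨ x = X.bar a) ∨ x = b ∨ x = X.bar b := by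
  rw [Set.image_pair]
  simp only [Set.mem_union, Set.mem_insert_iff, Set.mem_singleton_iff]
  tauto

lemma disjoint_pair_bar {a b} (hab : det (X.vec a) (X.vec b) ≠ 0) :
    Disjoint {a, b} (X.bar '' {a, b}) := by
  have hba : det (X.vec b) (X.vec a) ≠ 0 := by rwa [det_swap, neg_ne_zero]
  rw [Set.image_pair, Set.disjoint_left]
  rintro x (rfl | rfl) (h | h)
  exacts [X.bar_ne _ h.symm, ne_bar_of_det_ne_zero hba h, ne_bar_of_det_ne_zero hab h,
    X.bar_ne _ h.symm]

lemma not_subset_pair_union_bar {a b} (hab : det (X.vec a) (X.vec b) ≠ 0) {C}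
    (hC : X.IsCircuit C) : ¬ C ⊆ {a, b} ∪ X.bar '' {a, b} := by
  intro hsub
  have hrel : sign C a • X.vec a + sign C b • X.vec b = 0 := by
    rw [← finsum_mem_pair (f := fun x => sign C x • X.vec x) (ne_of_det_ne_zero hab).symm,
      ← finsum_mem_vec_eq_finsum_mem_sign (disjoint_pair_bar hab) hsub, hC.finsum_eq_zero]
  have hb : sign C b = 0 := by
    have := congr_arg (det (X.vec a)) hrel
    simpa only [det_add_right, det_smul_right, det_self, det_zero_right, mul_zero, zero_add,
      mul_eq_zero, hab, or_false] using this
  have ha : sign C a = 0 := by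
    have := congr_arg (det · (X.vec b)) hrel
    simpa only [det_add_left, det_smul_left, det_self, det_zero_left, mul_zero, add_zero,
      mul_eq_zero, hab, or_false] using this
  obtain ⟨x, hx⟩ := hC.nonempty
  rw [sign_eq_zero_iff] at ha hb
  have hbar := hC.bar_notMem hx
  rcases mem_pair_union_bar.1 (hsub hx) with (rfl | rfl) | rfl | rfl
  · exact hbar (ha.1 hx)
  · exact hC.bar_notMem (ha.2 hx) hx
  · exact hbar (hb.1 hx)
  · exact hC.bar_notMem (hb.2 hx) hx

lemma exists_isCircuit_mem_of_det_eq_zero {a x} (ha : X.vec a ≠ 0)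
    (hax : det (X.vec a) (X.vec x) = 0) (hne : x ≠ a) (hne_bar : x ≠ X.bar a) :
    ∃ C, X.IsCircuit C ∧ x ∈ C ∧ C ⊆ {x, a, X.bar a} := by
  by_cases hx : X.vec x = 0
  · exact ⟨{x}, isCircuit_singleton hx, rfl, by simp⟩
  rcases vec_eq_or_neg_of_det_eq_zero hax ha hx with hvec | hvec
  · refine ⟨{x, X.bar a}, isCircuit_pair hx (fun h => hne (bar_injective h).symm) ?_,
      by simp, Set.pair_subset (by simp) (by simp)⟩
    rw [X.vec_bar, hvec, add_neg_cancel]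
  · refine ⟨{x, a}, isCircuit_pair hx (fun h => hne_bar ?_) ?_,
      by simp, Set.pair_subset (by simp) (by simp)⟩
    · rw [h, X.bar_bar]
    · rw [hvec, neg_add_cancel]

lemma exists_vec_eq_smul (a : X.carrier) {ε : ℤ} (hε : IsUnit ε) :
    ∃ y, (y = a ∨ y = X.bar a) ∧ X.vec y = ε • X.vec a := by
  rcases Int.isUnit_iff.1 hε with rfl | rfl
  · exact ⟨a, Or.inl rfl, (one_smul _ _).symm⟩
  · exact ⟨X.bar a, Or.inr rfl, by rw [X.vec_bar, neg_smul, one_smul]⟩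

lemma exists_isCircuit_mem_of_det_ne_zero {a b x} (hab : det (X.vec a) (X.vec b) ≠ 0)
    (hax : det (X.vec a) (X.vec x) ≠ 0) (hxb : det (X.vec x) (X.vec b) ≠ 0) :
    ∃ C, X.IsCircuit C ∧ x ∈ C ∧ C ⊆ insert x ({a, b} ∪ X.bar '' {a, b}) := by
  have hu := unimodular_of_det_ne_zero hab
  have hab' := unimodular_iff_isUnit.1 hu
  have hax' := unimodular_iff_isUnit.1 (unimodular_of_det_ne_zero hax)
  have hxb' := unimodular_iff_isUnit.1 (unimodular_of_det_ne_zero hxb)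
  obtain ⟨y, hy, hvecy⟩ := exists_vec_eq_smul a (hab'.mul hxb').neg
  obtain ⟨z, hz, hvecz⟩ := exists_vec_eq_smul b (hab'.mul hax').neg
  refine ⟨{x, y, z}, isCircuit_triple ?_ ?_, by simp, Set.insert_subset_insert ?_⟩
  · rw [hvecy, det_smul_right, det_swap (X.vec a)]
    exact mul_ne_zero (hab'.mul hxb').neg.ne_zero (neg_ne_zero.2 hax)
  · rw [hvecy, hvecz, neg_smul, neg_smul, add_assoc, ← neg_add, ← hu.eq_smul_add_smul,
      add_neg_cancel]
  · exact Set.pair_subset (mem_pair_union_bar.2 (Or.inl hy)) (mem_pair_union_bar.2 (Or.inr hz))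

lemma exists_isCircuit_mem {a b} (hab : det (X.vec a) (X.vec b) ≠ 0) {x}
    (hx : x ∉ {a, b} ∪ X.bar '' {a, b}) :
    ∃ C, X.IsCircuit C ∧ x ∈ C ∧ C ⊆ insert x ({a, b} ∪ X.bar '' {a, b}) := by
  have hu := unimodular_of_det_ne_zero hab
  have hx' := mem_pair_union_bar.not.1 hx
  push Not at hx'
  obtain ⟨⟨hxa, hxa_bar⟩, hxb, hxb_bar⟩ := hx'
  by_cases hdeta : det (X.vec a) (X.vec x) = 0
  · obtain ⟨C, hC, hxC, hsub⟩ :=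
      exists_isCircuit_mem_of_det_eq_zero hu.left_ne_zero hdeta hxa hxa_bar
    exact ⟨C, hC, hxC, hsub.trans (Set.insert_subset_insert
      (Set.pair_subset (Or.inl (by simp)) (Or.inr (by simp))))⟩
  by_cases hdetb : det (X.vec x) (X.vec b) = 0
  · rw [det_swap, neg_eq_zero] at hdetb
    obtain ⟨C, hC, hxC, hsub⟩ :=
      exists_isCircuit_mem_of_det_eq_zero hu.right_ne_zero hdetb hxb hxb_bar
    exact ⟨C, hC, hxC, hsub.trans (Set.insert_subset_insert
      (Set.pair_subset (Or.inl (by simp)) (Or.inr (by simp))))⟩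
  exact exists_isCircuit_mem_of_det_ne_zero hab hdeta hdetb

lemma exists_isCircuit_of_det_eq_zero {a b} (hab : det (X.vec a) (X.vec b) = 0) (hne : b ≠ a)
    (hne_bar : b ≠ X.bar a) : ∃ C, X.IsCircuit C ∧ C ⊆ {a, b} ∪ X.bar '' {a, b} := by
  by_cases ha : X.vec a = 0
  · exact ⟨{a}, isCircuit_singleton ha, by simp⟩
  obtain ⟨C, hC, -, hsub⟩ := exists_isCircuit_mem_of_det_eq_zero ha hab hne hne_bar
  refine ⟨C, hC, hsub.trans ?_⟩
  rintro x (rfl | rfl | rfl) <;> simp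

lemma indep_pair {a b} (hab : det (X.vec a) (X.vec b) ≠ 0) : X.toMatroid.Indep {a, b} :=
  ⟨disjoint_pair_bar hab, fun _ hC => not_subset_pair_union_bar hab hC⟩

lemma det_ne_zero_of_indep {A : Set X.carrier} (hA : X.toMatroid.Indep A) {a b} (ha : a ∈ A)
    (hb : b ∈ A) (hne : b ≠ a) : det (X.vec a) (X.vec b) ≠ 0 := by
  intro hdet
  have hne_bar : b ≠ X.bar a := by
    rintro rfl
    exact Set.disjoint_left.1 hA.1 hb ⟨a, ha, rfl⟩
  obtain ⟨C, hC, hsub⟩ := exists_isCircuit_of_det_eq_zero hdet hne hne_bar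
  have hpair : {a, b} ⊆ A := Set.pair_subset ha hb
  exact hA.2 C hC (hsub.trans (Set.union_subset_union hpair (Set.image_mono hpair)))

lemma eq_pair_of_indep {A : Set X.carrier} (hA : X.toMatroid.Indep A) {a b} (ha : a ∈ A)
    (hb : b ∈ A) (hab : det (X.vec a) (X.vec b) ≠ 0) : A = {a, b} := by
  have hpair : {a, b} ⊆ A := Set.pair_subset ha hb
  refine hpair.antisymm' fun x hx => ?_
  by_contra hxab
  have hx' : x ∉ {a, b} ∪ X.bar '' {a, b} := fun h => h.elim hxab fun h =>
    Set.disjoint_left.1 hA.1 hx (Set.image_mono hpair h)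
  obtain ⟨C, hC, -, hsub⟩ := exists_isCircuit_mem hab hx'
  exact hA.2 C hC (hsub.trans (Set.insert_subset (Or.inl hx)
    (Set.union_subset_union hpair (Set.image_mono hpair))))

lemma exists_subset_pair_of_indep {A : Set X.carrier} (hA : X.toMatroid.Indep A) :
    ∃ a b, det (X.vec a) (X.vec b) ≠ 0 ∧ A ⊆ {a, b} := by
  rcases A.eq_empty_or_nonempty with rfl | ⟨a, ha⟩
  · obtain ⟨a, b, hab⟩ := X.exists_unimodular
    exact ⟨a, b, hab.det_ne_zero, Set.empty_subset _⟩
  by_cases hb : ∃ b ∈ A, b ≠ a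
  · obtain ⟨b, hb, hne⟩ := hb
    have hab := det_ne_zero_of_indep hA ha hb hne
    exact ⟨a, b, hab, (eq_pair_of_indep hA ha hb hab).subset⟩
  · push Not at hb
    have ha₀ : X.vec a ≠ 0 := fun h => hA.2 _ (isCircuit_singleton h)
      (Set.singleton_subset_iff.2 (Or.inl ha))
    obtain ⟨b, hab⟩ := exists_det_ne_zero ha₀
    exact ⟨a, b, hab, fun x hx => Or.inl (hb x hx)⟩

lemma isBasis_iff {A : Set X.carrier} :
    X.toMatroid.IsBasis A ↔ ∃ a b, det (X.vec a) (X.vec b) ≠ 0 ∧ A = {a, b} := by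
  constructor
  · intro hA
    obtain ⟨a, b, hab, hsub⟩ := exists_subset_pair_of_indep hA.1
    exact ⟨a, b, hab, hsub.antisymm (hA.2 (indep_pair hab) hsub)⟩
  · rintro ⟨a, b, hab, rfl⟩
    exact ⟨indep_pair hab, fun A hA hsub =>
      (eq_pair_of_indep hA (hsub (Or.inl rfl)) (hsub (Or.inr rfl)) hab).subset⟩

lemma hasRank_toMatroid : X.toMatroid.HasRank 2 := by
  obtain ⟨a, b, hab⟩ := X.exists_unimodular
  exact ⟨{a, b}, isBasis_iff.2 ⟨a, b, hab.det_ne_zero, rfl⟩,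
    Set.ncard_pair (ne_of_det_ne_zero hab.det_ne_zero).symm⟩

end VectorConfig

namespace Farey

/-- The inclusion of the integral vectors in the real ones. -/
def toReal : (Fin 2 → ℤ) →+ (Fin 2 → ℝ) := (Int.castAddHom ℝ).compLeft (Fin 2)

lemma basisDet_toReal (v w : Fin 2 → ℤ) :
    (Pi.basisFun ℝ (Fin 2)).det ![toReal v, toReal w] = det v w := by
  rw [Pi.basisFun_det_apply, Matrix.det_fin_two]
  simp [toReal, det]

lemma linearIndependent_and_span_toReal {v w : Fin 2 → ℤ} (h : det v w ≠ 0) :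
    LinearIndependent ℝ ![toReal v, toReal w] ∧
      Submodule.span ℝ (Set.range ![toReal v, toReal w]) = ⊤ := by
  rw [Module.Basis.is_basis_iff_det (Pi.basisFun ℝ (Fin 2)), basisDet_toReal]
  exact (Int.cast_ne_zero.2 h).isUnit

lemma Unimodular.abs_alternatingMap_toReal {v w : Fin 2 → ℤ} (h : Unimodular v w)
    (ω : (Fin 2 → ℝ) [⋀^Fin 2]→ₗ[ℝ] ℝ) :
    |ω ![toReal v, toReal w]| = |ω (Pi.basisFun ℝ (Fin 2))| := by
  have habs : |(det v w : ℝ)| = 1 := by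
    rw [← Int.cast_abs, Int.isUnit_iff_abs_eq.1 (unimodular_iff_isUnit.1 h), Int.cast_one]
  conv_lhs => rw [ω.eq_smul_basis_det (Pi.basisFun ℝ (Fin 2))]
  rw [AlternatingMap.smul_apply, basisDet_toReal, smul_eq_mul, abs_mul, habs, mul_one]

/-- The integral matrix with the given columns. -/
noncomputable def matrixOfBasis {v w : Fin 2 → ℤ} (h : Unimodular v w) : GL (Fin 2) ℤ :=
  Matrix.GeneralLinearGroup.mk'' !![v 0, w 0; v 1, w 1] (by
    rw [Matrix.det_fin_two_of, Int.isUnit_iff, mul_comm (w 0)]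
    exact h)

lemma act_matrixOfBasis_e₁ {v w} (h : Unimodular v w) : act (matrixOfBasis h) e₁ = v := by
  change Matrix.mulVec !![v 0, w 0; v 1, w 1] e₁ = v
  ext i
  fin_cases i <;> simp [e₁, Matrix.mulVec, dotProduct]

lemma act_matrixOfBasis_e₂ {v w} (h : Unimodular v w) : act (matrixOfBasis h) e₂ = w := by
  change Matrix.mulVec !![v 0, w 0; v 1, w 1] e₂ = w
  ext i
  fin_cases i <;> simp [e₂, Matrix.mulVec, dotProduct]

lemma exists_act_eq {v w v' w' : Fin 2 → ℤ} (h : Unimodular v w) (h' : Unimodular v' w') :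
    ∃ g : GL (Fin 2) ℤ, act g v = v' ∧ act g w = w' := by
  refine ⟨matrixOfBasis h' * (matrixOfBasis h)⁻¹, ?_, ?_⟩
  · conv_lhs => arg 2; rw [← act_matrixOfBasis_e₁ h]
    rw [← act_mul_apply, inv_mul_cancel_right, act_matrixOfBasis_e₁]
  · conv_lhs => arg 2; rw [← act_matrixOfBasis_e₂ h]
    rw [← act_mul_apply, inv_mul_cancel_right, act_matrixOfBasis_e₂]

lemma eq_of_act_eq {v w} (h : Unimodular v w) {g g' : GL (Fin 2) ℤ} (hv : act g v = act g' v)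
    (hw : act g w = act g' w) : g = g' := by
  refine act.injective (LinearEquiv.ext fun z => ?_)
  rw [h.eq_smul_add_smul z]
  simp only [map_add, map_smul, hv, hw]

end Farey

namespace VectorConfig

variable {X Y : VectorConfig.{u}}

lemma toReal_vec_add_toReal_vec_bar (e : X.carrier) :
    toReal (X.vec e) + toReal (X.vec (X.bar e)) = 0 := by
  rw [X.vec_bar, map_neg, add_neg_cancel]

lemma IsCircuit.finsum_toReal_eq_zero {C} (hC : X.IsCircuit C) :
    ∑ᶠ e ∈ C, (1 : ℝ) • toReal (X.vec e) = 0 := by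
  simp only [one_smul]
  rw [← AddMonoidHom.map_finsum_mem _ _ (finite_set C), hC.finsum_eq_zero, map_zero]

lemma isRepresentation_toMatroid : X.toMatroid.IsRepresentation fun e => toReal (X.vec e) where
  add_bar := toReal_vec_add_toReal_vec_bar
  circuit _ hC := ⟨fun _ => 1, fun _ _ => one_pos, IsCircuit.finsum_toReal_eq_zero hC⟩
  indep A hA := by
    obtain ⟨a, b, hab, hsub⟩ := exists_subset_pair_of_indep hA
    exact ((LinearIndepOn.pair_iff _ (ne_of_det_ne_zero hab).symm).2
      (LinearIndependent.pair_iff.1 (linearIndependent_and_span_toReal hab).1)).mono hsub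
  span := by
    obtain ⟨a, b, hab⟩ := X.exists_unimodular
    rw [eq_top_iff, ← (linearIndependent_and_span_toReal hab.det_ne_zero).2,
      Matrix.range_cons_cons_empty]
    exact Submodule.span_mono (Set.pair_subset ⟨a, rfl⟩ ⟨b, rfl⟩)

lemma eq_two_of_isBasis_range {n : ℕ} {b : Fin n → X.carrier} (hb : Function.Injective b)
    (hbasis : X.toMatroid.IsBasis (Set.range b)) : n = 2 := by
  obtain ⟨x, y, hxy, hrange⟩ := isBasis_iff.1 hbasis
  calc n = (Set.range b).ncard := by
        rw [← Set.image_univ, Set.ncard_image_of_injective _ hb, Set.ncard_univ, Nat.card_fin]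
    _ = 2 := hrange ▸ Set.ncard_pair (ne_of_det_ne_zero hxy).symm

lemma isUnipotent_toMatroid : X.toMatroid.IsUnipotent fun e => toReal (X.vec e) := by
  refine ⟨isRepresentation_toMatroid, fun n ω b b' hb hb' hbasis hbasis' => ?_⟩
  obtain rfl := eq_two_of_isBasis_range hb hbasis
  have hvolume : ∀ b : Fin 2 → X.carrier, Function.Injective b →
      X.toMatroid.IsBasis (Set.range b) →
      |ω fun i => toReal (X.vec (b i))| = |ω (Pi.basisFun ℝ (Fin 2))| := by
    intro b hb hbasis
    have hdet : det (X.vec (b 0)) (X.vec (b 1)) ≠ 0 :=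
      det_ne_zero_of_indep hbasis.1 ⟨0, rfl⟩ ⟨1, rfl⟩ (hb.ne one_ne_zero)
    rw [← (unimodular_of_det_ne_zero hdet).abs_alternatingMap_toReal]
    congr! with i
    fin_cases i <;> rfl
  exact (hvolume b hb hbasis).trans (hvolume b' hb' hbasis').symm

lemma isRegular_toMatroid : X.toMatroid.IsRegular :=
  ⟨_, _, _, _, isUnipotent_toMatroid⟩

/-- A morphism of configurations is an equivariant injection which is induced by an integral
matrix. -/
@[ext]
structure Hom (X Y : VectorConfig.{u}) where
  /-- the underlying map -/
  toFun : X.carrier → Y.carrier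
  /-- the integral matrix -/
  mat : GL (Fin 2) ℤ
  injective : Function.Injective toFun
  map_bar : ∀ e, toFun (X.bar e) = Y.bar (toFun e)
  vec_map : ∀ e, Y.vec (toFun e) = act mat (X.vec e)

instance : Category.{u} VectorConfig.{u} where
  Hom X Y := Hom X Y
  id X := ⟨id, 1, Function.injective_id, fun _ => rfl, fun _ => by rw [map_one]; rfl⟩
  comp f g := ⟨g.toFun ∘ f.toFun, g.mat * f.mat, g.injective.comp f.injective,
    fun e => by rw [Function.comp_apply, f.map_bar, g.map_bar, Function.comp_apply],
    fun e => by rw [act_mul_apply, ← f.vec_map, ← g.vec_map, Function.comp_apply]⟩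
  id_comp f := Hom.ext rfl (mul_one _)
  comp_id f := Hom.ext rfl (one_mul _)
  assoc f g h := Hom.ext rfl (mul_assoc _ _ _).symm

lemma Hom.det_vec_map_ne_zero_iff (f : Hom X Y) (x y) :
    det (Y.vec (f.toFun x)) (Y.vec (f.toFun y)) ≠ 0 ↔ det (X.vec x) (X.vec y) ≠ 0 := by
  rw [f.vec_map, f.vec_map, det_act, mul_ne_zero_iff_left (isUnit_det_coe f.mat).ne_zero]

lemma IsCircuit.image {C} (hC : X.IsCircuit C) (f : Hom X Y) : Y.IsCircuit (f.toFun '' C) := by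
  rcases hC with ⟨x, hx, rfl⟩ | ⟨x, y, hx, hy, hxy, rfl⟩ | ⟨x, y, z, hxy, hxyz, rfl⟩
  · rw [Set.image_singleton]
    exact isCircuit_singleton (by rw [f.vec_map, hx, map_zero])
  · rw [Set.image_pair]
    refine isCircuit_pair ?_ (fun h => hy (f.injective (by rw [h, f.map_bar]))) ?_
    · rwa [f.vec_map, Ne, LinearEquiv.map_eq_zero_iff]
    · rw [f.vec_map, f.vec_map, ← map_add, hxy, map_zero]
  · rw [Set.image_insert_eq, Set.image_pair]
    refine isCircuit_triple ((f.det_vec_map_ne_zero_iff x y).2 hxy) ?_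
    rw [f.vec_map, f.vec_map, f.vec_map, ← map_add, ← map_add, hxyz, map_zero]

lemma IsCircuit.of_image {f : Hom X Y} {C} (hC : Y.IsCircuit (f.toFun '' C)) :
    X.IsCircuit C := by
  have hinj := f.injective.image_injective
  rcases hC with ⟨x, hx, hC⟩ | ⟨x, y, hx, hy, hxy, hC⟩ | ⟨x, y, z, hxy, hxyz, hC⟩
  · obtain ⟨x, -, rfl⟩ : x ∈ f.toFun '' C := by rw [hC]; simp
    obtain rfl : C = {x} := hinj (by rw [hC, Set.image_singleton])
    exact isCircuit_singleton (by rwa [f.vec_map, LinearEquiv.map_eq_zero_iff] at hx)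
  · obtain ⟨x, -, rfl⟩ : x ∈ f.toFun '' C := by rw [hC]; simp
    obtain ⟨y, -, rfl⟩ : y ∈ f.toFun '' C := by rw [hC]; simp
    obtain rfl : C = {x, y} := hinj (by rw [hC, Set.image_pair])
    rw [f.vec_map, Ne, LinearEquiv.map_eq_zero_iff] at hx
    rw [f.vec_map, f.vec_map, ← map_add, LinearEquiv.map_eq_zero_iff] at hxy
    exact isCircuit_pair hx (fun h => hy (by rw [h, f.map_bar])) hxy
  · obtain ⟨x, -, rfl⟩ : x ∈ f.toFun '' C := by rw [hC]; simp
    obtain ⟨y, -, rfl⟩ : y ∈ f.toFun '' C := by rw [hC]; simp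
    obtain ⟨z, -, rfl⟩ : z ∈ f.toFun '' C := by rw [hC]; simp
    obtain rfl : C = {x, y, z} := hinj (by rw [hC, Set.image_insert_eq, Set.image_pair])
    rw [f.vec_map, f.vec_map, f.vec_map, ← map_add, ← map_add,
      LinearEquiv.map_eq_zero_iff] at hxyz
    exact isCircuit_triple ((f.det_vec_map_ne_zero_iff x y).1 hxy) hxyz

lemma isCircuit_image_iff (f : Hom X Y) (C : Set X.carrier) :
    Y.IsCircuit (f.toFun '' C) ↔ X.IsCircuit C :=
  ⟨IsCircuit.of_image, fun hC => hC.image f⟩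

/-- The matroid of a configuration of vectors, as a functor. -/
def matroidFunctor : VectorConfig.{u} ⥤ RegularMatroidCat.{u} 2 where
  obj X := ⟨X.toMatroid, hasRank_toMatroid, isRegular_toMatroid⟩
  map f := ⟨⟨f.toFun, f.injective, f.map_bar, isCircuit_image_iff f⟩⟩

instance : matroidFunctor.{u}.Faithful where
  map_injective {X Y f g} h := by
    have hfun : f.toFun = g.toFun :=
      congr_arg (fun f => FreelyOrientedMatroid.Hom.toFun (InducedCategory.Hom.hom f)) h
    refine Hom.ext hfun ?_
    obtain ⟨a, b, hab⟩ := X.exists_unimodular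
    refine eq_of_act_eq hab ?_ ?_ <;> rw [← f.vec_map, ← g.vec_map, hfun]

lemma det_vec_map_ne_zero {F : X.carrier → Y.carrier} (hF : Function.Injective F)
    (hbar : ∀ e, F (X.bar e) = Y.bar (F e))
    (hcircuit : ∀ C, Y.IsCircuit (F '' C) → X.IsCircuit C) {a b : X.carrier}
    (hab : det (X.vec a) (X.vec b) ≠ 0) : det (Y.vec (F a)) (Y.vec (F b)) ≠ 0 := by
  have himage : F '' ({a, b} ∪ X.bar '' {a, b}) = {F a, F b} ∪ Y.bar '' {F a, F b} := by
    simp only [Set.image_union, Set.image_pair, hbar]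
  intro hdet
  obtain ⟨C, hC, hsub⟩ := exists_isCircuit_of_det_eq_zero hdet (hF.ne (ne_of_det_ne_zero hab))
    (fun h => ne_bar_of_det_ne_zero hab (hF (h.trans (hbar a).symm)))
  rw [← himage] at hsub
  obtain ⟨C, hCsub, rfl⟩ := Set.subset_image_iff.1 hsub
  exact not_subset_pair_union_bar hab (hcircuit C hC) hCsub

/- The defect `Y.vec (F x) - act g (X.vec x)` sums to zero over the circuit. -/
lemma vec_map_eq_act_of_isCircuit {F : X.carrier → Y.carrier} (hF : Function.Injective F)
    {g : GL (Fin 2) ℤ} {C} (hC : X.IsCircuit C) (hFC : Y.IsCircuit (F '' C)) {e} (he : e ∈ C)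
    (hg : ∀ x ∈ C, x ≠ e → Y.vec (F x) = act g (X.vec x)) :
    Y.vec (F e) = act g (X.vec e) := by
  have himage : ∑ᶠ x ∈ C, Y.vec (F x) = 0 := by
    rw [← finsum_mem_image hF.injOn, hFC.finsum_eq_zero]
  have hact : ∑ᶠ x ∈ C, act g (X.vec x) = 0 := by
    have hmap := (act g).toAddEquiv.toAddMonoidHom.map_finsum_mem X.vec (finite_set C)
    rw [hC.finsum_eq_zero, map_zero] at hmap
    exact hmap.symm
  refine sub_eq_zero.1 ?_
  calc Y.vec (F e) - act g (X.vec e) = ∑ᶠ x ∈ C, (Y.vec (F x) - act g (X.vec x)) := by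
        rw [← finsum_mem_singleton (f := fun x => Y.vec (F x) - act g (X.vec x)) (a := e)]
        refine finsum_mem_inter_support_eq' _ _ _ fun x hx => ⟨fun hxe => hxe ▸ he, fun hxC => ?_⟩
        by_contra hxe
        exact hx (sub_eq_zero.2 (hg x hxC hxe))
    _ = 0 := by rw [finsum_mem_sub_distrib _ _ (finite_set C), himage, hact, sub_zero]

lemma exists_vec_map_eq_act {F : X.carrier → Y.carrier} (hF : Function.Injective F)
    (hbar : ∀ e, F (X.bar e) = Y.bar (F e))
    (hcircuit : ∀ C, Y.IsCircuit (F '' C) ↔ X.IsCircuit C) :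
    ∃ g : GL (Fin 2) ℤ, ∀ e, Y.vec (F e) = act g (X.vec e) := by
  obtain ⟨a, b, hab⟩ := X.exists_unimodular
  obtain ⟨g, hga, hgb⟩ := exists_act_eq hab (unimodular_of_det_ne_zero
    (det_vec_map_ne_zero hF hbar (fun C => (hcircuit C).1) hab.det_ne_zero))
  have hmem : ∀ e ∈ ({a, b} ∪ X.bar '' {a, b} : Set X.carrier),
      Y.vec (F e) = act g (X.vec e) := by
    intro e he
    rcases mem_pair_union_bar.1 he with (rfl | rfl) | rfl | rfl
    · exact hga.symm
    · rw [hbar, Y.vec_bar, X.vec_bar, map_neg, hga]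
    · exact hgb.symm
    · rw [hbar, Y.vec_bar, X.vec_bar, map_neg, hgb]
  refine ⟨g, fun e => ?_⟩
  by_cases he : e ∈ ({a, b} ∪ X.bar '' {a, b} : Set X.carrier)
  · exact hmem e he
  obtain ⟨C, hC, heC, hsub⟩ := exists_isCircuit_mem hab.det_ne_zero he
  exact vec_map_eq_act_of_isCircuit hF hC ((hcircuit C).2 hC) heC
    fun x hx hxe => hmem x ((hsub hx).resolve_left hxe)

instance : matroidFunctor.{u}.Full where
  map_surjective {X Y} f := by
    obtain ⟨g, hg⟩ := exists_vec_map_eq_act f.hom.injective f.hom.map_bar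
      f.hom.image_mem_circuits_iff
    exact ⟨⟨f.hom.toFun, g, f.hom.injective, f.hom.map_bar, hg⟩, rfl⟩

end VectorConfig

/-! ### Integral coordinates of regular matroids -/

namespace FreelyOrientedMatroid

variable {M : FreelyOrientedMatroid.{u}} {V : Type v} [AddCommGroup V] [Module ℝ V]
  {ρ : M.carrier → V}

lemma bar_injective : Function.Injective M.bar := Function.Involutive.injective M.bar_bar

lemma mem_bar_image {C : Set M.carrier} {e} : e ∈ M.bar '' C ↔ M.bar e ∈ C :=
  ⟨by rintro ⟨f, hf, rfl⟩; rwa [M.bar_bar], fun h => ⟨_, h, M.bar_bar e⟩⟩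

lemma bar_notMem_of_mem_circuits {C} (hC : C ∈ M.circuits) {e} (he : e ∈ C) : M.bar e ∉ C :=
  fun hbar => Set.disjoint_left.1 (M.disjoint_bar C hC) he (mem_bar_image.2 hbar)

lemma exists_circuit_subset_of_not_indep {A : Set M.carrier} (hA : Disjoint A (M.bar '' A))
    (hdep : ¬ M.Indep A) : ∃ C ∈ M.circuits, C ⊆ A ∪ M.bar '' A := by
  by_contra! hC
  exact hdep ⟨hA, hC⟩

lemma indep_of_ssubset_circuit {A C : Set M.carrier} (hC : C ∈ M.circuits) (hAC : A ⊂ C) :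
    M.Indep A := by
  refine ⟨(M.disjoint_bar C hC).mono hAC.1 (Set.image_mono hAC.1), fun C' hC' hsub => ?_⟩
  have hmem_of_bar_mem : ∀ x ∈ C, M.bar x ∈ A ∪ M.bar '' A → x ∈ A := by
    rintro x hx (hbar | hbar)
    · exact absurd (hAC.1 hbar) (bar_notMem_of_mem_circuits hC hx)
    · exact bar_injective.mem_set_image.1 hbar
  have hmem_of_mem : ∀ x ∈ C, x ∈ A ∪ M.bar '' A → x ∈ A := fun x hx hxA =>
    hxA.resolve_right fun hbar =>
      bar_notMem_of_mem_circuits hC hx (hAC.1 (mem_bar_image.1 hbar))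
  rcases M.eq_or_eq_bar _ hC' _ hC
    (hsub.trans (Set.union_subset_union hAC.1 (Set.image_mono hAC.1))) with rfl | rfl
  · exact hAC.2 fun x hx => hmem_of_mem x hx (hsub hx)
  · exact hAC.2 fun x hx => hmem_of_bar_mem x hx (hsub ⟨x, hx, rfl⟩)

/- A circuit witnessing that `insert e B` is dependent meets `{e, M.bar e}` in exactly one
element. -/
lemma IsBasis.exists_circuit_of_notMem {B} (hB : M.IsBasis B) {e} (he : e ∉ B ∪ M.bar '' B) :
    ∃ C ∈ M.circuits, ∃ x ∈ C, (x = e ∨ x = M.bar e) ∧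
      ∀ y ∈ C, y ≠ x → y ∈ B ∪ M.bar '' B := by
  obtain ⟨heB, hebar⟩ := not_or.1 he
  have hdisj : Disjoint (insert e B) (M.bar '' insert e B) := by
    rw [Set.image_insert_eq, Set.disjoint_insert_left, Set.disjoint_insert_right]
    refine ⟨?_, fun h => hebar (mem_bar_image.2 h), hB.1.1⟩
    rintro (h | h)
    exacts [M.bar_ne e h.symm, hebar h]
  obtain ⟨C, hC, hsub⟩ := exists_circuit_subset_of_not_indep hdisj fun hindep =>
    heB (hB.2 hindep (Set.subset_insert _ _) (Set.mem_insert _ _))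
  have hcases : ∀ y ∈ C, (y = e ∨ y = M.bar e) ∨ y ∈ B ∪ M.bar '' B := by
    intro y hy
    rcases hsub hy with (h | h) | h
    · exact Or.inl (Or.inl h)
    · exact Or.inr (Or.inl h)
    · rw [Set.image_insert_eq] at h
      exact h.imp Or.inr Or.inr
  obtain ⟨x, hx, hxe⟩ : ∃ x ∈ C, x = e ∨ x = M.bar e := by
    by_contra! hne
    exact hB.1.2 C hC fun y hy =>
      (hcases y hy).resolve_left (not_or.2 (hne y hy))
  refine ⟨C, hC, x, hx, hxe, fun y hy hyx => (hcases y hy).resolve_left fun hye => ?_⟩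
  have hyx' : y ≠ M.bar x := fun h => bar_notMem_of_mem_circuits hC hx (h ▸ hy)
  rcases hxe with rfl | rfl
  · exact hye.elim hyx hyx'
  · rw [M.bar_bar] at hyx'
    exact hye.elim hyx' hyx

namespace IsRepresentation

lemma map_bar (hρ : M.IsRepresentation ρ) (e) : ρ (M.bar e) = -ρ e :=
  eq_neg_of_add_eq_zero_right (hρ.add_bar e)

lemma map_bar_mem_iff (hρ : M.IsRepresentation ρ) {W : Submodule ℝ V} {e} :
    ρ (M.bar e) ∈ W ↔ ρ e ∈ W := by
  rw [hρ.map_bar, neg_mem_iff]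

lemma map_mem_span_of_mem_union_bar (hρ : M.IsRepresentation ρ) {A : Set M.carrier} {e}
    (he : e ∈ A ∪ M.bar '' A) : ρ e ∈ Submodule.span ℝ (ρ '' A) := by
  rcases he with he | he
  · exact Submodule.subset_span ⟨e, he, rfl⟩
  · exact hρ.map_bar_mem_iff.1 (Submodule.subset_span ⟨_, mem_bar_image.1 he, rfl⟩)

lemma map_mem_of_mem_circuit (hρ : M.IsRepresentation ρ) {C} (hC : C ∈ M.circuits) {x}
    (hx : x ∈ C) {W : Submodule ℝ V} (hW : ∀ y ∈ C, y ≠ x → ρ y ∈ W) : ρ x ∈ W := by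
  have := M.finite
  obtain ⟨a, ha, hsum⟩ := hρ.circuit C hC
  rw [← Set.insert_sdiff_self_of_mem hx,
    finsum_mem_insert _ (fun h => h.2 rfl) (Set.toFinite _)] at hsum
  have hrest : ∑ᶠ y ∈ C \ {x}, a y • ρ y ∈ W :=
    finsum_mem_induction (· ∈ W) W.zero_mem (fun _ _ => W.add_mem)
      fun y hy => W.smul_mem _ (hW y hy.1 hy.2)
  rw [eq_neg_of_add_eq_zero_right hsum, neg_mem_iff] at hrest
  exact (W.smul_mem_iff (ha x hx).ne').1 hrest

lemma span_image_eq_top (hρ : M.IsRepresentation ρ) {B} (hB : M.IsBasis B) :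
    Submodule.span ℝ (ρ '' B) = ⊤ := by
  rw [eq_top_iff, ← hρ.span, Submodule.span_le]
  rintro _ ⟨e, rfl⟩
  by_cases he : e ∈ B ∪ M.bar '' B
  · exact hρ.map_mem_span_of_mem_union_bar he
  obtain ⟨C, hC, x, hx, hxe, hrest⟩ := hB.exists_circuit_of_notMem he
  have hρx := hρ.map_mem_of_mem_circuit hC hx fun y hy hyx =>
    hρ.map_mem_span_of_mem_union_bar (hrest y hy hyx)
  rcases hxe with rfl | rfl
  exacts [hρx, hρ.map_bar_mem_iff.1 hρx]

lemma indep_of_linearIndepOn (hρ : M.IsRepresentation ρ) {A : Set M.carrier}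
    (hA : LinearIndepOn ℝ ρ A) : M.Indep A := by
  refine ⟨Set.disjoint_left.2 fun x hx hbar => ?_, fun C hC hsub => ?_⟩
  · have hmem : M.bar x ∈ A \ {x} := ⟨mem_bar_image.1 hbar, M.bar_ne x⟩
    exact hA.notMem_span hx (hρ.map_bar_mem_iff.1 (Submodule.subset_span ⟨_, hmem, rfl⟩))
  obtain ⟨x, hx⟩ := M.nonempty_of_circuit C hC
  obtain ⟨e, he, hxe⟩ : ∃ e ∈ A, x = e ∨ x = M.bar e := by
    rcases hsub hx with h | ⟨e, he, rfl⟩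
    exacts [⟨x, h, Or.inl rfl⟩, ⟨e, he, Or.inr rfl⟩]
  have hrest : ∀ y ∈ C, y ≠ x → ρ y ∈ Submodule.span ℝ (ρ '' (A \ {e})) := by
    intro y hy hyx
    have hyx' : M.bar y ≠ x := fun h => bar_notMem_of_mem_circuits hC hy (h ▸ hx)
    have hye : y ≠ e ∧ M.bar y ≠ e := by
      rcases hxe with rfl | rfl
      · exact ⟨hyx, hyx'⟩
      · exact ⟨fun h => hyx' (h ▸ rfl), fun h => hyx (by rw [← h, M.bar_bar])⟩
    exact hρ.map_mem_span_of_mem_union_bar ((hsub hy).imp (fun h => ⟨h, hye.1⟩) fun h =>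
      mem_bar_image.2 ⟨mem_bar_image.1 h, hye.2⟩)
  have hρx := hρ.map_mem_of_mem_circuit hC hx hrest
  rcases hxe with rfl | rfl
  exacts [hA.notMem_span he hρx, hA.notMem_span he (hρ.map_bar_mem_iff.1 hρx)]

lemma isBasis_of_linearIndepOn_of_span (hρ : M.IsRepresentation ρ) {B : Set M.carrier}
    (hB : LinearIndepOn ℝ ρ B) (hspan : Submodule.span ℝ (ρ '' B) = ⊤) : M.IsBasis B := by
  refine ⟨hρ.indep_of_linearIndepOn hB, fun A hA hBA x hx => ?_⟩
  by_contra hxB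
  refine ((hρ.indep A hA).mono (Set.insert_subset hx hBA)).notMem_span_of_insert hxB ?_
  rw [hspan]
  exact Submodule.mem_top

end IsRepresentation
end FreelyOrientedMatroid

section Dependence

variable {ι R V : Type*} [CommRing R] [AddCommGroup V] [Module R V] {ρ : ι → V} {C : Set ι}

lemma linearIndepOn_eq_zero_of_finsum_smul_eq_zero (hC : LinearIndepOn R ρ C) (hfin : C.Finite)
    {c : ι → R} (hc : ∑ᶠ x ∈ C, c x • ρ x = 0) {x} (hx : x ∈ C) : c x = 0 := by
  rw [finsum_mem_eq_finite_toFinset_sum _ hfin] at hc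
  exact linearIndepOn_iff'.1 hC hfin.toFinset c hfin.coe_toFinset.subset hc x
    (hfin.mem_toFinset.2 hx)

/- The combination of the two relations that vanishes at `e` is a relation on `C \ {e}`. -/
lemma mul_eq_mul_of_finsum_smul_eq_zero (hfin : C.Finite)
    (hproper : ∀ A ⊂ C, LinearIndepOn R ρ A) {a c : ι → R} (ha : ∑ᶠ x ∈ C, a x • ρ x = 0)
    (hc : ∑ᶠ x ∈ C, c x • ρ x = 0) {e x} (he : e ∈ C) (hx : x ∈ C) : a e * c x = c e * a x := by
  obtain rfl | hxe := eq_or_ne x e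
  · exact mul_comm _ _
  have hsum : ∑ᶠ y ∈ C, (a e * c y - c e * a y) • ρ y = 0 := by
    simp only [sub_smul, mul_smul]
    rw [finsum_mem_sub_distrib _ _ hfin, ← smul_finsum_mem hfin, ← smul_finsum_mem hfin, ha, hc,
      smul_zero, smul_zero, sub_zero]
  rw [← Set.insert_sdiff_self_of_mem he,
    finsum_mem_insert _ (show e ∉ C \ {e} from fun h => h.2 rfl) hfin.sdiff,
    mul_comm, sub_self, zero_smul, zero_add] at hsum
  exact sub_eq_zero.1 (linearIndepOn_eq_zero_of_finsum_smul_eq_zero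
    (hproper _ (Set.sdiff_singleton_ssubset.2 he)) hfin.sdiff hsum ⟨hx, hxe⟩)

end Dependence

namespace FreelyOrientedMatroid

variable {M : FreelyOrientedMatroid.{u}} {V : Type v} [AddCommGroup V] [Module ℝ V]
  {ρ : M.carrier → V}

namespace IsRepresentation

/- Both circuits carry a relation among the elements of `C`; these are proportional, and the first
one is positive. -/
lemma eq_of_mem_circuits (hρ : M.IsRepresentation ρ) {C : Set M.carrier}
    (hdisj : Disjoint C (M.bar '' C)) {a : M.carrier → ℝ} (ha : ∀ e ∈ C, 0 < a e)
    (hsum : ∑ᶠ e ∈ C, a e • ρ e = 0) (hproper : ∀ A ⊂ C, LinearIndepOn ℝ ρ A) {C'}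
    (hC' : C' ∈ M.circuits) (hsub : C' ⊆ C ∪ M.bar '' C) {e} (he : e ∈ C) (he' : e ∈ C') :
    C' = C := by
  have := M.finite
  obtain ⟨a', ha', hsum'⟩ := hρ.circuit C' hC'
  set c : M.carrier → ℝ := fun x => C'.indicator a' x - C'.indicator a' (M.bar x) with hc
  have hcsum : ∑ᶠ x ∈ C, c x • ρ x = 0 := by
    rw [← hsum', finsum_mem_eq_finsum_mem_indicator_add bar_injective hdisj hsub]
    refine finsum_mem_congr rfl fun x _ => ?_
    by_cases hx : x ∈ C' <;> by_cases hbar : M.bar x ∈ C' <;>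
      simp [hc, hx, hbar, hρ.map_bar, add_smul, sub_eq_add_neg]
  have hce : 0 < c e := by
    simpa only [hc, Set.indicator_of_mem he',
      Set.indicator_of_notMem (bar_notMem_of_mem_circuits hC' he'), sub_zero] using ha' e he'
  have hmem : ∀ x ∈ C, x ∈ C' := by
    intro x hx
    by_contra hxC'
    have hcx : 0 < c x := by
      refine pos_of_mul_pos_right ?_ (ha e he).le
      rw [mul_eq_mul_of_finsum_smul_eq_zero C.toFinite hproper hsum hcsum he hx]
      exact mul_pos hce (ha x hx)
    rw [hc] at hcx
    simp only [Set.indicator_of_notMem hxC', zero_sub, Left.neg_pos_iff] at hcx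
    exact hcx.not_ge (Set.indicator_nonneg (fun y hy => (ha' y hy).le) _)
  refine Set.Subset.antisymm (fun x hx => (hsub hx).resolve_right fun hbar => ?_) hmem
  exact bar_notMem_of_mem_circuits hC' hx (hmem _ (mem_bar_image.1 hbar))

lemma mem_circuits_iff (hρ : M.IsRepresentation ρ) {C : Set M.carrier} :
    C ∈ M.circuits ↔ C.Nonempty ∧ Disjoint C (M.bar '' C) ∧
      (∃ a : M.carrier → ℝ, (∀ e ∈ C, 0 < a e) ∧ ∑ᶠ e ∈ C, a e • ρ e = 0) ∧
      ∀ A ⊂ C, LinearIndepOn ℝ ρ A := by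
  refine ⟨fun hC => ⟨M.nonempty_of_circuit C hC, M.disjoint_bar C hC, hρ.circuit C hC,
    fun A hA => hρ.indep A (indep_of_ssubset_circuit hC hA)⟩, ?_⟩
  rintro ⟨⟨e, he⟩, hdisj, ⟨a, ha, hsum⟩, hproper⟩
  have := M.finite
  obtain ⟨C', hC', hsub⟩ := exists_circuit_subset_of_not_indep hdisj fun hindep =>
    (ha e he).ne' (linearIndepOn_eq_zero_of_finsum_smul_eq_zero (hρ.indep C hindep) C.toFinite
      hsum he)
  obtain ⟨x, hx⟩ := M.nonempty_of_circuit C' hC'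
  rcases hsub hx with hxC | hxC
  · exact hρ.eq_of_mem_circuits hdisj ha hsum hproper hC' hsub hxC hx ▸ hC'
  · have hbarC' := M.bar_mem_circuits C' hC'
    have hbar_sub : M.bar '' C' ⊆ C ∪ M.bar '' C := by
      rintro _ ⟨y, hy, rfl⟩
      exact (hsub hy).symm.imp mem_bar_image.1 fun h => ⟨y, h, rfl⟩
    exact hρ.eq_of_mem_circuits hdisj ha hsum hproper hbarC' hbar_sub (mem_bar_image.1 hxC)
      ⟨x, hx, rfl⟩ ▸ hbarC'

end IsRepresentation

lemma IsUnipotent.linearEquiv_comp (hρ : M.IsUnipotent ρ) {W : Type*} [AddCommGroup W]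
    [Module ℝ W] (φ : V ≃ₗ[ℝ] W) : M.IsUnipotent fun e => φ (ρ e) where
  left :=
    { add_bar := fun e => by rw [← map_add, hρ.1.add_bar, map_zero]
      circuit := fun C hC => by
        have := M.finite
        obtain ⟨a, ha, hsum⟩ := hρ.1.circuit C hC
        refine ⟨a, ha, ?_⟩
        have hmap := φ.toAddEquiv.toAddMonoidHom.map_finsum_mem (fun e => a e • ρ e) C.toFinite
        rw [hsum, map_zero] at hmap
        simp only [← map_smul]
        exact hmap.symm
      indep := fun A hA => (hρ.1.indep A hA).map_injOn φ.toLinearMap φ.injective.injOn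
      span := by
        have hmap := (Submodule.span_image φ.toLinearMap (s := Set.range ρ)).symm
        rw [hρ.1.span, Submodule.map_top, LinearEquiv.range, ← Set.range_comp] at hmap
        exact hmap.symm }
  right n ω b b' hb hb' hbasis hbasis' :=
    hρ.2 n (ω.compLinearMap φ.toLinearMap) b b' hb hb' hbasis hbasis'

end FreelyOrientedMatroid

namespace FreelyOrientedMatroid

variable {M : FreelyOrientedMatroid.{u}} {r : ℕ}

/- In the coordinates given by a basis of `M`. -/
lemma IsRegular.exists_isUnipotent_eq_one (hM : M.IsRegular) (hr : M.HasRank r) :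
    ∃ (ρ : M.carrier → Fin r → ℝ) (b : Fin r → M.carrier), M.IsUnipotent ρ ∧
      Matrix.of (fun i => ρ (b i)) = 1 := by
  have := M.finite
  obtain ⟨V, _, _, ρ, hρ⟩ := hM
  obtain ⟨B, hB, hcard⟩ := hr
  let b : Fin r → M.carrier := fun i => (Finite.equivFinOfCardEq hcard).symm i
  have hrange : Set.range b = B := by
    rw [Set.range_comp' Subtype.val, Equiv.range_eq_univ, Set.image_univ, Subtype.range_coe]
  have hindep : LinearIndependent ℝ fun i => ρ (b i) :=
    LinearIndependent.comp (hρ.1.indep B hB.1) _ (Equiv.injective _)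
  have hspan : Submodule.span ℝ (Set.range fun i => ρ (b i)) = ⊤ := by
    rw [Set.range_comp' ρ b, hrange]
    exact hρ.1.span_image_eq_top hB
  let β := Module.Basis.mk hindep hspan.ge
  refine ⟨fun e => β.equivFun (ρ e), b, hρ.linearEquiv_comp β.equivFun, ?_⟩
  have hβ : ∀ i, ρ (b i) = β i := fun i =>
    (Module.Basis.mk_apply hindep hspan.ge i).symm
  ext i j
  simp only [Matrix.of_apply, hβ, β.equivFun_self, Matrix.one_apply]

section

variable {ρ : M.carrier → Fin r → ℝ} {b : Fin r → M.carrier}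

lemma IsRepresentation.injective_and_isBasis_of_det_ne_zero (hρ : M.IsRepresentation ρ)
    (hb : (Matrix.of fun i => ρ (b i)).det ≠ 0) :
    Function.Injective b ∧ M.IsBasis (Set.range b) := by
  obtain ⟨hindep, hspan⟩ : LinearIndependent ℝ (fun i => ρ (b i)) ∧
      Submodule.span ℝ (Set.range fun i => ρ (b i)) = ⊤ := by
    rw [Module.Basis.is_basis_iff_det (Pi.basisFun ℝ (Fin r)), Pi.basisFun_det_apply]
    exact isUnit_iff_ne_zero.2 hb
  have hinj : Function.Injective b := Function.Injective.of_comp (f := ρ) hindep.injective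
  refine ⟨hinj, hρ.isBasis_of_linearIndepOn_of_span ((linearIndepOn_range_iff hinj ρ).2 hindep) ?_⟩
  rwa [← Set.range_comp]

lemma IsUnipotent.det_eq_zero_or_abs_eq_one (hρ : M.IsUnipotent ρ)
    (hb : Matrix.of (fun i => ρ (b i)) = 1) (c : Fin r → M.carrier) :
    (Matrix.of fun i => ρ (c i)).det = 0 ∨ |(Matrix.of fun i => ρ (c i)).det| = 1 := by
  refine or_iff_not_imp_left.2 fun hdet => ?_
  obtain ⟨hc, hcbasis⟩ := hρ.1.injective_and_isBasis_of_det_ne_zero hdet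
  obtain ⟨hb', hbasis⟩ := hρ.1.injective_and_isBasis_of_det_ne_zero (b := b) (by simp [hb])
  calc |(Matrix.of fun i => ρ (c i)).det|
      = |(Matrix.of fun i => ρ (b i)).det| :=
        hρ.2 r Matrix.detRowAlternating c b hc hb' hcbasis hbasis
    _ = 1 := by rw [hb, Matrix.det_one, abs_one]

/- The coordinate is the determinant of the standard basis with one vector replaced. -/
lemma IsUnipotent.apply_eq_zero_or_abs_eq_one (hρ : M.IsUnipotent ρ)
    (hb : Matrix.of (fun i => ρ (b i)) = 1) (e : M.carrier) (i : Fin r) :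
    ρ e i = 0 ∨ |ρ e i| = 1 := by
  have hupdate : Matrix.of (fun j => ρ (Function.update b i e j)) =
      (1 : Matrix (Fin r) (Fin r) ℝ).transpose.updateRow i (ρ e) := by
    rw [Matrix.transpose_one, ← hb]
    exact funext fun j => Function.apply_update (fun _ => ρ) b i e j
  have hdet : (Matrix.of fun j => ρ (Function.update b i e j)).det = ρ e i := by
    rw [hupdate, ← Matrix.cramer_transpose_apply, Matrix.transpose_transpose, Matrix.cramer_one,
      Module.End.one_apply]
  exact hdet ▸ hρ.det_eq_zero_or_abs_eq_one hb (Function.update b i e)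

end

lemma exists_integral_representation (hM : M.IsRegular) (hr : M.HasRank 2) :
    ∃ χ : M.carrier → Fin 2 → ℤ, M.IsRepresentation (fun e => toReal (χ e)) ∧
      (∀ e f, det (χ e) (χ f) = 0 ∨ Unimodular (χ e) (χ f)) ∧
      ∃ e f, Unimodular (χ e) (χ f) := by
  obtain ⟨ρ, b, hρ, hb⟩ := hM.exists_isUnipotent_eq_one hr
  have hint : ∀ e, ∃ v, toReal v = ρ e := by
    intro e
    have hcoord : ∀ i, ∃ n : ℤ, (n : ℝ) = ρ e i := by
      intro i
      rcases hρ.apply_eq_zero_or_abs_eq_one hb e i with h | h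
      · exact ⟨0, by rw [h, Int.cast_zero]⟩
      · exact ((abs_eq zero_le_one).1 h).elim (fun h => ⟨1, by rw [h, Int.cast_one]⟩)
          fun h => ⟨-1, by rw [h, Int.cast_neg, Int.cast_one]⟩
    choose v hv using hcoord
    exact ⟨v, funext hv⟩
  choose χ hχ using hint
  have hdet : ∀ c : Fin 2 → M.carrier,
      ((det (χ (c 0)) (χ (c 1)) : ℤ) : ℝ) = (Matrix.of fun i => ρ (c i)).det := by
    intro c
    rw [← basisDet_toReal, hχ, hχ, Pi.basisFun_det_apply, Matrix.det_fin_two, Matrix.det_fin_two]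
    rfl
  have hunimodular : ∀ c : Fin 2 → M.carrier, |(Matrix.of fun i => ρ (c i)).det| = 1 →
      Unimodular (χ (c 0)) (χ (c 1)) := by
    intro c hc
    rw [← hdet] at hc
    exact unimodular_iff_isUnit.2 (Int.isUnit_iff_abs_eq.2 (by exact_mod_cast hc))
  refine ⟨χ, by simpa only [hχ] using hρ.1, fun e f => ?_, b 0, b 1, hunimodular b (by simp [hb])⟩
  refine (hρ.det_eq_zero_or_abs_eq_one hb ![e, f]).imp (fun h => ?_)
    (hunimodular ![e, f])
  rw [← hdet] at h
  exact_mod_cast h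

end FreelyOrientedMatroid

namespace VectorConfig

lemma exists_toMatroid_eq {M : FreelyOrientedMatroid.{u}} (hM : M.IsRegular) (hr : M.HasRank 2) :
    ∃ X : VectorConfig.{u}, X.toMatroid = M := by
  obtain ⟨χ, hχ, hdet, hex⟩ := FreelyOrientedMatroid.exists_integral_representation hM hr
  have hneg : ∀ e, χ (M.bar e) = -χ e := by
    intro e
    refine eq_neg_of_add_eq_zero_right (funext fun i => ?_)
    have h : ((χ e i : ℤ) : ℝ) + χ (M.bar e) i = 0 := congr_fun (hχ.add_bar e) i
    exact_mod_cast h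
  let X : VectorConfig.{u} := ⟨M.carrier, M.finite, M.bar, M.bar_bar, M.bar_ne, χ, hneg, hdet, hex⟩
  have hcircuits : {C | X.IsCircuit C} = M.circuits := Set.ext fun C =>
    X.isRepresentation_toMatroid.mem_circuits_iff.trans hχ.mem_circuits_iff.symm
  refine ⟨X, ?_⟩
  cases M
  simp only [toMatroid, FreelyOrientedMatroid.mk.injEq, heq_eq_eq]
  exact ⟨rfl, rfl, hcircuits⟩

instance : matroidFunctor.{u}.EssSurj where
  mem_essImage N := by
    obtain ⟨X, h⟩ := exists_toMatroid_eq N.property.2 N.property.1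
    exact ⟨X, ⟨eqToIso (ObjectProperty.FullSubcategory.ext h)⟩⟩

instance : matroidFunctor.{u}.IsEquivalence where

end VectorConfig

/-! ### Vector configurations and the homotopy orbit category -/

section UniverseLift

attribute [local instance] uliftCategory

lemma nonempty_homeomorph_classifyingSpace_uLift (C : Type u) [Category.{v} C] :
    Nonempty (classifyingSpace C ≃ₜ classifyingSpace (ULiftHom.{w} (ULift.{w'} C))) :=
  nonempty_homeomorph_toTop_of_equiv (fun _ =>
    { toFun := fun x => (x : ComposableArrows C _) ⋙ ULift.upFunctor ⋙ ULiftHom.up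
      invFun := fun x => (x : ComposableArrows (ULiftHom.{w} (ULift.{w'} C)) _) ⋙
        ULiftHom.down ⋙ ULift.downFunctor
      left_inv := fun _ => rfl
      right_inv := fun _ => rfl }) fun _ _ => rfl

end UniverseLift

lemma Farey.IsUnimodularSystem.finite {E : Set (Fin 2 → ℤ)} (hE : IsUnimodularSystem E) :
    E.Finite := by
  obtain ⟨v, hv, w, hw, h⟩ := hE.exists_unimodular
  rcases hE.eq_edge_or_triangle h hv hw with h | h | h <;> rw [h] <;>
    simp only [edge, triangle, Set.finite_insert, Set.finite_singleton]

namespace VectorConfig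

/-- The nonzero vectors of a configuration. -/
def support (X : VectorConfig.{u}) : IR 2 :=
  ⟨{v | v ≠ 0 ∧ ∃ x, X.vec x = v}, (isUnimodularSystem_iff _).1
    { zero_notMem := fun h => h.1 rfl
      neg_mem_iff := by
        have hneg : ∀ v : Fin 2 → ℤ, (v ≠ 0 ∧ ∃ x, X.vec x = v) → -v ≠ 0 ∧ ∃ x, X.vec x = -v := by
          rintro _ ⟨h, x, rfl⟩
          exact ⟨neg_ne_zero.2 h, X.bar x, X.vec_bar x⟩
        exact fun v => ⟨hneg v, fun h => neg_neg v ▸ hneg _ h⟩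
      unimodular := by
        rintro _ ⟨-, x, rfl⟩ _ ⟨-, y, rfl⟩
        exact X.det_eq_zero_or_unimodular x y
      exists_unimodular := by
        obtain ⟨x, y, h⟩ := X.exists_unimodular
        exact ⟨_, ⟨h.left_ne_zero, x, rfl⟩, _, ⟨h.right_ne_zero, y, rfl⟩, h⟩ }⟩

/-- The functor sending a configuration to the set of its nonzero vectors, and a morphism to its
matrix. -/
def supportFunctor : VectorConfig.{u} ⥤ HomotopyOrbit actionIR where
  obj X := ⟨X.support⟩
  map f := ⟨f.mat, by
    rintro _ ⟨_, ⟨h, x, rfl⟩, rfl⟩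
    exact ⟨(map_ne_zero_iff _ (act f.mat).injective).2 h, f.toFun x, f.vec_map x⟩⟩
  map_id _ := rfl
  map_comp _ _ := rfl

/-- The tautological configuration of the elements of `E`, each of which represents itself. -/
def tautological (E : IR 2) : VectorConfig.{u} where
  carrier := ULift.{u} E.1
  finite := by
    have := (isUnimodularSystem E).finite.to_subtype
    infer_instance
  bar x := ⟨-x.down.1, (E.2.2.1 _).1 x.down.2⟩
  bar_bar _ := ULift.ext _ _ (Subtype.ext (neg_neg _))
  bar_ne x h := by
    have hneg : -x.down.1 = x.down.1 := congr_arg (fun y : ULift.{u} E.1 => y.down.1) h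
    exact E.2.1 (Set.mem_of_eq_of_mem (neg_eq_self.1 hneg).symm x.down.2)
  vec x := x.down.1
  vec_bar _ := rfl
  det_eq_zero_or_unimodular x y :=
    (isUnimodularSystem E).unimodular _ x.down.2 _ y.down.2
  exists_unimodular := by
    obtain ⟨v, hv, w, hw, h⟩ := (isUnimodularSystem E).exists_unimodular
    exact ⟨⟨v, hv⟩, ⟨w, hw⟩, h⟩

/-- The tautological configuration as a functor; a morphism acts on the vectors by its matrix. -/
noncomputable def tautologicalFunctor : HomotopyOrbit actionIR ⥤ VectorConfig.{u} where
  obj E := tautological E.pt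
  map {_ F} g :=
    { toFun := fun x => ⟨act g.1 x.down.1, g.2 ⟨_, x.down.2, rfl⟩⟩
      mat := g.1
      injective := fun _ _ h => ULift.ext _ _ (Subtype.ext ((act g.1).injective
        (congr_arg (fun y : ULift.{u} F.pt.1 => y.down.1) h)))
      map_bar := fun _ => ULift.ext _ _ (Subtype.ext (map_neg (act g.1) _))
      vec_map := fun _ => rfl }
  map_id _ := Hom.ext (funext fun x => ULift.ext _ _ (Subtype.ext
    (congr_fun (congr_arg DFunLike.coe (map_one act)) x.down.1))) rfl
  map_comp _ _ := Hom.ext (funext fun _ => ULift.ext _ _ (Subtype.ext (act_mul_apply _ _ _))) rfl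

/-- The disjoint union of a configuration and of the tautological configuration of its nonzero
vectors. Both summands embed naturally, which relates `supportFunctor ⋙ tautologicalFunctor` to the
identity. -/
def sum (X : VectorConfig.{u}) : VectorConfig.{u} where
  carrier := X.carrier ⊕ (tautological.{u} X.support).carrier
  finite := by
    have := X.finite
    have := (tautological.{u} X.support).finite
    infer_instance
  bar := Sum.map X.bar (tautological X.support).bar
  bar_bar := by
    rintro (x | x)
    exacts [congr_arg Sum.inl (X.bar_bar x), congr_arg Sum.inr ((tautological _).bar_bar x)]
  bar_ne := by
    rintro (x | x) h
    exacts [X.bar_ne x (Sum.inl_injective h), (tautological _).bar_ne x (Sum.inr_injective h)]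
  vec := Sum.elim X.vec (tautological X.support).vec
  vec_bar := by
    rintro (x | x)
    exacts [X.vec_bar x, rfl]
  det_eq_zero_or_unimodular := by
    have hvec : ∀ x, ∃ y, X.vec y = Sum.elim X.vec (tautological.{u} X.support).vec x := by
      rintro (x | x)
      exacts [⟨x, rfl⟩, x.down.2.2]
    intro x y
    obtain ⟨x', hx⟩ := hvec x
    obtain ⟨y', hy⟩ := hvec y
    exact hx ▸ hy ▸ X.det_eq_zero_or_unimodular x' y'
  exists_unimodular := by
    obtain ⟨x, y, h⟩ := X.exists_unimodular
    exact ⟨Sum.inl x, Sum.inl y, h⟩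

/-- The functoriality of `sum`. -/
noncomputable def sumFunctor : VectorConfig.{u} ⥤ VectorConfig.{u} where
  obj X := X.sum
  map f :=
    { toFun := Sum.map f.toFun ((supportFunctor ⋙ tautologicalFunctor).map f).toFun
      mat := f.mat
      injective := f.injective.sumMap ((supportFunctor ⋙ tautologicalFunctor).map f).injective
      map_bar := by
        rintro (x | x)
        · exact congr_arg Sum.inl (f.map_bar x)
        · exact congr_arg Sum.inr (((supportFunctor ⋙ tautologicalFunctor).map f).map_bar x)
      vec_map := by
        rintro (x | x)
        exacts [f.vec_map x, rfl] }
  map_id X := Hom.ext (by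
    funext x
    rcases x with x | x
    · rfl
    · exact congr_arg Sum.inr (congr_fun (congr_arg Hom.toFun
        ((supportFunctor ⋙ tautologicalFunctor).map_id X)) x)) rfl
  map_comp f g := Hom.ext (by
    funext x
    rcases x with x | x
    · rfl
    · exact congr_arg Sum.inr (congr_fun (congr_arg Hom.toFun
        ((supportFunctor ⋙ tautologicalFunctor).map_comp f g)) x)) rfl

/-- The inclusion of the first summand. -/
noncomputable def inlSum : 𝟭 VectorConfig.{u} ⟶ sumFunctor where
  app _ := ⟨Sum.inl, 1, Sum.inl_injective, fun _ => rfl, fun _ => by rw [map_one]; rfl⟩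
  naturality _ _ _ := Hom.ext rfl ((one_mul _).trans (mul_one _).symm)

/-- The inclusion of the second summand. -/
noncomputable def inrSum : supportFunctor.{u} ⋙ tautologicalFunctor.{u} ⟶ sumFunctor where
  app _ := ⟨Sum.inr, 1, Sum.inr_injective, fun _ => rfl, fun _ => by rw [map_one]; rfl⟩
  naturality _ _ _ := Hom.ext rfl ((one_mul _).trans (mul_one _).symm)

/-- The inclusion of the set of nonzero vectors of the tautological configuration of `E` in `E`. -/
noncomputable def supportTautological :
    tautologicalFunctor.{u} ⋙ supportFunctor.{u} ⟶ 𝟭 (HomotopyOrbit actionIR) where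
  app _ := ⟨1, by
    rw [map_one]
    rintro _ ⟨-, x, rfl⟩
    exact x.down.2⟩
  naturality _ _ _ := Subtype.ext ((one_mul _).trans (mul_one _).symm)

section

attribute [local instance] uliftCategory

theorem nonempty_homotopyEquiv_homotopyOrbit :
    Nonempty (classifyingSpace VectorConfig.{u} ≃ₕ
      classifyingSpace (HomotopyOrbit actionIR)) := by
  obtain ⟨h⟩ :=
    nonempty_homeomorph_classifyingSpace_uLift.{0, 0, u, u + 1} (HomotopyOrbit actionIR)
  let e : HomotopyOrbit actionIR ≌ ULiftHom.{u} (ULift.{u + 1} (HomotopyOrbit actionIR)) :=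
    ULiftHomULiftCategory.equiv _
  refine ⟨ContinuousMap.HomotopyEquiv.trans ?_ h.symm.toHomotopyEquiv⟩
  refine classifyingHomotopyEquiv (supportFunctor ⋙ e.functor) (e.inverse ⋙ tautologicalFunctor)
    ?_ ?_
  · have toSum : (supportFunctor ⋙ e.functor) ⋙ (e.inverse ⋙ tautologicalFunctor) ⟶
        sumFunctor.{u} :=
      Functor.whiskerRight (Functor.whiskerLeft supportFunctor e.unitInv) tautologicalFunctor ≫
        inrSum
    exact (classifyingMap_homotopic toSum).trans (classifyingMap_homotopic inlSum).symm
  · have toId : (e.inverse ⋙ tautologicalFunctor.{u}) ⋙ (supportFunctor ⋙ e.functor) ⟶ 𝟭 _ :=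
      Functor.whiskerRight (Functor.whiskerLeft e.inverse supportTautological) e.functor ≫
        e.counit
    exact classifyingMap_homotopic toId

end

theorem nonempty_homotopyEquiv_regularMatroidCat :
    Nonempty (classifyingSpace (RegularMatroidCat.{u} 2) ≃ₕ
      classifyingSpace (SingleObj (GL (Fin 2) ℤ))) := by
  obtain ⟨toOrbit⟩ := nonempty_homotopyEquiv_homotopyOrbit.{u}
  obtain ⟨toGL⟩ := HomotopyOrbit.nonempty_homotopyEquiv_of_rootedTreePoset actionIR rootedTreePoset
  exact ⟨((classifyingHomotopyEquivOfEquivalence matroidFunctor.asEquivalence).symm.trans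
    toOrbit).trans toGL⟩

end VectorConfig

/-- `|IR(2,ℤ)|` is contractible; it is an infinite tree: the order complex of `IR(2,ℤ)` has no
simplices of dimension at least two, infinitely many vertices, and its graph is a tree. Moreover
`BR(2,ℤ)` is homotopy equivalent to `BGL(2,ℤ)`. -/
theorem mainTheorem5 :
    ContractibleSpace (classifyingSpace (IR 2)) ∧
    ((¬ ∃ E₁ E₂ E₃ : IR 2, E₁ < E₂ ∧ E₂ < E₃) ∧
      Infinite (IR 2) ∧ (comparabilityGraph (IR 2)).IsTree) ∧
    Nonempty (classifyingSpace (RegularMatroidCat.{u} 2) ≃ₕ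
      classifyingSpace (SingleObj (GL (Fin 2) ℤ))) := by
  refine ⟨Farey.rootedTreePoset.contractibleSpace, ⟨?_, Farey.infinite_IR,
    Farey.rootedTreePoset.isTree⟩, VectorConfig.nonempty_homotopyEquiv_regularMatroidCat⟩
  rintro ⟨E₁, E₂, E₃, h, h'⟩
  exact Farey.rootedTreePoset.not_chain _ _ _ h h'
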